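/- **Theorem 4 (Consistency).** Let $d\ge 1$, let $\mathcal Z\subset\mathbb R$ be bounded, $\mathcal X\subset\mathbb R^d$, and let $z_0$ be an interior point of $\mathcal Z$. Let $(Y_i(\cdot),Z_i,\mathbf X_i)$, $i=1,2,\dots$, be i.i.d., where $Z_i\in\mathcal Z$ is the exposure, $\mathbf X_i\in\mathcal X$ the covariate and $Y_i(z)$, $z\in\mathcal Z$, the potential outcomes; put $\mu_{\mathbf x}(z)=\mathbb E[Y_i(z)\mid \mathbf X_i=\mathbf x]$ and $\delta(z_0)=\mathbb E[Y_i'(z_0)]$. Assume: 1. (Consistency) the observed outcome $Y_i$ satisfies $Y_i=Y_i(z)$ whenever $Z_i=z$; 2. (Local weak confoundedness) there is $r>0$ such that for all $z\in\mathcal Z$ the conditional law of $Y_i(z)$ given $(Z_i,\mathbf X_i)$ equals its conditional law given $\mathbf X_i$ almost surely on $\{|Z_i-z|\le r\}$; 3. (Strict overlap) $Z_i$ has a conditional Lebesgue density given $\mathbf X_i$ with $f_{Z_i\mid\mathbf X_i}(z\mid\mathbf x)\ge\zeta$ for all $z\in\mathcal Z$, $\mathbf x\in\mathcal X$ and some constant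 $\zeta>0$; 4. (Smoothness) almost surely $z\mapsto Y_i(z)$, and for every $\mathbf x\in\mathcal X$ a version of $z\mapsto\mu_{\mathbf x}(z)$, is differentiable on $\mathcal Z$ with continuous derivative bounded by a constant $C$ (not depending on $i$, $\mathbf x$, $z$ or the realization); 5. (Regularity) $\mathcal X$ is bounded and $\mathbf X_i$ has a bounded Lebesgue density; $\mathbb E[Y_i(z)^2]<\infty$ for $z\in\mathcal Z$ and the conditional variances $\mathbb V[Y_i(z)\mid\mathbf X_i]$ are bounded by a constant uniformly in $z\in\mathcal Z$; the version of $\mu_{\mathbf x}(z)$ in 4 is Lipschitz in $\mathbf x\in\mathcal X$ with a constant that does not depend on $z\in\mathcal Z$. Let $\kappa\in(0,1)$ be fixed and let $\eta=\eta_N>0$ satisfy $\eta=o(N^{-1/(d+3)})$, $N\eta^{3}\to\infty$ and $N\eta^{d+1}\to\infty$. For each $N$ and $i\le N$ let $$i_1\in\operatorname*{argmin}_{l\le N:\ z_0-\eta\le Z_l\le z_0-\kappa\eta}\|\mathbf X_l-\mathbf X_i\|_2,\qquad i_2\in\operatorname*{argmin}_{l\le N:\ z_0+\kappa\eta\le Z_l\le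 z_0+\eta}\|\mathbf X_l-\mathbf X_i\|_2$$ (ties are broken arbitrarily, and an index is chosen arbitrarily if there is no candidate), and let $$\hat\delta(z_0)=\frac1N\sum_{i=1}^N\frac{Y_{i_2}-Y_{i_1}}{Z_{i_2}-Z_{i_1}}.$$ Then $\hat\delta(z_0)-\delta(z_0)\to0$ in probability as $N\to\infty$. -/

import Mathlib

open MeasureTheory ProbabilityTheory Filter Topology Asymptotics

noncomputable section

namespace ACDE

/-- The covariate space `ℝ^d` with its Euclidean norm. -/
abbrev Cov (d : ℕ) : Type := EuclideanSpace ℝ (Fin d)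

/-! ### The matching estimator -/

/-- Individuals `l` among the first `N` with `z₀ - η ≤ Z_l ≤ z₀ - κ η`. -/
def leftCandidates (N : ℕ) (Z : ℕ → ℝ) (z₀ κ η : ℝ) : Set ℕ :=
  {l | l < N ∧ z₀ - η ≤ Z l ∧ Z l ≤ z₀ - κ * η}

/-- Individuals `l` among the first `N` with `z₀ + κ η ≤ Z_l ≤ z₀ + η`. -/
def rightCandidates (N : ℕ) (Z : ℕ → ℝ) (z₀ κ η : ℝ) : Set ℕ :=
  {l | l < N ∧ z₀ + κ * η ≤ Z l ∧ Z l ≤ z₀ + η}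

/-- `j` minimises the Euclidean covariate distance to `i` over the candidate set `S`. -/
def IsNearestMatch {d : ℕ} (X : ℕ → Cov d) (S : Set ℕ) (i j : ℕ) : Prop :=
  j ∈ S ∧ ∀ l ∈ S, dist (X j) (X i) ≤ dist (X l) (X i)

/-- `m₁ i` and `m₂ i` are the two matches of individual `i`, for every `i` in the sample of
size `N`. Ties may be broken in any way, and nothing is required when there is no candidate. -/
def IsMatching {d : ℕ} (N : ℕ) (Z : ℕ → ℝ) (X : ℕ → Cov d) (z₀ κ η : ℝ)
    (m₁ m₂ : ℕ → ℕ) : Prop :=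
  ∀ i < N,
    ((leftCandidates N Z z₀ κ η).Nonempty →
      IsNearestMatch X (leftCandidates N Z z₀ κ η) i (m₁ i)) ∧
    ((rightCandidates N Z z₀ κ η).Nonempty →
      IsNearestMatch X (rightCandidates N Z z₀ κ η) i (m₂ i))

/-- The matching estimator: the average over the sample of
`(Y_{i₂} - Y_{i₁}) / (Z_{i₂} - Z_{i₁})`. -/
def matchingEstimator (N : ℕ) (Yobs Z : ℕ → ℝ) (m₁ m₂ : ℕ → ℕ) : ℝ :=
  (1 / (N : ℝ)) *
    ∑ i ∈ Finset.range N, (Yobs (m₂ i) - Yobs (m₁ i)) / (Z (m₂ i) - Z (m₁ i))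

/-! ### The estimand and the assumptions -/

variable {Ω : Type*} [MeasurableSpace Ω]

/-- The population average causal derivative effect `E[Y'(z₀)]`, where `Y z ω` is the potential
outcome at exposure level `z`. -/
def acde (μ : Measure Ω) (Y : ℝ → Ω → ℝ) (z₀ : ℝ) : ℝ :=
  ∫ ω, deriv (fun z => Y z ω) z₀ ∂μ

/-- The individuals `(Y_i(·), Z_i, X_i)` are independent and identically distributed random
elements of `ℝ^𝒵 × ℝ × ℝ^d`, with `Z_i ∈ 𝒵` and `X_i ∈ 𝒳` almost surely. -/
structure IIDSample {d : ℕ} (μ : Measure Ω) (𝒵 : Set ℝ) (𝒳 : Set (Cov d))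
    (Y : ℕ → ℝ → Ω → ℝ) (Z : ℕ → Ω → ℝ) (X : ℕ → Ω → Cov d) : Prop where
  measurable_Y : ∀ i, ∀ z ∈ 𝒵, Measurable (Y i z)
  measurable_Z : ∀ i, Measurable (Z i)
  measurable_X : ∀ i, Measurable (X i)
  mem_exposure : ∀ i, ∀ᵐ ω ∂μ, Z i ω ∈ 𝒵
  mem_covariate : ∀ i, ∀ᵐ ω ∂μ, X i ω ∈ 𝒳
  indep : iIndepFun (fun i ω => ((fun z : 𝒵 => Y i z ω), Z i ω, X i ω)) μ
  identDistrib : ∀ i, IdentDistrib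
    (fun ω => ((fun z : 𝒵 => Y i z ω), Z i ω, X i ω))
    (fun ω => ((fun z : 𝒵 => Y 0 z ω), Z 0 ω, X 0 ω)) μ μ

/-- Consistency of potential outcomes: `Z_i = z` implies `Y_i = Y_i(z)`. -/
def OutcomeConsistency (𝒵 : Set ℝ) (Y : ℕ → ℝ → Ω → ℝ) (Yobs Z : ℕ → Ω → ℝ) : Prop :=
  ∀ i, ∀ z ∈ 𝒵, ∀ ω, Z i ω = z → Yobs i ω = Y i z ω

/-- Local weak (un)confoundedness with radius `r`: for each `z ∈ 𝒵`, the conditional law of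
`Y(z)` given `(Z, X)` equals its conditional law given `X` on the event `|Z - z| ≤ r`. -/
def LocalWeakConfoundedness {d : ℕ} (μ : Measure Ω) (𝒵 : Set ℝ) (r : ℝ)
    (Y : ℝ → Ω → ℝ) (Z : Ω → ℝ) (X : Ω → Cov d) : Prop :=
  ∀ z ∈ 𝒵, ∀ B : Set ℝ, MeasurableSet B → ∀ᵐ ω ∂μ, Z ω ∈ Set.Icc (z - r) (z + r) →
    (μ⟦Y z ⁻¹' B | MeasurableSpace.comap (fun ω' => (Z ω', X ω')) inferInstance⟧) ω =
      (μ⟦Y z ⁻¹' B | MeasurableSpace.comap X inferInstance⟧) ω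

/-- `f z x` is a version of the conditional Lebesgue density of `Z` at `z` given `X = x`. -/
def IsCondDensity {d : ℕ} (μ : Measure Ω) (Z : Ω → ℝ) (X : Ω → Cov d)
    (f : ℝ → Cov d → ℝ) : Prop :=
  Measurable (Function.uncurry f) ∧
    μ.map (fun ω => (Z ω, X ω)) =
      ((volume : Measure ℝ).prod (μ.map X)).withDensity
        (fun p => ENNReal.ofReal (f p.1 p.2))

/-- Strict overlap: the conditional density of `Z` given `X` is at least some constant `ζ > 0`
on `𝒵 × 𝒳`. -/
def StrictOverlap {d : ℕ} (μ : Measure Ω) (𝒵 : Set ℝ) (𝒳 : Set (Cov d))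
    (Z : Ω → ℝ) (X : Ω → Cov d) : Prop :=
  ∃ f : ℝ → Cov d → ℝ, IsCondDensity μ Z X f ∧
    ∃ ζ > 0, ∀ z ∈ 𝒵, ∀ x ∈ 𝒳, ζ ≤ f z x

/-- `g` is differentiable on `𝒵` and its derivative is continuous and bounded by `C` there. -/
def SmoothOn (g : ℝ → ℝ) (𝒵 : Set ℝ) (C : ℝ) : Prop :=
  DifferentiableOn ℝ g 𝒵 ∧ ContinuousOn (derivWithin g 𝒵) 𝒵 ∧
    ∀ z ∈ 𝒵, |derivWithin g 𝒵 z| ≤ C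

/-- `m z x` is a version of the regression function `μ_x(z) = E[Y(z) | X = x]`, `z ∈ 𝒵`. -/
def IsCondMean {d : ℕ} (μ : Measure Ω) (𝒵 : Set ℝ) (Y : ℝ → Ω → ℝ) (X : Ω → Cov d)
    (m : ℝ → Cov d → ℝ) : Prop :=
  ∀ z ∈ 𝒵, (fun ω => m z (X ω)) =ᵐ[μ] μ[Y z | MeasurableSpace.comap X inferInstance]

/-- Smoothness: almost every path `z ↦ Y_i(z)` and every `z ↦ μ_x(z)`, `x ∈ 𝒳`, is
differentiable on `𝒵` with continuous and uniformly bounded derivative. -/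
def Smoothness {d : ℕ} (μ : Measure Ω) (𝒵 : Set ℝ) (𝒳 : Set (Cov d))
    (Y : ℕ → ℝ → Ω → ℝ) (m : ℝ → Cov d → ℝ) : Prop :=
  ∃ C : ℝ, (∀ i, ∀ᵐ ω ∂μ, SmoothOn (fun z => Y i z ω) 𝒵 C) ∧
    ∀ x ∈ 𝒳, SmoothOn (fun z => m z x) 𝒵 C

/-- Regularity conditions: the covariate domain is bounded and the covariate has a bounded
Lebesgue density; the potential outcomes are square integrable with bounded conditional variance
`σ²_x(z) = V[Y(z) | X = x]`; `x ↦ μ_x(z)` is Lipschitz on `𝒳` uniformly in `z ∈ 𝒵`. -/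
structure Regularity {d : ℕ} (μ : Measure Ω) (𝒵 : Set ℝ) (𝒳 : Set (Cov d))
    (Y : ℝ → Ω → ℝ) (X : Ω → Cov d) (m : ℝ → Cov d → ℝ) : Prop where
  bounded_covariate : Bornology.IsBounded 𝒳
  density : ∃ fX : Cov d → ℝ, Measurable fX ∧ (∃ M : ℝ, ∀ x, fX x ≤ M) ∧
    μ.map X = (volume : Measure (Cov d)).withDensity (fun x => ENNReal.ofReal (fX x))
  memLp : ∀ z ∈ 𝒵, MemLp (Y z) 2 μ
  condVar_bounded : ∃ V : ℝ, ∀ z ∈ 𝒵,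
    ∀ᵐ ω ∂μ, Var[Y z; μ | MeasurableSpace.comap X inferInstance] ω ≤ V
  lipschitz : ∃ L : ℝ, ∀ z ∈ 𝒵, ∀ x ∈ 𝒳, ∀ x' ∈ 𝒳, |m z x - m z x'| ≤ L * ‖x - x'‖

/-- Rate conditions on the caliper: `η_N > 0`, `η_N = o(N^{-1/(d+3)})`, `N η_N³ → ∞` and
`N η_N^{d+1} → ∞`. -/
structure CaliperRate (d : ℕ) (η : ℕ → ℝ) : Prop where
  pos : ∀ N, 0 < η N
  upper : η =o[atTop] (fun N : ℕ => (N : ℝ) ^ (-(1 / ((d : ℝ) + 3))))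
  residual : Tendsto (fun N : ℕ => (N : ℝ) * η N ^ 3) atTop atTop
  discrepancy : Tendsto (fun N : ℕ => (N : ℝ) * η N ^ (d + 1)) atTop atTop

end ACDE

end

/-! Write `D x` for the derivative at `z₀` of the regression function `m · x`, and call the pairs
`(Z_i, X_i)` the design. Strict overlap gives a unit, conditionally on its covariate, probability at
least `p = ζ (1 - κ) η` of lying in a given one of the two exposure windows. Since `E[Y(z)] = E[m z
X]`, dominated convergence of difference quotients gives `E[D X] = δ(z₀)`, so the average of `D (X
i)` over the sample converges to the estimand by the law of large numbers. It remains to compare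
each matched quotient with `D (X i)`. There are four errors.

Noise. Unconfoundedness is available for each fixed `z` only up to a null set, so the random
exposure cannot be substituted into it. The exposure range is cut into finitely many cells of
half-width `τ = min (η ^ 2) r`, and on each cell `Y(Z)` is compared with `Y(rep)` at a fixed
representative. The residual `Y(rep) - m rep X` is centred given the design with bounded variance
(`cellResidual_moments`). Distinct units are then uncorrelated, and the second moment of the noise
is at most a constant times the sum of squared weights. The weight of unit `j` is at most `1 / (2 κ
η N)` times the number of units matched to it, so what matters is the expected number of pairs
sharing a match. It is of order `N / p` (`lintegral_shared_match_le`): given the covariates, each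
unit misses the window with probability at most `1 - p`, and a shared match forces a whole ranked
list of units to miss it, which sums to a geometric series. A finite cover of directions by narrow
cones supplies these lists. The noise has second moment of order `1 / (N η ^ 3)`.

Covariate mismatch. By the Lipschitz condition this is at most a constant times the mean matching
distance divided by `η`. A dyadic search through boxes of growing size shows that this ratio tends
to zero (`exists_discrepancy_bound`).

Secants. Differentiability at `z₀` is only pointwise in `x`, but outside a set of covariates of
small probability the linearization error is uniform (`exists_uniform_linearization`). On that set
all slopes are bounded by the derivative bound.

Mesh. Replacing exposures by representatives costs a multiple of `τ / η`, hence `O(η)`.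

The matches are arbitrary functions of the sample point, with no measurability. All errors are
therefore bounded by measurable majorants and treated in outer probability (`Negligible`). -/

noncomputable section

namespace ACDE

/-! ### Resampling one coordinate of an i.i.d. sample. -/

section PiUpdate

variable {ι : Type*} [DecidableEq ι] {U : Type*} [MeasurableSpace U]

/-- Fubini for a product of copies of a probability measure: one coordinate may be resampled. -/
theorem lintegral_pi_update [Fintype ι] (Q : Measure U) [IsProbabilityMeasure Q] (l : ι)
    {f : (ι → U) → ENNReal} (hf : Measurable f) :
    ∫⁻ u, f u ∂Measure.pi (fun _ : ι => Q) =
      ∫⁻ u, ∫⁻ v, f (Function.update u l v) ∂Q ∂Measure.pi (fun _ : ι => Q) := by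
  have key : ∀ g : (ι → U) → ENNReal, Measurable g →
      (∫⋯∫⁻_Finset.univ, g ∂(fun _ : ι => Q)) =
        ∫⋯∫⁻_(Finset.univ.erase l), (∫⋯∫⁻_{l}, g ∂(fun _ : ι => Q)) ∂(fun _ : ι => Q) := by
    intro g hg
    rw [← lmarginal_union _ _ hg]
    · congr 1
      ext i
      by_cases h : i = l <;> simp [h]
    · simp
  rcases isEmpty_or_nonempty (ι → U) with hE | ⟨⟨x0⟩⟩
  · have : Measure.pi (fun _ : ι => Q) = 0 := Measure.eq_zero_of_isEmpty _
    simp [this]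
  rw [lintegral_eq_lmarginal_univ x0, lintegral_eq_lmarginal_univ x0, key f hf]
  have hm : Measurable (∫⋯∫⁻_{l}, f ∂(fun _ : ι => Q)) := hf.lmarginal _
  have e : (∫⋯∫⁻_{l}, f ∂(fun _ : ι => Q)) = fun u => ∫⁻ v, f (Function.update u l v) ∂Q := by
    funext u
    rw [lmarginal_singleton]
  rw [← e, key _ hm]
  -- The marginal over `l` no longer depends on coordinate `l`, so integrating it over that
  -- coordinate again, against a probability measure, changes nothing.
  have e2 : (∫⋯∫⁻_{l}, (∫⋯∫⁻_{l}, f ∂(fun _ : ι => Q)) ∂(fun _ : ι => Q)) =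
      ∫⋯∫⁻_{l}, f ∂(fun _ : ι => Q) := by
    funext u
    rw [lmarginal_singleton]
    simp [e]
  rw [e2]

theorem measurable_update_pair (l : ι) :
    Measurable (fun q : (ι → U) × U => Function.update q.1 l q.2) := by
  refine measurable_pi_iff.2 fun i => ?_
  by_cases h : i = l
  · subst h; simpa using measurable_snd
  · simp only [Function.update_of_ne h]; fun_prop

/-- Resampling as an equality of laws, which carries the Tonelli identity over to signed integrable
functions. -/
theorem map_update_pi_prod [Fintype ι] (Q : Measure U) [IsProbabilityMeasure Q] (l : ι) :
    ((Measure.pi (fun _ : ι => Q)).prod Q).map (fun q => Function.update q.1 l q.2) =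
      Measure.pi (fun _ : ι => Q) := by
  have hmeas := measurable_update_pair (U := U) l
  ext s hs
  rw [Measure.map_apply hmeas hs, ← lintegral_indicator_one (hmeas hs), lintegral_prod,
    ← lintegral_indicator_one hs, lintegral_pi_update Q l (measurable_one.indicator hs)]
  · rfl
  · exact (measurable_one.indicator (hmeas hs)).aemeasurable

theorem integral_pi_update [Fintype ι] (Q : Measure U) [IsProbabilityMeasure Q] (l : ι)
    {f : (ι → U) → ℝ} (hf : Integrable f (Measure.pi (fun _ : ι => Q))) :
    ∫ u, f u ∂Measure.pi (fun _ : ι => Q) =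
      ∫ u, ∫ v, f (Function.update u l v) ∂Q ∂Measure.pi (fun _ : ι => Q) := by
  have hmeas := measurable_update_pair (U := U) l
  have h := map_update_pi_prod Q l
  rw [← h] at hf
  conv_lhs => rw [← h]
  rw [integral_map hmeas.aemeasurable hf.aestronglyMeasurable, integral_prod]
  exact (integrable_map_measure hf.aestronglyMeasurable hmeas.aemeasurable).1 hf

end PiUpdate

/-! ### Second moment of a weighted sum of centred residuals. -/

section Variance

variable {N : ℕ} {U W : Type*} [MeasurableSpace U] [MeasurableSpace W]

/-- A weighted sum of residuals that are centred given the design has second moment at most the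
conditional variance bound times the sum of the squared weights. -/
theorem lintegral_sq_weighted_sum_le (Q : Measure U) [IsProbabilityMeasure Q]
    {w : U → W} (hw : Measurable w) {e : U → ℝ} (he : Measurable e) (he2 : MemLp e 2 Q)
    {V : ENNReal}
    (h0 : ∀ g : W → ℝ, Measurable g → (∃ B, ∀ x, |g x| ≤ B) → ∫ u, g (w u) * e u ∂Q = 0)
    (hV : ∀ g : W → ENNReal, Measurable g →
      ∫⁻ u, g (w u) * ENNReal.ofReal (e u ^ 2) ∂Q ≤ V * ∫⁻ u, g (w u) ∂Q)
    {α : Fin N → (Fin N → W) → ℝ} (hα : ∀ j, Measurable (α j)) {B : ℝ}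
    (hB : ∀ j x, |α j x| ≤ B) :
    ∫⁻ u, ENNReal.ofReal ((∑ j, α j (w ∘ u) * e (u j)) ^ 2) ∂Measure.pi (fun _ : Fin N => Q) ≤
      V * ∫⁻ u, ∑ j, ENNReal.ofReal (α j (w ∘ u) ^ 2) ∂Measure.pi (fun _ : Fin N => Q) := by
  set μN := Measure.pi (fun _ : Fin N => Q) with hμN
  have hwu : Measurable (fun u : Fin N → U => w ∘ u) :=
    measurable_pi_iff.2 fun i => hw.comp (measurable_pi_apply i)
  have hej : ∀ j, MemLp (fun u : Fin N → U => e (u j)) 2 μN := fun j =>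
    he2.comp_measurePreserving (measurePreserving_eval (fun _ : Fin N => Q) j)
  have haj : ∀ j, Measurable (fun u : Fin N → U => α j (w ∘ u)) := fun j => (hα j).comp hwu
  have hint : ∀ j k, Integrable
      (fun u : Fin N → U => (α j (w ∘ u) * e (u j)) * (α k (w ∘ u) * e (u k))) μN := by
    intro j k
    have h1 : ∀ j, MemLp (fun u : Fin N → U => α j (w ∘ u) * e (u j)) 2 μN := fun j => by
      refine MemLp.of_le_mul (c := B) (hej j) ?_ ?_
      · exact ((haj j).mul (he.comp (measurable_pi_apply j))).aestronglyMeasurable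
      · refine Eventually.of_forall fun u => ?_
        rw [norm_mul]
        exact mul_le_mul_of_nonneg_right (hB j _) (norm_nonneg _)
    exact (h1 j).integrable_mul (h1 k)
  have hupd : ∀ (j : Fin N) (u : Fin N → U) (v : U),
      w ∘ Function.update u j v = Function.update (w ∘ u) j (w v) := fun j u v => by
    rw [Function.comp_update]
  -- Resample unit `j` with the others fixed. Both weights depend on the resampled unit only through
  -- its design, and `e (u k)` is a constant, so the product is a bounded function of the design
  -- times `e`, to which `h0` applies.
  have hcross : ∀ j k, j ≠ k →
      ∫ u, (α j (w ∘ u) * e (u j)) * (α k (w ∘ u) * e (u k)) ∂μN = 0 := by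
    intro j k hjk
    rw [hμN, integral_pi_update Q j (hint j k)]
    refine integral_eq_zero_of_ae (Eventually.of_forall fun u => ?_)
    simp only [hupd, Function.update_self, Function.update_of_ne hjk.symm, Pi.zero_apply]
    have hup : Measurable (fun x : W => Function.update (w ∘ u) j x) := measurable_update _
    have := h0 (fun x => α j (Function.update (w ∘ u) j x) *
      (α k (Function.update (w ∘ u) j x) * e (u k)))
      (((hα j).comp hup).mul (((hα k).comp hup).mul_const _))
      ⟨B * (B * |e (u k)|), fun x => by
        have hB0 : 0 ≤ B := (abs_nonneg _).trans (hB j (w ∘ u))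
        rw [abs_mul, abs_mul]
        gcongr <;> apply hB⟩
    rw [← this]
    congr 1
    funext v
    ring
  have hsq : ∀ u : Fin N → U, (∑ j, α j (w ∘ u) * e (u j)) ^ 2 =
      ∑ j, ∑ k, (α j (w ∘ u) * e (u j)) * (α k (w ∘ u) * e (u k)) := fun u => by
    rw [sq, Finset.sum_mul_sum]
  -- The cross terms have no sign, so their cancellation is carried out with Bochner integrals
  -- before returning to `∫⁻`.
  have hL : ∫⁻ u, ENNReal.ofReal ((∑ j, α j (w ∘ u) * e (u j)) ^ 2) ∂μN =
      ∫⁻ u, ∑ j, ENNReal.ofReal ((α j (w ∘ u) * e (u j)) ^ 2) ∂μN := by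
    have i1 : Integrable (fun u : Fin N → U => (∑ j, α j (w ∘ u) * e (u j)) ^ 2) μN := by
      simp_rw [hsq]
      exact integrable_finsetSum _ fun j _ => integrable_finsetSum _ fun k _ => hint j k
    have i2 : Integrable (fun u : Fin N → U => ∑ j, (α j (w ∘ u) * e (u j)) ^ 2) μN :=
      integrable_finsetSum _ fun j _ => by simpa [sq] using hint j j
    rw [← ofReal_integral_eq_lintegral_ofReal i1 (Eventually.of_forall fun u => sq_nonneg _)]
    simp_rw [← ENNReal.ofReal_sum_of_nonneg (fun j _ => sq_nonneg _)]
    rw [← ofReal_integral_eq_lintegral_ofReal i2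
      (Eventually.of_forall fun u => Finset.sum_nonneg fun j _ => sq_nonneg _)]
    congr 1
    simp_rw [hsq]
    rw [integral_finsetSum _ fun j _ => integrable_finsetSum _ fun k _ => hint j k,
      integral_finsetSum _ fun j _ => by simpa [sq] using hint j j]
    refine Finset.sum_congr rfl fun j _ => ?_
    rw [integral_finsetSum _ fun k _ => hint j k, Finset.sum_eq_single j]
    · simp [sq]
    · intro k _ hkj; exact hcross j k hkj.symm
    · simp
  have m1 (j : Fin N) : Measurable
      (fun u : Fin N → U => ENNReal.ofReal ((α j (w ∘ u) * e (u j)) ^ 2)) :=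
    (((haj j).mul (he.comp (measurable_pi_apply j))).pow_const 2).ennreal_ofReal
  have m2 (j : Fin N) : Measurable (fun u : Fin N → U => ENNReal.ofReal (α j (w ∘ u) ^ 2)) :=
    ((haj j).pow_const 2).ennreal_ofReal
  rw [hL, lintegral_finsetSum _ fun j _ => m1 j, lintegral_finsetSum _ fun j _ => m2 j,
    Finset.mul_sum]
  refine Finset.sum_le_sum fun j _ => ?_
  rw [hμN, lintegral_pi_update Q j (m1 j), lintegral_pi_update Q j (m2 j), ← lintegral_const_mul]
  · refine lintegral_mono fun u => ?_
    simp only [hupd, Function.update_self, mul_pow]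
    simp_rw [ENNReal.ofReal_mul (sq_nonneg (α j _))]
    exact hV (fun x => ENNReal.ofReal (α j (Function.update (w ∘ u) j x) ^ 2))
      ((((hα j).comp (measurable_update _)).pow_const 2).ennreal_ofReal)
  · exact ((m2 j).comp (measurable_update_pair j)).lintegral_prod_right'

end Variance

/-! ### Exposures as a thinning of the covariates. -/

section Thinning

/-- The covariate part of a sample. -/
def covariates {N : ℕ} {A E : Type*} (u : Fin N → A × E) : Fin N → E := fun i => (u i).2

/-- A set of units selected through the covariates does not react when only an exposure is redrawn.
This is what allows conditioning on the covariates without disintegrating the law. -/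
theorem covariates_update {N : ℕ} {A E : Type*} (u : Fin N → A × E) (l : Fin N) (a : A) :
    covariates (Function.update u l (a, (u l).2)) = covariates u := by
  funext i
  by_cases h : i = l
  · subst h; simp [covariates]
  · simp [covariates, Function.update_of_ne h]

variable {N : ℕ} {A E : Type*} [MeasurableSpace A] [MeasurableSpace E]

/-- The chance that none of the units in `s` falls into `𝒞` is at most `r ^ #s`, also after
weighting by a function of the other coordinates. -/
theorem lintegral_mul_prod_indicator_le (P : Measure (A × E)) [IsProbabilityMeasure P]
    {𝒞 : Set A} (h𝒞 : MeasurableSet 𝒞) {r : ENNReal}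
    (hP : ∀ h : E → ENNReal, Measurable h →
      ∫⁻ w, h w.2 * 𝒞ᶜ.indicator 1 w.1 ∂P ≤ r * ∫⁻ w, h w.2 ∂P)
    (s : Finset (Fin N)) {H : (Fin N → A × E) → ENNReal} (hH : Measurable H)
    (hHs : ∀ l ∈ s, ∀ u a, H (Function.update u l (a, (u l).2)) = H u) :
    ∫⁻ u, H u * ∏ l ∈ s, 𝒞ᶜ.indicator 1 (u l).1 ∂Measure.pi (fun _ : Fin N => P) ≤
      r ^ s.card * ∫⁻ u, H u ∂Measure.pi (fun _ : Fin N => P) := by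
  have hind : Measurable (𝒞ᶜ.indicator (1 : A → ENNReal)) := measurable_one.indicator h𝒞.compl
  have hone : ∀ (l : Fin N) (G : (Fin N → A × E) → ENNReal), Measurable G →
      (∀ u a, G (Function.update u l (a, (u l).2)) = G u) →
      ∫⁻ u, G u * 𝒞ᶜ.indicator 1 (u l).1 ∂Measure.pi (fun _ : Fin N => P) ≤
        r * ∫⁻ u, G u ∂Measure.pi (fun _ : Fin N => P) := by
    intro l G hG hGl
    have hG' : Measurable fun u : Fin N → A × E => G u * 𝒞ᶜ.indicator 1 (u l).1 := by fun_prop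
    rw [lintegral_pi_update P l hG', lintegral_pi_update P l hG, ← lintegral_const_mul]
    · refine lintegral_mono fun u => ?_
      -- Since `G` ignores the exposure of unit `l`, the new exposure may be replaced by the old
      -- one. The integrand then depends on the new draw through its covariate alone, as `hP`
      -- requires.
      have e : ∀ v, G (Function.update u l v) = G (Function.update u l ((u l).1, v.2)) := by
        intro v
        have := hGl (Function.update u l v) (u l).1
        simpa using this.symm
      simp only [Function.update_self]
      simp_rw [e]
      exact hP (fun x => G (Function.update u l ((u l).1, x)))
        (hG.comp ((measurable_update _).comp (by fun_prop)))
    · exact (hG.comp (measurable_update_pair l)).lintegral_prod_right'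
  induction s using Finset.induction_on with
  | empty => simp
  | insert l s hl ih =>
    have ih' := ih fun k hk => hHs k (Finset.mem_insert_of_mem hk)
    simp_rw [Finset.prod_insert hl, Finset.card_insert_of_notMem hl]
    calc ∫⁻ u, H u * (𝒞ᶜ.indicator 1 (u l).1 * ∏ k ∈ s, 𝒞ᶜ.indicator 1 (u k).1)
          ∂Measure.pi (fun _ : Fin N => P)
        = ∫⁻ u, (H u * ∏ k ∈ s, 𝒞ᶜ.indicator 1 (u k).1) * 𝒞ᶜ.indicator 1 (u l).1
          ∂Measure.pi (fun _ : Fin N => P) := by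
          congr 1; funext u; ring
      _ ≤ r * ∫⁻ u, (H u * ∏ k ∈ s, 𝒞ᶜ.indicator 1 (u k).1)
          ∂Measure.pi (fun _ : Fin N => P) := by
          refine hone l _ ?_ ?_
          · refine hH.mul (Finset.measurable_prod _ fun k _ => ?_)
            fun_prop
          · intro u a
            rw [hHs l (Finset.mem_insert_self _ _)]
            congr 1
            refine Finset.prod_congr rfl fun k hk => ?_
            rw [Function.update_of_ne (by rintro rfl; exact hl hk)]
      _ ≤ r * (r ^ s.card * ∫⁻ u, H u ∂Measure.pi (fun _ : Fin N => P)) := by gcongr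
      _ = _ := by rw [pow_succ]; ring

theorem measurable_covariates : Measurable (covariates : (Fin N → A × E) → Fin N → E) := by
  unfold covariates
  fun_prop

theorem measurable_pow_card_covariates {S : (Fin N → E) → Finset (Fin N)}
    (hS : ∀ l, MeasurableSet {x | l ∈ S x}) (r : ENNReal) :
    Measurable fun u : Fin N → A × E => r ^ (S (covariates u)).card := by
  classical
  have : ∀ u : Fin N → A × E, (S (covariates u)).card =
      ∑ l, {x : Fin N → E | l ∈ S x}.indicator 1 (covariates u) := by
    intro u
    simp [Set.indicator_apply]
  simp_rw [this]
  refine Measurable.pow measurable_const (Finset.measurable_sum _ fun l _ => ?_)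
  exact (measurable_one.indicator (hS l)).comp measurable_covariates

/-- Version of `lintegral_mul_prod_indicator_le` for a set of units chosen from the covariates. -/
theorem lintegral_mul_prod_indicator_le_of_covariates
    (P : Measure (A × E)) [IsProbabilityMeasure P]
    {𝒞 : Set A} (h𝒞 : MeasurableSet 𝒞) {r : ENNReal}
    (hP : ∀ h : E → ENNReal, Measurable h →
      ∫⁻ w, h w.2 * 𝒞ᶜ.indicator 1 w.1 ∂P ≤ r * ∫⁻ w, h w.2 ∂P)
    {S : (Fin N → E) → Finset (Fin N)} (hS : ∀ l, MeasurableSet {x | l ∈ S x})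
    {G : (Fin N → A × E) → ENNReal} (hG : Measurable G)
    (hGS : ∀ u l, l ∈ S (covariates u) → ∀ a, G (Function.update u l (a, (u l).2)) = G u) :
    ∫⁻ u, G u * ∏ l ∈ S (covariates u), 𝒞ᶜ.indicator 1 (u l).1
        ∂Measure.pi (fun _ : Fin N => P) ≤
      ∫⁻ u, G u * r ^ (S (covariates u)).card ∂Measure.pi (fun _ : Fin N => P) := by
  classical
  have hind : Measurable (𝒞ᶜ.indicator (1 : A → ENNReal)) := measurable_one.indicator h𝒞.compl
  have hSs : ∀ s, MeasurableSet {u : Fin N → A × E | S (covariates u) = s} := by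
    intro s
    have : {u : Fin N → A × E | S (covariates u) = s} =
        covariates ⁻¹' ⋂ l, (if l ∈ s then {x | l ∈ S x} else {x | l ∈ S x}ᶜ) := by
      ext u
      simp only [Set.mem_ofPred_eq, Set.mem_preimage, Set.mem_iInter, Finset.ext_iff]
      refine forall_congr' fun l => ?_
      by_cases h : l ∈ s <;> simp [h]
    rw [this]
    refine measurable_covariates (MeasurableSet.iInter fun l => ?_)
    split_ifs
    · exact hS l
    · exact (hS l).compl
  -- The random set `S (covariates u)` takes finitely many values. On each of them it is a fixed set
  -- `s`, and the event of taking the value `s` is unaffected by redrawing exposures.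
  have split : ∀ K : Finset (Fin N) → (Fin N → A × E) → ENNReal, ∀ u,
      K (S (covariates u)) u =
        ∑ s, {u : Fin N → A × E | S (covariates u) = s}.indicator (K s) u := by
    intro K u
    rw [Finset.sum_eq_single (S (covariates u))]
    · simp
    · intro s _ hs
      simp [hs.symm]
    · simp
  have hKm : ∀ s : Finset (Fin N), Measurable fun u : Fin N → A × E =>
      G u * ∏ l ∈ s, 𝒞ᶜ.indicator 1 (u l).1 := by
    intro s
    refine hG.mul (Finset.measurable_prod _ fun k _ => ?_)
    fun_prop
  rw [lintegral_congr (split fun s u => G u * ∏ l ∈ s, 𝒞ᶜ.indicator 1 (u l).1),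
    lintegral_congr (split fun s u => G u * r ^ s.card),
    lintegral_finsetSum _ fun s _ => (hKm s).indicator (hSs s),
    lintegral_finsetSum _ fun s _ => (hG.mul_const _).indicator (hSs s)]
  refine Finset.sum_le_sum fun s _ => ?_
  have h := lintegral_mul_prod_indicator_le P h𝒞 hP s
    (H := {u : Fin N → A × E | S (covariates u) = s}.indicator G) (hG.indicator (hSs s)) (by
      intro l hl u a
      by_cases hu : S (covariates u) = s
      · have : S (covariates (Function.update u l (a, (u l).2))) = s := by
          rw [covariates_update, hu]
        simp only [Set.indicator_apply, Set.mem_ofPred_eq, this, hu, if_true]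
        exact hGS u l (hu ▸ hl) a
      · have : S (covariates (Function.update u l (a, (u l).2))) ≠ s := by
          rwa [covariates_update]
        simp only [Set.indicator_apply, Set.mem_ofPred_eq, this, hu, if_false])
  rw [← lintegral_const_mul _ (hG.indicator (hSs s))] at h
  refine le_of_eq_of_le (lintegral_congr fun u => ?_) (h.trans (le_of_eq
    (lintegral_congr fun u => ?_)))
  · by_cases hu : u ∈ {u : Fin N → A × E | S (covariates u) = s}
    · simp only [Set.indicator_of_mem hu]
    · simp only [Set.indicator_of_notMem hu, zero_mul]
  · by_cases hu : u ∈ {u : Fin N → A × E | S (covariates u) = s}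
    · simp only [Set.indicator_of_mem hu, mul_comm]
    · simp only [Set.indicator_of_notMem hu, mul_zero]

end Thinning

/-- Summing `(1 - p) ^ rank` over a finite set ranked by `f` gives at most `1 / p`. -/
theorem sum_pow_rank_le {α : Type*} [DecidableEq α] {p : ℝ} (hp : 0 < p) (hp1 : p ≤ 1) (f : α → ℝ)
    (S : Finset α) :
    ∑ i ∈ S, ENNReal.ofReal (1 - p) ^ (S.filter fun l => f l ≤ f i).card ≤
      ENNReal.ofReal (1 / p) := by
  have h0 : 0 ≤ 1 - p := by linarith
  -- The sharper bound telescopes: adding a point of maximal `f`-value adds `(1 - p) ^ (#s + 1)`,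
  -- while the ranks of the others can only grow.
  have key : ∑ i ∈ S, (1 - p) ^ (S.filter fun l => f l ≤ f i).card ≤
      (1 - (1 - p) ^ S.card) / p := by
    induction S using Finset.induction_on_max_value f with
    | empty => simp
    | insert a s ha hmax ih =>
      rw [Finset.sum_insert ha, Finset.card_insert_of_notMem ha]
      have e1 : ((insert a s).filter fun l => f l ≤ f a) = insert a s := by
        refine Finset.filter_true_of_mem fun l hl => ?_
        rcases Finset.mem_insert.1 hl with rfl | hl
        · exact le_rfl
        · exact hmax l hl
      rw [e1, Finset.card_insert_of_notMem ha]
      have e2 : ∑ i ∈ s, (1 - p) ^ ((insert a s).filter fun l => f l ≤ f i).card ≤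
          ∑ i ∈ s, (1 - p) ^ (s.filter fun l => f l ≤ f i).card := by
        refine Finset.sum_le_sum fun i _ => pow_le_pow_of_le_one h0 (by linarith) ?_
        exact Finset.card_le_card (Finset.filter_subset_filter _ (Finset.subset_insert _ _))
      have e3 : (1 - (1 - p) ^ (s.card + 1)) / p =
          (1 - (1 - p) ^ s.card) / p + (1 - p) ^ s.card := by
        field_simp
        ring
      have e4 : (1 - p) ^ (s.card + 1) ≤ (1 - p) ^ s.card :=
        pow_le_pow_of_le_one h0 (by linarith) (Nat.le_succ _)
      linarith
  simp_rw [← ENNReal.ofReal_pow h0]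
  rw [← ENNReal.ofReal_sum_of_nonneg fun i _ => by positivity]
  refine ENNReal.ofReal_le_ofReal (key.trans ?_)
  gcongr
  have : 0 ≤ (1 - p) ^ S.card := by positivity
  linarith

/-! ### Cells that contain no candidate. -/

section Cells

variable {N : ℕ} {A E : Type*} [MeasurableSpace A] [MeasurableSpace E]

/-- In a partition of the covariate space into finitely many cells, the expected number of
units whose cell contains no candidate is at most the number of cells divided by `p`. -/
theorem lintegral_card_cell_without_candidate_le
    (P : Measure (A × E)) [IsProbabilityMeasure P]
    {𝒞 : Set A} (h𝒞 : MeasurableSet 𝒞) {p : ℝ} (hp : 0 < p) (hp1 : p ≤ 1)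
    (hP : ∀ h : E → ENNReal, Measurable h →
      ∫⁻ w, h w.2 * 𝒞ᶜ.indicator 1 w.1 ∂P ≤ ENNReal.ofReal (1 - p) * ∫⁻ w, h w.2 ∂P)
    {β : Type*} (b : E → β) (hb : MeasurableSet {q : E × E | b q.1 = b q.2}) (T : Finset β)
    (hT : ∀ᵐ u ∂Measure.pi (fun _ : Fin N => P), ∀ i, b (u i).2 ∈ T) :
    ∫⁻ u, ∑ i : Fin N, {u : Fin N → A × E |
        ∀ l, b (u l).2 = b (u i).2 → (u l).1 ∉ 𝒞}.indicator 1 u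
        ∂Measure.pi (fun _ : Fin N => P) ≤ T.card * ENNReal.ofReal (1 / p) := by
  classical
  set r := ENNReal.ofReal (1 - p)
  let S : Fin N → (Fin N → E) → Finset (Fin N) := fun i x =>
    Finset.univ.filter fun l => b (x l) = b (x i)
  have hSm : ∀ i l, MeasurableSet {x | l ∈ S i x} := by
    intro i l
    simp only [S, Finset.mem_filter, Finset.mem_univ, true_and]
    exact hb.preimage (by fun_prop : Measurable fun x : Fin N → E => (x l, x i))
  have hind : Measurable (𝒞ᶜ.indicator (1 : A → ENNReal)) := measurable_one.indicator h𝒞.compl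
  have e1 : ∀ (i : Fin N) (u : Fin N → A × E), {u : Fin N → A × E |
        ∀ l, b (u l).2 = b (u i).2 → (u l).1 ∉ 𝒞}.indicator (1 : (Fin N → A × E) → ENNReal) u =
      1 * ∏ l ∈ S i (covariates u), 𝒞ᶜ.indicator 1 (u l).1 := by
    intro i u
    rw [one_mul]
    by_cases h : ∀ l, b (u l).2 = b (u i).2 → (u l).1 ∉ 𝒞
    · rw [Set.indicator_of_mem (by exact h), Finset.prod_eq_one]
      · rfl
      · intro l hl
        rw [Set.indicator_of_mem (h l (Finset.mem_filter.1 hl).2)]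
        rfl
    · rw [Set.indicator_of_notMem (by exact h)]
      push Not at h
      obtain ⟨l, hl, hl'⟩ := h
      symm
      refine Finset.prod_eq_zero (i := l) (Finset.mem_filter.2 ⟨Finset.mem_univ _, hl⟩) ?_
      rw [Set.indicator_of_notMem (by simpa using hl')]
  have hSall : ∀ i, {u : Fin N → A × E | ∀ l, b (u l).2 = b (u i).2 → (u l).1 ∉ 𝒞} =
      ⋂ l, ({u : Fin N → A × E | b (u l).2 = b (u i).2}ᶜ ∪ {u : Fin N → A × E | (u l).1 ∈ 𝒞}ᶜ) := by
    intro i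
    ext u
    simp [imp_iff_not_or]
  have hEm : ∀ i, MeasurableSet
      {u : Fin N → A × E | ∀ l, b (u l).2 = b (u i).2 → (u l).1 ∉ 𝒞} := by
    intro i
    rw [hSall i]
    refine MeasurableSet.iInter fun l => MeasurableSet.union (MeasurableSet.compl ?_)
      (MeasurableSet.compl ?_)
    · exact hb.preimage (by fun_prop : Measurable fun u : Fin N → A × E => ((u l).2, (u i).2))
    · exact h𝒞.preimage (by fun_prop : Measurable fun u : Fin N → A × E => (u l).1)
  have hcm : ∀ i, Measurable fun u : Fin N → A × E => 1 * r ^ (S i (covariates u)).card := by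
    intro i
    simpa using measurable_pow_card_covariates (hSm i) r
  rw [lintegral_finsetSum _ fun i _ => measurable_one.indicator (hEm i)]
  calc ∑ i, ∫⁻ u, {u : Fin N → A × E |
        ∀ l, b (u l).2 = b (u i).2 → (u l).1 ∉ 𝒞}.indicator 1 u ∂Measure.pi (fun _ : Fin N => P)
      ≤ ∑ i, ∫⁻ u, 1 * r ^ (S i (covariates u)).card ∂Measure.pi (fun _ : Fin N => P) := by
        refine Finset.sum_le_sum fun i _ => ?_
        rw [lintegral_congr (e1 i)]
        exact lintegral_mul_prod_indicator_le_of_covariates P h𝒞 hP (hSm i) (G := fun _ => 1)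
          measurable_const (fun _ _ _ _ => rfl)
    _ = ∫⁻ u, ∑ i, 1 * r ^ (S i (covariates u)).card ∂Measure.pi (fun _ : Fin N => P) := by
        rw [lintegral_finsetSum _ fun i _ => hcm i]
    _ ≤ ∫⁻ _, T.card * ENNReal.ofReal (1 / p) ∂Measure.pi (fun _ : Fin N => P) := by
        refine lintegral_mono_ae (hT.mono fun u hu => ?_)
        simp only [one_mul]
        rw [← Finset.sum_fiberwise_of_maps_to (t := T) (g := fun i => b (u i).2)
          (fun i _ => hu i)]
        rw [← nsmul_eq_mul, ← Finset.sum_const]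
        refine Finset.sum_le_sum fun t _ => ?_
        -- With a constant ranking function every rank equals the cell size `n`, and the bound reads
        -- `n (1 - p) ^ n ≤ 1 / p`.
        have := sum_pow_rank_le hp hp1 (fun _ : Fin N => (0 : ℝ))
          (Finset.univ.filter fun i => b (u i).2 = t)
        refine le_trans (Finset.sum_le_sum fun i hi => ?_) this
        simp only [le_refl, Finset.filter_true]
        simp only [Finset.mem_filter, Finset.mem_univ, true_and] at hi
        simp only [S, covariates, hi]
        exact le_rfl
    _ = _ := by simp

end Cells

/-! ### Narrow cones of directions. -/

section Cones

variable {d : ℕ}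

/-- The cone of nonzero vectors whose direction is within `1 / 2` of `c`. -/
def dirCone (c : Cov d) : Set (Cov d) := {v | v ≠ 0 ∧ ‖‖v‖⁻¹ • v - c‖ < 1 / 2}

theorem measurableSet_dirCone (c : Cov d) : MeasurableSet (dirCone c) := by
  refine MeasurableSet.inter (measurableSet_singleton (0 : Cov d)).compl ?_
  have : Measurable fun v : Cov d => ‖‖v‖⁻¹ • v - c‖ := by fun_prop
  exact measurableSet_lt this measurable_const

/-- Compactness of the unit sphere. The number of cones depends on `d` only and becomes a constant
in the variance bound. -/
theorem exists_finset_dirCone (d : ℕ) :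
    ∃ t : Finset (Cov d), ∀ v : Cov d, v ≠ 0 → ∃ c ∈ t, v ∈ dirCone c := by
  have hc : IsCompact (Metric.sphere (0 : Cov d) 1) := isCompact_sphere _ _
  obtain ⟨t, -, ht, hcov⟩ := hc.finite_cover_balls (e := 1 / 2) (by norm_num)
  refine ⟨ht.toFinset, fun v hv => ?_⟩
  have hmem : ‖v‖⁻¹ • v ∈ Metric.sphere (0 : Cov d) 1 := by
    simp [norm_smul, hv]
  obtain ⟨c, hct, hc⟩ := Set.mem_iUnion₂.1 (hcov hmem)
  exact ⟨c, by simpa using hct, hv, by simpa [dist_eq_norm] using hc⟩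

/-- Within a narrow cone, moving from `v` to a shorter vector reduces the distance. -/
theorem norm_sub_lt_of_mem_dirCone {c v v' : Cov d} (hv : v ∈ dirCone c) (hv' : v' ∈ dirCone c)
    (h : ‖v'‖ ≤ ‖v‖) : ‖v' - v‖ < ‖v‖ := by
  have p1 : 0 < ‖v‖ := norm_pos_iff.2 hv.1
  have p2 : 0 < ‖v'‖ := norm_pos_iff.2 hv'.1
  have hdir : ‖‖v'‖⁻¹ • v' - ‖v‖⁻¹ • v‖ < 1 := by
    calc ‖‖v'‖⁻¹ • v' - ‖v‖⁻¹ • v‖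
        = ‖(‖v'‖⁻¹ • v' - c) - (‖v‖⁻¹ • v - c)‖ := by congr 1; abel
      _ ≤ ‖‖v'‖⁻¹ • v' - c‖ + ‖‖v‖⁻¹ • v - c‖ := norm_sub_le _ _
      _ < 1 := by linarith [hv.2, hv'.2]
  -- First change direction at length `‖v'‖`, which costs less than `‖v'‖`, then change length along
  -- the direction of `v`, which costs `‖v‖ - ‖v'‖`.
  have e : v' - v = ‖v'‖ • (‖v'‖⁻¹ • v' - ‖v‖⁻¹ • v) - (‖v‖ - ‖v'‖) • (‖v‖⁻¹ • v) := by
    rw [smul_sub, sub_smul, smul_smul, smul_smul, smul_smul, mul_inv_cancel₀ p2.ne',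
      mul_inv_cancel₀ p1.ne', one_smul, one_smul]
    abel
  have n1 : ‖‖v‖⁻¹ • v‖ = 1 := by simp [norm_smul, hv.1]
  calc ‖v' - v‖ ≤ ‖v'‖ * ‖‖v'‖⁻¹ • v' - ‖v‖⁻¹ • v‖ + (‖v‖ - ‖v'‖) * 1 := by
        rw [e]
        refine (norm_sub_le _ _).trans (le_of_eq ?_)
        rw [norm_smul, norm_smul, n1, Real.norm_of_nonneg p2.le, Real.norm_of_nonneg (by linarith)]
    _ < ‖v'‖ * 1 + (‖v‖ - ‖v'‖) * 1 := by
        have := mul_lt_mul_of_pos_left hdir p2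
        linarith
    _ = ‖v‖ := by ring

end Cones

/-! ### Nearest candidates and the number of shared matches. -/

section Matches

variable {N d : ℕ} {A : Type*}

/-- Samples in which `j` is the strictly nearest candidate to `i`. -/
def nearestSet (𝒞 : Set A) (i j : Fin N) : Set (Fin N → A × Cov d) :=
  {u | (u j).1 ∈ 𝒞 ∧ ∀ l, l ≠ j → (u l).1 ∈ 𝒞 → dist (u j).2 (u i).2 < dist (u l).2 (u i).2}

/-- Samples in which all covariate distances to any given unit are different. -/
def noTies (N d : ℕ) (A : Type*) : Set (Fin N → A × Cov d) :=
  {u | ∀ i j k : Fin N, j ≠ k → dist (u j).2 (u i).2 ≠ dist (u k).2 (u i).2}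

theorem measurableSet_nearestSet [MeasurableSpace A] {𝒞 : Set A} (h𝒞 : MeasurableSet 𝒞) (i j : Fin N) :
    MeasurableSet (nearestSet (d := d) 𝒞 i j) := by
  have : nearestSet (d := d) 𝒞 i j = {u | (u j).1 ∈ 𝒞} ∩ ⋂ l, ⋂ (_ : l ≠ j),
      ({u | (u l).1 ∈ 𝒞}ᶜ ∪ {u | dist (u j).2 (u i).2 < dist (u l).2 (u i).2}) := by
    ext u
    simp [nearestSet, imp_iff_not_or]
  rw [this]
  refine MeasurableSet.inter (h𝒞.preimage (by fun_prop)) (MeasurableSet.iInter fun l =>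
    MeasurableSet.iInter fun _ => MeasurableSet.union (MeasurableSet.compl ?_) ?_)
  · exact h𝒞.preimage (by fun_prop : Measurable fun u : Fin N → A × Cov d => (u l).1)
  · exact measurableSet_lt (by fun_prop) (by fun_prop)

theorem nearestSet_unique {𝒞 : Set A} {i j k : Fin N} {u : Fin N → A × Cov d}
    (hj : u ∈ nearestSet 𝒞 i j) (hk : u ∈ nearestSet 𝒞 i k) : j = k := by
  by_contra h
  exact lt_asymm (hj.2 k (Ne.symm h) hk.1) (hk.2 j h hj.1)

theorem sum_indicator_nearestSet_le {R : Type*} [AddCommMonoid R] [One R] [PartialOrder R]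
    [ZeroLEOneClass R] (𝒞 : Set A) (i : Fin N) (u : Fin N → A × Cov d) :
    ∑ j, (nearestSet 𝒞 i j).indicator (1 : (Fin N → A × Cov d) → R) u ≤ 1 := by
  classical
  by_cases h : ∃ j, u ∈ nearestSet 𝒞 i j
  · obtain ⟨j, hj⟩ := h
    rw [Finset.sum_eq_single j]
    · simp [hj]
    · intro k _ hk
      exact Set.indicator_of_notMem (fun hk' => hk (nearestSet_unique hk' hj)) _
    · simp
  · push Not at h
    rw [Finset.sum_eq_zero fun j _ => Set.indicator_of_notMem (h j) _]
    exact zero_le_one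

/-- The expected number of pairs of units that share their nearest candidate is of order
`N / p`, where `p` bounds from below the conditional probability of being a candidate. -/
theorem lintegral_shared_match_le [MeasurableSpace A] (P : Measure (A × Cov d)) [IsProbabilityMeasure P]
    {𝒞 : Set A} (h𝒞 : MeasurableSet 𝒞) {p : ℝ} (hp : 0 < p) (hp1 : p ≤ 1)
    (hP : ∀ h : Cov d → ENNReal, Measurable h →
      ∫⁻ w, h w.2 * 𝒞ᶜ.indicator 1 w.1 ∂P ≤ ENNReal.ofReal (1 - p) * ∫⁻ w, h w.2 ∂P)
    (hties : ∀ᵐ u ∂Measure.pi (fun _ : Fin N => P), u ∈ noTies N d A)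
    {t : Finset (Cov d)} (ht : ∀ v : Cov d, v ≠ 0 → ∃ c ∈ t, v ∈ dirCone c) :
    ∫⁻ u, ∑ i, ∑ j, ∑ k, (nearestSet 𝒞 i j).indicator 1 u * (nearestSet 𝒞 k j).indicator 1 u
        ∂Measure.pi (fun _ : Fin N => P) ≤
      N * (1 + (1 + t.card) * ENNReal.ofReal (1 / p)) := by
  classical
  set r := ENNReal.ofReal (1 - p)
  set μN := Measure.pi (fun _ : Fin N => P) with hμN
  have hind : Measurable (𝒞ᶜ.indicator (1 : A → ENNReal)) := measurable_one.indicator h𝒞.compl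
  let miss : Finset (Fin N) → (Fin N → A × Cov d) → ENNReal := fun s u =>
    ∏ l ∈ s, 𝒞ᶜ.indicator 1 (u l).1
  have miss_eq : ∀ s u, (∀ l ∈ s, (u l).1 ∉ 𝒞) → miss s u = 1 := by
    intro s u h
    refine Finset.prod_eq_one fun l hl => ?_
    rw [Set.indicator_of_mem (h l hl)]
    rfl
  -- units at least as close to `i` as `k`
  let S₁ : Fin N → Fin N → (Fin N → Cov d) → Finset (Fin N) := fun i k x =>
    Finset.univ.filter fun l => dist (x l) (x i) ≤ dist (x k) (x i)
  -- units in the cone at `j` that are farther from `i` than `j`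
  let T : Cov d → Fin N → Fin N → (Fin N → Cov d) → Finset (Fin N) := fun c i j x =>
    Finset.univ.filter fun l => l ≠ j ∧ dist (x j) (x i) < dist (x l) (x i) ∧
      x l - x j ∈ dirCone c
  let S₂ : Cov d → Fin N → Fin N → Fin N → (Fin N → Cov d) → Finset (Fin N) := fun c i j k x =>
    (T c i j x).filter fun l => dist (x l) (x j) ≤ dist (x k) (x j)
  have hS₁ : ∀ i k l, MeasurableSet {x | l ∈ S₁ i k x} := by
    intro i k l
    have e : {x | l ∈ S₁ i k x} = {x | dist (x l) (x i) ≤ dist (x k) (x i)} := by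
      ext x
      rw [Set.mem_ofPred_eq, Set.mem_ofPred_eq]
      exact ⟨fun h => (Finset.mem_filter.1 h).2,
        fun h => Finset.mem_filter.2 ⟨Finset.mem_univ _, h⟩⟩
    rw [e]
    exact measurableSet_le (by fun_prop) (by fun_prop)
  have hT : ∀ c i j l, MeasurableSet {x | l ∈ T c i j x} := by
    intro c i j l
    have e : {x | l ∈ T c i j x} = {_x | l ≠ j} ∩
        ({x | dist (x j) (x i) < dist (x l) (x i)} ∩ {x | x l - x j ∈ dirCone c}) := by
      ext x
      simp only [Set.mem_inter_iff, Set.mem_ofPred_eq]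
      exact ⟨fun h => (Finset.mem_filter.1 h).2,
        fun h => Finset.mem_filter.2 ⟨Finset.mem_univ _, h⟩⟩
    rw [e]
    refine MeasurableSet.inter (MeasurableSet.const _) (MeasurableSet.inter ?_ ?_)
    · exact measurableSet_lt (by fun_prop) (by fun_prop)
    · exact (measurableSet_dirCone c).preimage
        (by fun_prop : Measurable fun x : Fin N → Cov d => x l - x j)
  have hS₂ : ∀ c i j k l, MeasurableSet {x | l ∈ S₂ c i j k x} := by
    intro c i j k l
    have e : {x | l ∈ S₂ c i j k x} =
        {x | l ∈ T c i j x} ∩ {x | dist (x l) (x j) ≤ dist (x k) (x j)} := by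
      ext x
      rw [Set.mem_inter_iff, Set.mem_ofPred_eq, Set.mem_ofPred_eq, Set.mem_ofPred_eq]
      exact Finset.mem_filter
    rw [e]
    exact (hT c i j l).inter (measurableSet_le (by fun_prop) (by fun_prop))
  let M : Fin N → Fin N → (Fin N → A × Cov d) → ENNReal := fun i j =>
    (nearestSet 𝒞 i j).indicator 1
  have hM : ∀ i j, Measurable (M i j) := fun i j =>
    measurable_one.indicator (measurableSet_nearestSet h𝒞 i j)
  let In : Cov d → Fin N → Fin N → Fin N → (Fin N → A × Cov d) → ENNReal := fun c i j k u =>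
    {x | k ∈ T c i j x}.indicator 1 (covariates u)
  have hIn : ∀ c i j k, Measurable (In c i j k) := fun c i j k =>
    (measurable_one.indicator (hT c i j k)).comp measurable_covariates
  -- A product over a random set of units is rewritten as a product over all units, with factor 1
  -- outside the set, so that measurability can be read off.
  have hmissm : ∀ {S : (Fin N → Cov d) → Finset (Fin N)}, (∀ l, MeasurableSet {x | l ∈ S x}) →
      Measurable fun u : Fin N → A × Cov d => miss (S (covariates u)) u := by
    intro S hS
    have : ∀ u : Fin N → A × Cov d, miss (S (covariates u)) u =
        ∏ l, ({x : Fin N → Cov d | l ∈ S x}ᶜ.indicator 1 (covariates u) +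
          {x : Fin N → Cov d | l ∈ S x}.indicator 1 (covariates u) *
            𝒞ᶜ.indicator 1 (u l).1) := by
      intro u
      simp only [miss]
      rw [← Finset.prod_filter_mul_prod_filter_not Finset.univ (fun l => l ∈ S (covariates u))
        (fun l => _ + _)]
      have a1 : (Finset.univ.filter fun l => l ∈ S (covariates u)) = S (covariates u) := by simp
      rw [a1, Finset.prod_eq_one (s := Finset.univ.filter fun l => ¬ l ∈ S (covariates u)), mul_one]
      · refine Finset.prod_congr rfl fun l hl => ?_
        simp [hl]
      · intro l hl
        have hl' := (Finset.mem_filter.1 hl).2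
        simp [hl']
    simp_rw [this]
    refine Finset.measurable_prod _ fun l _ => ?_
    refine Measurable.add ?_ (Measurable.mul ?_ ?_)
    · exact (measurable_one.indicator (hS l).compl).comp measurable_covariates
    · exact (measurable_one.indicator (hS l)).comp measurable_covariates
    · fun_prop
  -- pointwise bound
  have hpt : ∀ u ∈ noTies N d A, ∀ i j k, M i j u * M k j u ≤
      M i j u * (if k = j then 1 else 0) + M i j u * miss (S₁ i k (covariates u)) u +
        ∑ c ∈ t, (M i j u * In c i j k u) * miss (S₂ c i j k (covariates u)) u := by
    intro u hu i j k
    by_cases hij : u ∈ nearestSet 𝒞 i j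
    swap
    · simp [M, Set.indicator_of_notMem hij]
    by_cases hkj : u ∈ nearestSet 𝒞 k j
    swap
    · simp [M, Set.indicator_of_notMem hkj]
    have e1 : M i j u = 1 := Set.indicator_of_mem hij _
    have e2 : M k j u = 1 := Set.indicator_of_mem hkj _
    simp only [e1, e2, one_mul]
    by_cases hk : k = j
    · rw [if_pos hk, add_assoc]
      exact le_self_add
    -- If `k` is no farther from `i` than `j`, every unit at most as far from `i` as `k` must miss
    -- the window, because `j` is the nearest candidate to `i`. The absence of ties keeps `j` itself
    -- out of this list.
    by_cases hd : dist (u k).2 (u i).2 ≤ dist (u j).2 (u i).2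
    · have : miss (S₁ i k (covariates u)) u = 1 := by
        refine miss_eq _ _ fun l hl hlC => ?_
        have hl' : dist (u l).2 (u i).2 ≤ dist (u k).2 (u i).2 := (Finset.mem_filter.1 hl).2
        have hlj : l ≠ j := by
          rintro rfl
          exact hu i k l hk (le_antisymm hd hl')
        exact absurd (hij.2 l hlj hlC) (not_lt.2 (hl'.trans hd))
      rw [this, add_assoc, add_left_comm]
      exact le_self_add
    -- If `k` is farther from `i` than `j`, take a cone containing `x_k - x_j`. A unit of this cone
    -- at `j` that is at most as far from `j` as `k` is strictly closer to `k` than `j` is. As `j`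
    -- is the nearest candidate to `k`, all such units miss the window.
    · push Not at hd
      have hne : (u k).2 - (u j).2 ≠ 0 := by
        intro h0
        rw [sub_eq_zero] at h0
        rw [h0] at hd
        exact lt_irrefl _ hd
      obtain ⟨c, hct, hc⟩ := ht _ hne
      have hkT : k ∈ T c i j (covariates u) :=
        Finset.mem_filter.2 ⟨Finset.mem_univ _, hk, hd, hc⟩
      have eIn : In c i j k u = 1 := Set.indicator_of_mem (by exact hkT) _
      have : miss (S₂ c i j k (covariates u)) u = 1 := by
        refine miss_eq _ _ fun l hl hlC => ?_
        obtain ⟨hlT, hlk⟩ := Finset.mem_filter.1 hl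
        obtain ⟨-, hlj, -, hlc⟩ := Finset.mem_filter.1 hlT
        have := norm_sub_lt_of_mem_dirCone hc hlc (by simpa [dist_eq_norm, covariates] using hlk)
        have h1 := hkj.2 l hlj hlC
        rw [dist_eq_norm, dist_eq_norm, norm_sub_rev] at h1
        simp only [covariates, sub_sub_sub_cancel_right] at this
        exact lt_asymm this h1
      refine le_trans ?_ (le_add_self)
      refine le_trans ?_ (Finset.single_le_sum (fun _ _ => zero_le) hct)
      rw [eIn, this, one_mul]
  have hpt2 : ∀ u ∈ noTies N d A, ∑ i, ∑ j, ∑ k, M i j u * M k j u ≤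
      ∑ i, (1 + ∑ k, 1 * miss (S₁ i k (covariates u)) u +
        ∑ j, ∑ c ∈ t, ∑ k, (M i j u * In c i j k u) * miss (S₂ c i j k (covariates u)) u) := by
    intro u hu
    refine Finset.sum_le_sum fun i _ => ?_
    have hs : ∑ j, M i j u ≤ 1 := sum_indicator_nearestSet_le 𝒞 i u
    calc ∑ j, ∑ k, M i j u * M k j u
        ≤ ∑ j, ∑ k, (M i j u * (if k = j then 1 else 0) + M i j u * miss (S₁ i k (covariates u)) u +
          ∑ c ∈ t, (M i j u * In c i j k u) * miss (S₂ c i j k (covariates u)) u) :=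
          Finset.sum_le_sum fun j _ => Finset.sum_le_sum fun k _ => hpt u hu i j k
      _ = ∑ j, M i j u + (∑ j, M i j u) * ∑ k, miss (S₁ i k (covariates u)) u +
          ∑ j, ∑ c ∈ t, ∑ k, (M i j u * In c i j k u) * miss (S₂ c i j k (covariates u)) u := by
          simp_rw [Finset.sum_add_distrib]
          congr 1
          · congr 1
            · refine Finset.sum_congr rfl fun j _ => ?_
              rw [← Finset.mul_sum]
              simp
            · rw [Finset.sum_mul_sum]
          · refine Finset.sum_congr rfl fun j _ => ?_
            rw [Finset.sum_comm]
      _ ≤ _ := by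
          simp only [one_mul]
          gcongr
          exact (mul_le_mul_left hs _).trans (by rw [one_mul])
  have hI1 : ∀ i, ∫⁻ u, ∑ k, 1 * miss (S₁ i k (covariates u)) u ∂μN ≤ ENNReal.ofReal (1 / p) := by
    intro i
    rw [lintegral_finsetSum _ fun k _ => (hmissm (hS₁ i k)).const_mul _]
    calc ∑ k, ∫⁻ u, 1 * miss (S₁ i k (covariates u)) u ∂μN
        ≤ ∑ k, ∫⁻ u, 1 * r ^ (S₁ i k (covariates u)).card ∂μN :=
          Finset.sum_le_sum fun k _ => lintegral_mul_prod_indicator_le_of_covariates P h𝒞 hP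
            (hS₁ i k) (G := fun _ => 1) measurable_const (fun _ _ _ _ => rfl)
      _ = ∫⁻ u, ∑ k, 1 * r ^ (S₁ i k (covariates u)).card ∂μN := by
          rw [lintegral_finsetSum _ fun k _ =>
            (measurable_pow_card_covariates (hS₁ i k) r).const_mul _]
      _ ≤ ∫⁻ _, ENNReal.ofReal (1 / p) ∂μN := by
          refine lintegral_mono fun u => ?_
          simp only [one_mul]
          exact sum_pow_rank_le hp hp1 (fun l => dist (u l).2 (u i).2) Finset.univ
      _ = _ := by simp
  have hI2 : ∀ i j c, ∫⁻ u, ∑ k, (M i j u * In c i j k u) * miss (S₂ c i j k (covariates u)) u ∂μN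
      ≤ ∫⁻ u, M i j u * ENNReal.ofReal (1 / p) ∂μN := by
    intro i j c
    have hMI : ∀ k, Measurable fun u => M i j u * In c i j k u := fun k => (hM i j).mul (hIn c i j k)
    have hMm : ∀ k, Measurable fun u =>
        (M i j u * In c i j k u) * miss (S₂ c i j k (covariates u)) u := fun k =>
      (hMI k).mul (hmissm (hS₂ c i j k))
    have hMr : ∀ k, Measurable fun u : Fin N → A × Cov d =>
        (M i j u * In c i j k u) * r ^ (S₂ c i j k (covariates u)).card := fun k =>
      (hMI k).mul (measurable_pow_card_covariates (hS₂ c i j k) r)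
    rw [lintegral_finsetSum _ fun k _ => hMm k]
    calc ∑ k, ∫⁻ u, (M i j u * In c i j k u) * miss (S₂ c i j k (covariates u)) u ∂μN
        ≤ ∑ k, ∫⁻ u, (M i j u * In c i j k u) * r ^ (S₂ c i j k (covariates u)).card ∂μN := by
          refine Finset.sum_le_sum fun k _ => lintegral_mul_prod_indicator_le_of_covariates P h𝒞 hP
            (hS₂ c i j k) (hMI k) ?_
          intro u l hl a
          obtain ⟨-, hlj, hld, -⟩ := Finset.mem_filter.1 (Finset.mem_filter.1 hl).1
          have hcov := covariates_update u l a
          have hcov' : ∀ i, ((Function.update u l (a, (u l).2)) i).2 = (u i).2 := fun i =>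
            congrFun hcov i
          -- Unit `l` lies strictly farther from `i` than `j`, so its exposure has no influence on
          -- whether `j` is the nearest candidate to `i`. Restricting the cone to such units is what
          -- makes the thinning bound applicable together with the weight `M i j`.
          have hmem : Function.update u l (a, (u l).2) ∈ nearestSet 𝒞 i j ↔
              u ∈ nearestSet 𝒞 i j := by
            simp only [nearestSet, Set.mem_ofPred_eq, hcov', Function.update_of_ne hlj.symm]
            refine and_congr_right fun _ => forall_congr' fun l' => ?_
            by_cases hl' : l' = l
            · subst hl'
              have : dist (u j).2 (u i).2 < dist (u l').2 (u i).2 := hld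
              simp [this]
            · rw [Function.update_of_ne hl']
          simp only [M, In, hcov]
          congr 1
          by_cases h : u ∈ nearestSet 𝒞 i j
          · rw [Set.indicator_of_mem h, Set.indicator_of_mem (hmem.2 h)]
            rfl
          · rw [Set.indicator_of_notMem h, Set.indicator_of_notMem (fun h' => h (hmem.1 h'))]
      _ = ∫⁻ u, ∑ k, (M i j u * In c i j k u) * r ^ (S₂ c i j k (covariates u)).card ∂μN := by
          rw [lintegral_finsetSum _ fun k _ => hMr k]
      _ ≤ _ := by
          refine lintegral_mono fun u => ?_
          simp_rw [mul_assoc, ← Finset.mul_sum]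
          gcongr
          -- Inside the cone, `S₂` has as cardinality the rank of `k` by distance to `j`, and the
          -- sum over `k` is again geometric.
          have := sum_pow_rank_le hp hp1 (fun l => dist (u l).2 (u j).2) (T c i j (covariates u))
          refine le_of_eq_of_le ?_ this
          rw [← Finset.sum_filter_add_sum_filter_not Finset.univ
            (fun l => l ∈ T c i j (covariates u)),
            Finset.sum_eq_zero (s := Finset.univ.filter fun l => ¬ l ∈ T c i j (covariates u)),
            add_zero]
          · have a1 : (Finset.univ.filter fun l => l ∈ T c i j (covariates u)) =
              T c i j (covariates u) := by simp
            rw [a1]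
            refine Finset.sum_congr rfl fun l hl => ?_
            simp only [In]
            rw [Set.indicator_of_mem (by exact hl), Pi.one_apply, one_mul]
            rfl
          · intro l hl
            simp only [In]
            rw [Set.indicator_of_notMem (by exact (Finset.mem_filter.1 hl).2), zero_mul]
  have hm2 : ∀ i j, Measurable fun u => ∑ c ∈ t, ∑ k,
      (M i j u * In c i j k u) * miss (S₂ c i j k (covariates u)) u := fun i j =>
    Finset.measurable_sum _ fun c _ => Finset.measurable_sum _ fun k _ =>
      ((hM i j).mul (hIn c i j k)).mul (hmissm (hS₂ c i j k))
  have hm1 : ∀ i, Measurable fun u => ∑ k, 1 * miss (S₁ i k (covariates u)) u := fun i =>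
    Finset.measurable_sum _ fun k _ => (hmissm (hS₁ i k)).const_mul _
  have hm3 : ∀ i, Measurable fun u : Fin N → A × Cov d =>
      1 + ∑ k, 1 * miss (S₁ i k (covariates u)) u := fun i => measurable_const.add (hm1 i)
  have hm4 : ∀ i, Measurable fun u : Fin N → A × Cov d =>
      1 + ∑ k, 1 * miss (S₁ i k (covariates u)) u + ∑ j, ∑ c ∈ t, ∑ k,
        (M i j u * In c i j k u) * miss (S₂ c i j k (covariates u)) u := fun i =>
    (hm3 i).add (Finset.measurable_sum _ fun j _ => hm2 i j)
  calc ∫⁻ u, ∑ i, ∑ j, ∑ k, M i j u * M k j u ∂μN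
      ≤ ∫⁻ u, ∑ i, (1 + ∑ k, 1 * miss (S₁ i k (covariates u)) u +
        ∑ j, ∑ c ∈ t, ∑ k, (M i j u * In c i j k u) * miss (S₂ c i j k (covariates u)) u) ∂μN :=
        lintegral_mono_ae (hties.mono hpt2)
    _ ≤ ∑ _i : Fin N, (1 + (1 + t.card) * ENNReal.ofReal (1 / p)) := by
        rw [lintegral_finsetSum _ fun i _ => hm4 i]
        refine Finset.sum_le_sum fun i _ => ?_
        rw [lintegral_add_left (hm3 i), lintegral_add_left measurable_const,
          add_assoc, add_mul, one_mul]
        have : ∫⁻ _ : Fin N → A × Cov d, (1 : ENNReal) ∂μN = 1 := by simp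
        rw [this]
        gcongr
        · exact hI1 i
        · rw [lintegral_finsetSum _ fun j _ => hm2 i j]
          calc ∑ j, ∫⁻ u, ∑ c ∈ t, ∑ k,
                (M i j u * In c i j k u) * miss (S₂ c i j k (covariates u)) u ∂μN
              ≤ ∑ j, ∑ _c ∈ t, ∫⁻ u, M i j u * ENNReal.ofReal (1 / p) ∂μN := by
                refine Finset.sum_le_sum fun j _ => ?_
                have hm5 : ∀ c, Measurable fun u => ∑ k,
                    (M i j u * In c i j k u) * miss (S₂ c i j k (covariates u)) u := fun c =>
                  Finset.measurable_sum _ fun k _ =>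
                    ((hM i j).mul (hIn c i j k)).mul (hmissm (hS₂ c i j k))
                rw [lintegral_finsetSum _ fun c _ => hm5 c]
                exact Finset.sum_le_sum fun c _ => hI2 i j c
            _ = t.card * ∫⁻ u, (∑ j, M i j u) * ENNReal.ofReal (1 / p) ∂μN := by
                simp_rw [Finset.sum_const, nsmul_eq_mul, ← Finset.mul_sum, Finset.sum_mul]
                rw [lintegral_finsetSum _ fun j _ => (hM i j).mul_const _]
            _ ≤ t.card * ∫⁻ _, 1 * ENNReal.ofReal (1 / p) ∂μN := by
                gcongr with u
                exact sum_indicator_nearestSet_le 𝒞 i u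
            _ = _ := by simp
    _ = _ := by rw [Finset.sum_const, Finset.card_univ, Fintype.card_fin, nsmul_eq_mul]

/-- If the covariate law has no atoms on spheres, distances are almost surely distinct. -/
theorem ae_mem_noTies [MeasurableSpace A] (P : Measure (A × Cov d)) [IsProbabilityMeasure P]
    (hsph : ∀ (x : Cov d) (ρ : ℝ), ∀ᵐ w ∂P, dist w.2 x ≠ ρ) :
    ∀ᵐ u ∂Measure.pi (fun _ : Fin N => P), u ∈ noTies N d A := by
  have key : ∀ i j k : Fin N, k ≠ j → k ≠ i → ∀ᵐ u ∂Measure.pi (fun _ : Fin N => P),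
      dist (u j).2 (u i).2 ≠ dist (u k).2 (u i).2 := by
    intro i j k hkj hki
    have hm : MeasurableSet {u : Fin N → A × Cov d |
        dist (u j).2 (u i).2 = dist (u k).2 (u i).2} :=
      measurableSet_eq_fun (by fun_prop) (by fun_prop)
    have h0 : ∫⁻ u, {u : Fin N → A × Cov d |
        dist (u j).2 (u i).2 = dist (u k).2 (u i).2}.indicator 1 u
          ∂Measure.pi (fun _ : Fin N => P) = 0 := by
      rw [lintegral_pi_update P k (measurable_one.indicator hm)]
      refine (lintegral_congr fun u => ?_).trans lintegral_zero
      refine (lintegral_congr_ae ?_).trans lintegral_zero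
      filter_upwards [hsph (u i).2 (dist (u j).2 (u i).2)] with v hv
      refine Set.indicator_of_notMem ?_ _
      simp only [Set.mem_ofPred_eq, Function.update_self, Function.update_of_ne hkj.symm,
        Function.update_of_ne hki.symm]
      exact hv.symm
    rw [lintegral_indicator_one hm] at h0
    simpa [ae_iff] using h0
  simp only [noTies, Set.mem_ofPred_eq, ae_all_iff]
  intro i j k hjk
  -- The unit that is redrawn must differ from the centre `i`. If `k = i`, redraw `j` instead.
  by_cases hki : k = i
  · filter_upwards [key i k j hjk (fun h => hjk (h.trans hki.symm))] with u hu using hu.symm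
  · exact key i j k hjk.symm hki

end Matches

/-! ### Conditional moments of a residual under unconfoundedness. -/

section Residual

variable {Ω : Type*} {m mX mW m₀ : MeasurableSpace Ω} {μ : Measure Ω} {d : ℕ}

theorem integral_mul_eq_integral_mul_condExp [IsProbabilityMeasure μ] (hm : m ≤ m₀) {k f : Ω → ℝ}
    (hk : StronglyMeasurable[m] k) (hkf : Integrable (k * f) μ) (hf : Integrable f μ) :
    ∫ ω, k ω * f ω ∂μ = ∫ ω, k ω * (μ[f | m]) ω ∂μ := by
  have h1 := integral_condExp hm (f := k * f) (μ := μ)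
  have h2 := condExp_mul_of_stronglyMeasurable_left hk hkf hf
  calc ∫ ω, k ω * f ω ∂μ = ∫ ω, (μ[k * f | m]) ω ∂μ := h1.symm
    _ = _ := integral_congr_ae h2

theorem condExp_indicator_one_nonneg (A : Set Ω) :
    ∀ᵐ ω ∂μ, 0 ≤ (μ[A.indicator (fun _ => (1 : ℝ)) | m]) ω :=
  condExp_nonneg (Eventually.of_forall fun ω => Set.indicator_nonneg (fun _ _ => zero_le_one) ω)

theorem condExp_indicator_one_le [IsProbabilityMeasure μ] (hm : m ≤ m₀) {A : Set Ω}
    (hA : MeasurableSet A) : ∀ᵐ ω ∂μ, (μ[A.indicator (fun _ => (1 : ℝ)) | m]) ω ≤ 1 := by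
  have h := condExp_mono (m := m) (μ := μ) ((integrable_const (1 : ℝ)).indicator hA)
    (integrable_const (1 : ℝ)) (Eventually.of_forall fun ω =>
      Set.indicator_le_self' (fun _ _ => zero_le_one) ω)
  rwa [condExp_const hm] at h

variable {y Z : Ω → ℝ} {X : Ω → Cov d}

/-- Under unconfoundedness on `A`, restricting to `A` reweights the law of `(y, X)` by the
conditional probability of `A` given `X`. -/
theorem map_restrict_eq_map_withDensity [IsProbabilityMeasure μ]
    (hmX : mX = MeasurableSpace.comap X inferInstance)
    (hmW : mW = MeasurableSpace.comap (fun ω => (Z ω, X ω)) inferInstance) (hy : Measurable y) (hZ : Measurable Z)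
    (hX : Measurable X) {I : Set ℝ}
    (hconf : ∀ B : Set ℝ, MeasurableSet B → ∀ᵐ ω ∂μ, Z ω ∈ I →
      (μ⟦y ⁻¹' B | mW⟧) ω =
        (μ⟦y ⁻¹' B | mX⟧) ω)
    {S : Set (ℝ × Cov d)} (hS : MeasurableSet S) (hSI : ∀ w ∈ S, w.1 ∈ I) :
    (μ.restrict ((fun ω => (Z ω, X ω)) ⁻¹' S)).map (fun ω => (y ω, X ω)) =
      (μ.withDensity fun ω => ENNReal.ofReal
        ((μ⟦(fun ω => (Z ω, X ω)) ⁻¹' S | mX⟧) ω)).map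
        (fun ω => (y ω, X ω)) := by
  have hW : Measurable (fun ω => (Z ω, X ω)) := hZ.prodMk hX
  have hX_le : mX ≤ m₀ := hmX ▸ hX.comap_le
  have hW_le : mW ≤ m₀ := hmW ▸ hW.comap_le
  set A := (fun ω => (Z ω, X ω)) ⁻¹' S with hA
  have hAm : MeasurableSet A := hW hS
  have hyX : Measurable (fun ω => (y ω, X ω)) := hy.prodMk hX
  refine Measure.ext_prod fun {B D} hB hD => ?_
  have hyB : MeasurableSet (y ⁻¹' B) := hy hB
  have hXD : MeasurableSet (X ⁻¹' D) := hX hD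
  have hXD' : MeasurableSet[mX] (X ⁻¹' D) := hmX ▸ ⟨D, hD, rfl⟩
  have hAD' : MeasurableSet[mW] (A ∩ X ⁻¹' D) :=
    hmW ▸ ⟨S ∩ Prod.snd ⁻¹' D, hS.inter (measurable_snd hD), rfl⟩
  have hpre : (fun ω => (y ω, X ω)) ⁻¹' (B ×ˢ D) = y ⁻¹' B ∩ X ⁻¹' D := rfl
  rw [Measure.map_apply hyX (hB.prod hD), Measure.map_apply hyX (hB.prod hD), hpre,
    Measure.restrict_apply (hyB.inter hXD), withDensity_apply _ (hyB.inter hXD)]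
  set h := μ⟦A | mX⟧ with hh
  have h0 : ∀ᵐ ω ∂μ, 0 ≤ h ω := condExp_indicator_one_nonneg A
  have hint : Integrable h μ := integrable_condExp
  rw [← ofReal_integral_eq_lintegral_ofReal hint.integrableOn (ae_restrict_of_ae h0)]
  rw [← ofReal_measureReal]
  congr 1
  have i1B : Integrable ((y ⁻¹' B).indicator (fun _ => (1 : ℝ))) μ :=
    (integrable_const _).indicator hyB
  have i1A : Integrable (A.indicator (fun _ => (1 : ℝ))) μ := (integrable_const _).indicator hAm
  have iPX : Integrable (μ⟦y ⁻¹' B | mX⟧) μ := integrable_condExp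
  -- On `A` the conditional probability given `(Z, X)` may be replaced by the one given `X`. Taking
  -- the conditional expectation of the indicator of `A`, and then undoing that of the indicator of
  -- `y ⁻¹' B`, leaves the weight `h`.
  calc μ.real (y ⁻¹' B ∩ X ⁻¹' D ∩ A)
      = ∫ ω in A ∩ X ⁻¹' D, (y ⁻¹' B).indicator (fun _ => (1 : ℝ)) ω ∂μ := by
        rw [integral_indicator hyB, Measure.restrict_restrict hyB, setIntegral_const, smul_eq_mul,
          mul_one]
        congr 1
        ext ω
        simp only [Set.mem_inter_iff]
        tauto
    _ = ∫ ω in A ∩ X ⁻¹' D, (μ⟦y ⁻¹' B | mW⟧) ω ∂μ := (setIntegral_condExp hW_le i1B hAD').symm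
    _ = ∫ ω in A ∩ X ⁻¹' D, (μ⟦y ⁻¹' B | mX⟧) ω ∂μ := by
        refine setIntegral_congr_ae (hAm.inter hXD) ?_
        filter_upwards [hconf B hB] with ω hω hmem
        exact hω (hSI _ hmem.1)
    _ = ∫ ω, (X ⁻¹' D).indicator (μ⟦y ⁻¹' B | mX⟧) ω * A.indicator (fun _ => (1 : ℝ)) ω ∂μ := by
        rw [← integral_indicator (hAm.inter hXD)]
        congr 1
        funext ω
        by_cases h1 : ω ∈ A <;> by_cases h2 : ω ∈ X ⁻¹' D <;> simp [Set.indicator, h1, h2]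
    _ = ∫ ω, (X ⁻¹' D).indicator (μ⟦y ⁻¹' B | mX⟧) ω * h ω ∂μ := by
        refine integral_mul_eq_integral_mul_condExp hX_le
          (stronglyMeasurable_condExp.indicator hXD') ?_ i1A
        have e : (X ⁻¹' D).indicator (μ⟦y ⁻¹' B | mX⟧) * A.indicator (fun _ => (1 : ℝ)) =
            A.indicator ((X ⁻¹' D).indicator (μ⟦y ⁻¹' B | mX⟧)) := by
          funext ω
          by_cases h1 : ω ∈ A <;> simp [Set.indicator, h1]
        rw [e]
        exact (iPX.indicator hXD).indicator hAm
    _ = ∫ ω, (X ⁻¹' D).indicator h ω * (μ⟦y ⁻¹' B | mX⟧) ω ∂μ := by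
        congr 1
        funext ω
        by_cases h2 : ω ∈ X ⁻¹' D <;> simp [Set.indicator, h2, mul_comm]
    _ = ∫ ω, (X ⁻¹' D).indicator h ω * (y ⁻¹' B).indicator (fun _ => (1 : ℝ)) ω ∂μ := by
        symm
        refine integral_mul_eq_integral_mul_condExp hX_le
          (stronglyMeasurable_condExp.indicator hXD') ?_ i1B
        have e : (X ⁻¹' D).indicator h * (y ⁻¹' B).indicator (fun _ => (1 : ℝ)) =
            (y ⁻¹' B).indicator ((X ⁻¹' D).indicator h) := by
          funext ω
          by_cases h1 : ω ∈ y ⁻¹' B <;> simp [Set.indicator, h1]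
        rw [e]
        exact (hint.indicator hXD).indicator hyB
    _ = ∫ ω in y ⁻¹' B ∩ X ⁻¹' D, h ω ∂μ := by
        rw [← integral_indicator (hyB.inter hXD)]
        congr 1
        funext ω
        by_cases h1 : ω ∈ y ⁻¹' B <;> by_cases h2 : ω ∈ X ⁻¹' D <;>
          simp only [Set.indicator, Set.mem_inter_iff, h1, h2] <;> simp

/-- Conditional mean and variance of the residual `y - g X` on an event where `y` is
unconfounded. -/
theorem setIntegral_residual [IsProbabilityMeasure μ]
    (hmX : mX = MeasurableSpace.comap X inferInstance)
    (hmW : mW = MeasurableSpace.comap (fun ω => (Z ω, X ω)) inferInstance) (hy : Measurable y) (hZ : Measurable Z)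
    (hX : Measurable X) {I : Set ℝ}
    (hconf : ∀ B : Set ℝ, MeasurableSet B → ∀ᵐ ω ∂μ, Z ω ∈ I →
      (μ⟦y ⁻¹' B | mW⟧) ω =
        (μ⟦y ⁻¹' B | mX⟧) ω)
    {S : Set (ℝ × Cov d)} (hS : MeasurableSet S) (hSI : ∀ w ∈ S, w.1 ∈ I)
    {g : Cov d → ℝ} (hg : Measurable g)
    (hgy : (fun ω => g (X ω)) =ᵐ[μ] μ[y | mX])
    (hy2 : MemLp y 2 μ) {V : ℝ}
    (hV : ∀ᵐ ω ∂μ, Var[y; μ | mX] ω ≤ V) :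
    ∫ ω in (fun ω => (Z ω, X ω)) ⁻¹' S, (y ω - g (X ω)) ∂μ = 0 ∧
    ∫⁻ ω in (fun ω => (Z ω, X ω)) ⁻¹' S, ENNReal.ofReal ((y ω - g (X ω)) ^ 2) ∂μ ≤
      ENNReal.ofReal V * μ ((fun ω => (Z ω, X ω)) ⁻¹' S) := by
  have hmap := map_restrict_eq_map_withDensity hmX hmW hy hZ hX hconf hS hSI
  have hX_le : mX ≤ m₀ := hmX ▸ hX.comap_le
  have hAm : MeasurableSet ((fun ω => (Z ω, X ω)) ⁻¹' S) := (hZ.prodMk hX) hS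
  set A := (fun ω => (Z ω, X ω)) ⁻¹' S with hA
  set h := μ⟦A | mX⟧ with hh
  have h0 : ∀ᵐ ω ∂μ, 0 ≤ h ω := condExp_indicator_one_nonneg A
  have h1 : ∀ᵐ ω ∂μ, h ω ≤ 1 := condExp_indicator_one_le hX_le hAm
  have hb : ∀ᵐ ω ∂μ, ‖h ω‖ ≤ 1 := by
    filter_upwards [h0, h1] with ω a b
    rwa [Real.norm_of_nonneg a]
  have hsm : StronglyMeasurable[mX] h := stronglyMeasurable_condExp
  have hmeas : Measurable h := (hsm.mono hX_le).measurable
  have hyX : Measurable (fun ω => (y ω, X ω)) := hy.prodMk hX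
  have hyint : Integrable y μ := hy2.integrable one_le_two
  have hgint : Integrable (fun ω => g (X ω)) μ := (integrable_congr hgy).2 integrable_condExp
  have hg2 : MemLp (fun ω => g (X ω)) 2 μ := (memLp_congr_ae hgy).2 (hy2.condExp one_le_two)
  have hg_sm : StronglyMeasurable[mX] (fun ω => g (X ω)) :=
    hmX ▸ (hg.comp (comap_measurable X)).stronglyMeasurable
  have hq2 : MemLp (fun ω => y ω - g (X ω)) 2 μ := hy2.sub hg2
  constructor
  · have hφ : Measurable (fun q : ℝ × Cov d => q.1 - g q.2) := by fun_prop
    have e1 : ∫ ω in A, (y ω - g (X ω)) ∂μ =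
        ∫ q, (q.1 - g q.2) ∂((μ.restrict A).map (fun ω => (y ω, X ω))) := by
      rw [integral_map hyX.aemeasurable hφ.aestronglyMeasurable]
    have hri : Integrable (fun ω => y ω - g (X ω)) μ := hyint.sub hgint
    rw [e1, hmap, integral_map hyX.aemeasurable hφ.aestronglyMeasurable,
      integral_withDensity_eq_integral_toReal_smul hmeas.ennreal_ofReal
        (Eventually.of_forall fun _ => ENNReal.ofReal_lt_top)]
    calc ∫ ω, (ENNReal.ofReal (h ω)).toReal • (y ω - g (X ω)) ∂μ
        = ∫ ω, h ω * (y ω - g (X ω)) ∂μ := by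
          refine integral_congr_ae ?_
          filter_upwards [h0] with ω a
          simp [ENNReal.toReal_ofReal a]
      _ = ∫ ω, h ω * (μ[fun ω => y ω - g (X ω) | mX]) ω ∂μ :=
          integral_mul_eq_integral_mul_condExp hX_le hsm
            (hri.bdd_mul hmeas.aestronglyMeasurable hb) hri
      _ = ∫ _, (0 : ℝ) ∂μ := by
          refine integral_congr_ae ?_
          have c1 : μ[fun ω => y ω - g (X ω) | mX] =ᵐ[μ]
              μ[y | mX] - μ[fun ω => g (X ω) | mX] := condExp_sub hyint hgint mX
          have c2 : μ[fun ω => g (X ω) | mX] = fun ω => g (X ω) :=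
            condExp_of_stronglyMeasurable hX_le hg_sm hgint
          filter_upwards [c1, hgy] with ω a b
          rw [a, Pi.sub_apply, c2, ← b]
          simp
      _ = 0 := by simp
  · have hφ : Measurable (fun q : ℝ × Cov d => ENNReal.ofReal ((q.1 - g q.2) ^ 2)) := by fun_prop
    have hφX : Measurable (fun ω => ENNReal.ofReal ((y ω - g (X ω)) ^ 2)) := by fun_prop
    have e1 : ∫⁻ ω in A, ENNReal.ofReal ((y ω - g (X ω)) ^ 2) ∂μ =
        ∫⁻ q, ENNReal.ofReal ((q.1 - g q.2) ^ 2)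
          ∂((μ.restrict A).map (fun ω => (y ω, X ω))) := by
      rw [lintegral_map hφ hyX]
    have hqi : Integrable (fun ω => (y ω - g (X ω)) ^ 2) μ := hq2.integrable_sq
    have hhq : Integrable (fun ω => h ω * (y ω - g (X ω)) ^ 2) μ :=
      hqi.bdd_mul hmeas.aestronglyMeasurable hb
    rw [e1, hmap, lintegral_map hφ hyX,
      lintegral_withDensity_eq_lintegral_mul _ hmeas.ennreal_ofReal hφX]
    have hc : μ[fun ω => (y ω - g (X ω)) ^ 2 | mX] =ᵐ[μ] Var[y; μ | mX] := by
      refine condExp_congr_ae ?_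
      filter_upwards [hgy] with ω a
      simp [a]
    calc ∫⁻ ω, ((fun ω => ENNReal.ofReal (h ω)) *
          fun ω => ENNReal.ofReal ((y ω - g (X ω)) ^ 2)) ω ∂μ
        = ∫⁻ ω, ENNReal.ofReal (h ω * (y ω - g (X ω)) ^ 2) ∂μ := by
          refine lintegral_congr fun ω => ?_
          rw [Pi.mul_apply, ENNReal.ofReal_mul' (sq_nonneg _)]
      _ = ENNReal.ofReal (∫ ω, h ω * (y ω - g (X ω)) ^ 2 ∂μ) := by
          rw [ofReal_integral_eq_lintegral_ofReal hhq]
          filter_upwards [h0] with ω a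
          exact mul_nonneg a (sq_nonneg _)
      _ = ENNReal.ofReal (∫ ω, h ω * (μ[fun ω => (y ω - g (X ω)) ^ 2 | mX]) ω ∂μ) := by
          rw [integral_mul_eq_integral_mul_condExp hX_le hsm hhq hqi]
      _ ≤ ENNReal.ofReal (∫ ω, h ω * V ∂μ) := by
          refine ENNReal.ofReal_le_ofReal (integral_mono_ae ?_ ?_ ?_)
          · exact integrable_condExp.bdd_mul hmeas.aestronglyMeasurable hb
          · exact integrable_condExp.mul_const V
          · filter_upwards [h0, hc, hV] with ω a b c
            simp only [b]
            gcongr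
      _ = ENNReal.ofReal V * μ A := by
          rw [integral_mul_const, integral_condExp hX_le, integral_indicator hAm,
            setIntegral_const, smul_eq_mul, mul_one, mul_comm,
            ENNReal.ofReal_mul' measureReal_nonneg, ofReal_measureReal]

end Residual

/-! ### Residuals assembled over exposure cells. -/

section CellResidual

variable {Ω : Type*} {mX mW m₀ : MeasurableSpace Ω} {μ : Measure Ω} [IsProbabilityMeasure μ] {d : ℕ}
  {Z : Ω → ℝ} {X : Ω → Cov d} {ι : Type*} [Fintype ι]

/-- Moments, given the design, of a residual that is assembled from unconfounded pieces living on
disjoint exposure cells. -/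
theorem cellResidual_moments
    (hmX : mX = MeasurableSpace.comap X inferInstance)
    (hmW : mW = MeasurableSpace.comap (fun ω => (Z ω, X ω)) inferInstance) (hZ : Measurable Z) (hX : Measurable X)
    {y : ι → Ω → ℝ} (hy : ∀ k, Measurable (y k)) {I cell : ι → Set ℝ}
    (hcell : ∀ k, MeasurableSet (cell k)) (hdisj : Pairwise fun k l => Disjoint (cell k) (cell l))
    (hcI : ∀ k, cell k ⊆ I k)
    (hconf : ∀ k, ∀ B : Set ℝ, MeasurableSet B → ∀ᵐ ω ∂μ, Z ω ∈ I k →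
      (μ⟦y k ⁻¹' B | mW⟧) ω =
        (μ⟦y k ⁻¹' B | mX⟧) ω)
    {g : ι → Cov d → ℝ} (hg : ∀ k, Measurable (g k))
    (hgy : ∀ k, (fun ω => g k (X ω)) =ᵐ[μ] μ[y k | mX])
    (hy2 : ∀ k, MemLp (y k) 2 μ) {V : ℝ}
    (hV : ∀ k, ∀ᵐ ω ∂μ, Var[y k; μ | mX] ω ≤ V)
    {e : Ω → ℝ}
    (he : e = fun ω => ∑ k, (cell k).indicator 1 (Z ω) * (y k ω - g k (X ω))) :
    MemLp e 2 μ ∧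
    (∀ G : ℝ × Cov d → ℝ, Measurable G → (∃ B, ∀ w, |G w| ≤ B) →
      ∫ ω, G (Z ω, X ω) * e ω ∂μ = 0) ∧
    (∀ G : ℝ × Cov d → ENNReal, Measurable G →
      ∫⁻ ω, G (Z ω, X ω) * ENNReal.ofReal (e ω ^ 2) ∂μ ≤
        ENNReal.ofReal V * ∫⁻ ω, G (Z ω, X ω) ∂μ) := by
  classical
  have hW : Measurable (fun ω => (Z ω, X ω)) := hZ.prodMk hX
  have hZc : ∀ k, MeasurableSet (Z ⁻¹' cell k) := fun k => hZ (hcell k)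
  have hres : ∀ k, MemLp (fun ω => y k ω - g k (X ω)) 2 μ := fun k =>
    (hy2 k).sub ((memLp_congr_ae (hgy k)).2 ((hy2 k).condExp one_le_two))
  have hpiece : ∀ k ω, (cell k).indicator 1 (Z ω) * (y k ω - g k (X ω)) =
      (Z ⁻¹' cell k).indicator (fun ω => y k ω - g k (X ω)) ω := by
    intro k ω
    by_cases h : Z ω ∈ cell k
    · rw [Set.indicator_of_mem h, Set.indicator_of_mem (by exact h)]; simp
    · rw [Set.indicator_of_notMem h, Set.indicator_of_notMem (by exact h)]; simp
  have he' : e = fun ω => ∑ k, (Z ⁻¹' cell k).indicator (fun ω => y k ω - g k (X ω)) ω := by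
    rw [he]
    funext ω
    exact Finset.sum_congr rfl fun k _ => hpiece k ω
  have hmem : MemLp e 2 μ := by
    rw [he']
    exact memLp_finsetSum _ fun k _ => (hres k).indicator (hZc k)
  have hem : Measurable e := by
    rw [he']
    exact Finset.measurable_sum _ fun k _ =>
      ((hy k).sub ((hg k).comp hX)).indicator (hZc k)
  -- The cells are disjoint, so at most one summand is nonzero and the square has no mixed terms.
  have hsq : ∀ ω, ENNReal.ofReal (e ω ^ 2) = ∑ k, (Z ⁻¹' cell k).indicator
      (fun ω => ENNReal.ofReal ((y k ω - g k (X ω)) ^ 2)) ω := by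
    intro ω
    rw [he']
    by_cases h : ∃ k, Z ω ∈ cell k
    · obtain ⟨k, hk⟩ := h
      have hne : ∀ l, l ≠ k → ω ∉ Z ⁻¹' cell l := fun l hl hm =>
        (Set.disjoint_left.1 (hdisj hl)) hm hk
      simp only
      rw [Finset.sum_eq_single k (fun l _ hl => Set.indicator_of_notMem (hne l hl) _) (by simp),
        Finset.sum_eq_single k (fun l _ hl => Set.indicator_of_notMem (hne l hl) _) (by simp),
        Set.indicator_of_mem (by exact hk), Set.indicator_of_mem (by exact hk)]
    · push Not at h
      simp only
      rw [Finset.sum_eq_zero fun k _ => Set.indicator_of_notMem (by exact h k) _,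
        Finset.sum_eq_zero fun k _ => Set.indicator_of_notMem (by exact h k) _]
      simp
  have hpre : ∀ k (S : Set (ℝ × Cov d)), (fun ω => (Z ω, X ω)) ⁻¹' (S ∩ Prod.fst ⁻¹' cell k) =
      Z ⁻¹' cell k ∩ (fun ω => (Z ω, X ω)) ⁻¹' S := by
    intro k S
    ext ω
    simp only [Set.mem_preimage, Set.mem_inter_iff]
    tauto
  have hmom := fun k (S : Set (ℝ × Cov d)) (hS : MeasurableSet S) =>
    setIntegral_residual hmX hmW (hy k) hZ hX (hconf k) (hS.inter (measurable_fst (hcell k)))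
      (fun w hw => hcI k hw.2) (hg k) (hgy k) (hy2 k) (hV k)
  simp only [hpre] at hmom
  refine ⟨hmem, ?_, ?_⟩
  · intro G hG hGb
    obtain ⟨B, hB⟩ := hGb
    have hW_le : mW ≤ m₀ := hmW ▸ hW.comap_le
    have hei : Integrable e μ := hmem.integrable one_le_two
    -- The conditional mean given the design is identified by integrating over events `(Z, X) ∈ S`.
    -- Each cell cuts out a smaller event of the same form, on which its own piece integrates to
    -- zero.
    have hzero : (0 : Ω → ℝ) =ᵐ[μ] μ[e | mW] := by
      refine ae_eq_condExp_of_forall_setIntegral_eq hW_le hei (fun _ _ _ => integrableOn_zero) ?_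
        stronglyMeasurable_zero.aestronglyMeasurable
      intro A hA _
      rw [hmW] at hA
      obtain ⟨S, hS, rfl⟩ := hA
      rw [he', integral_finsetSum]
      · simp only [Pi.zero_apply, integral_zero]
        symm
        refine Finset.sum_eq_zero fun k _ => ?_
        rw [integral_indicator (hZc k), Measure.restrict_restrict (hZc k)]
        exact (hmom k S hS).1
      · intro k _
        exact (((hres k).integrable one_le_two).indicator (hZc k)).integrableOn
    have hGW : StronglyMeasurable[mW] fun ω => G (Z ω, X ω) :=
      hmW ▸ (hG.comp (comap_measurable (fun ω => (Z ω, X ω)))).stronglyMeasurable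
    rw [integral_mul_eq_integral_mul_condExp hW_le hGW
      (hei.bdd_mul (hG.comp hW).aestronglyMeasurable
        (Eventually.of_forall fun ω => hB (Z ω, X ω))) hei]
    rw [integral_eq_zero_of_ae]
    filter_upwards [hzero] with ω hω
    rw [← hω]
    simp
  · intro G hG
    -- The variance bound is proved as an inequality between measures on the design space, where
    -- only sets need checking. It then holds against every nonnegative measurable `G`.
    have hle : (μ.withDensity fun ω => ENNReal.ofReal (e ω ^ 2)).map (fun ω => (Z ω, X ω)) ≤
        ENNReal.ofReal V • μ.map (fun ω => (Z ω, X ω)) := by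
      refine Measure.le_iff.2 fun S hS => ?_
      rw [Measure.map_apply hW hS, withDensity_apply _ (hW hS), Measure.smul_apply,
        Measure.map_apply hW hS, smul_eq_mul]
      simp_rw [hsq]
      have hqm : ∀ k, Measurable ((Z ⁻¹' cell k).indicator
          fun ω => ENNReal.ofReal ((y k ω - g k (X ω)) ^ 2)) := fun k =>
        (((hy k).sub ((hg k).comp hX)).pow_const 2).ennreal_ofReal.indicator (hZc k)
      rw [lintegral_finsetSum _ fun k _ => hqm k]
      calc ∑ k, ∫⁻ ω in (fun ω => (Z ω, X ω)) ⁻¹' S, (Z ⁻¹' cell k).indicator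
            (fun ω => ENNReal.ofReal ((y k ω - g k (X ω)) ^ 2)) ω ∂μ
          ≤ ∑ k, ENNReal.ofReal V * μ (Z ⁻¹' cell k ∩ (fun ω => (Z ω, X ω)) ⁻¹' S) := by
            refine Finset.sum_le_sum fun k _ => ?_
            rw [lintegral_indicator (hZc k), Measure.restrict_restrict (hZc k)]
            exact (hmom k S hS).2
        _ = ENNReal.ofReal V * μ (⋃ k, Z ⁻¹' cell k ∩ (fun ω => (Z ω, X ω)) ⁻¹' S) := by
            rw [← Finset.mul_sum, measure_iUnion, tsum_fintype]
            · intro k l hkl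
              refine Disjoint.mono Set.inter_subset_left Set.inter_subset_left ?_
              exact (hdisj hkl).preimage Z
            · exact fun k => (hZc k).inter (hW hS)
        _ ≤ _ := by
            gcongr
            exact Set.iUnion_subset fun k => Set.inter_subset_right
    have h1 := lintegral_mono' hle (le_refl G)
    have hGW : Measurable fun ω => G (Z ω, X ω) := hG.comp hW
    rw [lintegral_smul_measure, lintegral_map hG hW, lintegral_map hG hW,
      lintegral_withDensity_eq_lintegral_mul _ (hem.pow_const 2).ennreal_ofReal hGW] at h1
    refine le_of_eq_of_le (lintegral_congr fun ω => ?_) h1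
    simp [mul_comm]

end CellResidual

/-! ### Consequences of overlap and of the covariate density. -/

section Overlap

variable {Ω : Type*} [MeasurableSpace Ω] {μ : Measure Ω} {d : ℕ}

/-- Strict overlap bounds the conditional probability of missing an exposure window. -/
theorem StrictOverlap.exists_miss_bound [IsProbabilityMeasure μ] {𝒵 : Set ℝ} {𝒳 : Set (Cov d)} {Z : Ω → ℝ}
    {X : Ω → Cov d} (hZ : Measurable Z) (hX : Measurable X) (hmem : ∀ᵐ ω ∂μ, X ω ∈ 𝒳)
    (h : StrictOverlap μ 𝒵 𝒳 Z X) :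
    ∃ ζ > 0, ∀ a b : ℝ, a ≤ b → Set.Icc a b ⊆ 𝒵 → ζ * (b - a) ≤ 1 ∧
      ∀ g : Cov d → ENNReal, Measurable g →
        ∫⁻ w, g w.2 * (Set.Icc a b)ᶜ.indicator 1 w.1 ∂(μ.map fun ω => (Z ω, X ω)) ≤
          ENNReal.ofReal (1 - ζ * (b - a)) *
            ∫⁻ w, g w.2 ∂(μ.map fun ω => (Z ω, X ω)) := by
  obtain ⟨f, ⟨hf, hdens⟩, ζ, hζ, hlow⟩ := h
  refine ⟨ζ, hζ, fun a b hab hsub => ?_⟩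
  have hW : Measurable fun ω => (Z ω, X ω) := hZ.prodMk hX
  set P := μ.map fun ω => (Z ω, X ω) with hP
  have : IsProbabilityMeasure P := Measure.isProbabilityMeasure_map hW.aemeasurable
  have : IsProbabilityMeasure (μ.map X) := Measure.isProbabilityMeasure_map hX.aemeasurable
  have hof : Measurable fun q : ℝ × Cov d => ENNReal.ofReal (f q.1 q.2) := hf.ennreal_ofReal
  have hcm : Measurable fun x => ∫⁻ z in Set.Icc a b, ENNReal.ofReal (f z x) :=
    Measurable.lintegral_prod_left' (μ := volume.restrict (Set.Icc a b)) hof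
  have hae : ∀ᵐ x ∂(μ.map X), ENNReal.ofReal (ζ * (b - a)) ≤
      ∫⁻ z in Set.Icc a b, ENNReal.ofReal (f z x) := by
    rw [ae_map_iff hX.aemeasurable (measurableSet_le measurable_const hcm)]
    filter_upwards [hmem] with ω hω
    calc ENNReal.ofReal (ζ * (b - a)) = ∫⁻ _ in Set.Icc a b, ENNReal.ofReal ζ := by
          rw [setLIntegral_const, Real.volume_Icc, ENNReal.ofReal_mul hζ.le]
      _ ≤ _ := setLIntegral_mono' measurableSet_Icc fun z hz =>
          ENNReal.ofReal_le_ofReal (hlow z (hsub hz) _ hω)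
  have hin : ∀ D : Set (Cov d), MeasurableSet D →
      ENNReal.ofReal (ζ * (b - a)) * μ.map X D ≤ P (Set.Icc a b ×ˢ D) := by
    intro D hD
    rw [hdens, withDensity_apply _ (measurableSet_Icc.prod hD), ← Measure.prod_restrict,
      lintegral_prod_symm _ hof.aemeasurable]
    calc ENNReal.ofReal (ζ * (b - a)) * μ.map X D
        = ∫⁻ _ in D, ENNReal.ofReal (ζ * (b - a)) ∂(μ.map X) := by rw [setLIntegral_const]
      _ ≤ _ := lintegral_mono_ae (ae_restrict_of_ae hae)
  have hsnd : P.map Prod.snd = μ.map X := by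
    rw [hP, Measure.map_map measurable_snd hW]
    rfl
  have hp0 : 0 ≤ ζ * (b - a) := mul_nonneg hζ.le (by linarith)
  -- Total mass one forces the lower bound on the hitting probability to be at most one.
  have hp1 : ζ * (b - a) ≤ 1 := by
    have h1 := (hin Set.univ MeasurableSet.univ).trans prob_le_one
    rw [measure_univ, mul_one] at h1
    exact ENNReal.ofReal_le_one.1 h1
  refine ⟨hp1, fun g hg => ?_⟩
  have hle : (P.restrict (Prod.fst ⁻¹' (Set.Icc a b)ᶜ)).map Prod.snd ≤
      ENNReal.ofReal (1 - ζ * (b - a)) • P.map Prod.snd := by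
    refine Measure.le_iff.2 fun D hD => ?_
    rw [Measure.map_apply measurable_snd hD, Measure.restrict_apply (measurable_snd hD),
      Measure.smul_apply, hsnd, smul_eq_mul]
    have h1 := hin D hD
    have h2 : P (Prod.snd ⁻¹' D) = μ.map X D := by
      rw [← hsnd, Measure.map_apply measurable_snd hD]
    have h3 := measure_inter_add_sdiff (μ := P) (Prod.snd ⁻¹' D)
      (measurable_fst (measurableSet_Icc (a := a) (b := b)) :
        MeasurableSet ((Prod.fst : ℝ × Cov d → ℝ) ⁻¹' Set.Icc a b))
    have e1 : (Prod.snd ⁻¹' D ∩ Prod.fst ⁻¹' Set.Icc a b : Set (ℝ × Cov d)) =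
        Set.Icc a b ×ˢ D := by
      ext w; simp only [Set.mem_inter_iff, Set.mem_preimage, Set.mem_prod]; tauto
    have e2 : (Prod.snd ⁻¹' D \ Prod.fst ⁻¹' Set.Icc a b : Set (ℝ × Cov d)) =
        Prod.snd ⁻¹' D ∩ Prod.fst ⁻¹' (Set.Icc a b)ᶜ := rfl
    rw [e1, e2, h2] at h3
    -- The miss probability arises by subtraction from the whole, which is done with real numbers;
    -- all measures here are finite.
    have hr := congrArg ENNReal.toReal h3
    rw [ENNReal.toReal_add (measure_ne_top _ _) (measure_ne_top _ _)] at hr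
    have h1r := ENNReal.toReal_mono (measure_ne_top _ _) h1
    rw [ENNReal.toReal_mul, ENNReal.toReal_ofReal hp0] at h1r
    rw [← ENNReal.toReal_le_toReal (measure_ne_top _ _)
      (ENNReal.mul_ne_top ENNReal.ofReal_ne_top (measure_ne_top _ _)), ENNReal.toReal_mul,
      ENNReal.toReal_ofReal (by linarith)]
    linarith
  have h1 := lintegral_mono' hle (le_refl g)
  rw [lintegral_smul_measure, lintegral_map hg measurable_snd, lintegral_map hg measurable_snd,
    ← lintegral_indicator (measurable_fst measurableSet_Icc.compl)] at h1
  refine le_of_eq_of_le (lintegral_congr fun w => ?_) h1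
  by_cases hw : w.1 ∈ (Set.Icc a b)ᶜ
  · rw [Set.indicator_of_mem hw, Set.indicator_of_mem (by exact hw)]; simp
  · rw [Set.indicator_of_notMem hw, Set.indicator_of_notMem (by exact hw)]; simp

/-- Spheres are Lebesgue null once `d ≥ 1`; in dimension zero the sphere of radius zero would be the
whole space. -/
theorem ae_dist_ne_of_density (hd : 1 ≤ d) {Z : Ω → ℝ} {X : Ω → Cov d} (hZ : Measurable Z)
    (hX : Measurable X) {ϕ : Cov d → ENNReal}
    (hϕ : μ.map X = (volume : Measure (Cov d)).withDensity ϕ) (x : Cov d) (ρ : ℝ) :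
    ∀ᵐ w ∂(μ.map fun ω => (Z ω, X ω)), dist w.2 x ≠ ρ := by
  have : Nonempty (Fin d) := ⟨⟨0, hd⟩⟩
  have h1 : ∀ᵐ x' ∂(μ.map X), dist x' x ≠ ρ := by
    rw [hϕ]
    have h0 : ∀ᵐ x' ∂(volume : Measure (Cov d)), dist x' x ≠ ρ := by
      have := Measure.addHaar_sphere (volume : Measure (Cov d)) x ρ
      rw [ae_iff]
      simpa [Metric.sphere] using this
    exact (withDensity_absolutelyContinuous _ _).ae_le h0
  have hm : MeasurableSet {x' : Cov d | dist x' x ≠ ρ} :=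
    (measurableSet_eq_fun (by fun_prop) measurable_const).compl
  rw [ae_map_iff hX.aemeasurable hm] at h1
  have hm2 : MeasurableSet {w : ℝ × Cov d | dist w.2 x ≠ ρ} :=
    hm.preimage (measurable_snd : Measurable fun w : ℝ × Cov d => w.2)
  rw [ae_map_iff (hZ.prodMk hX).aemeasurable hm2]
  exact h1

end Overlap

/-! ### Covering a bounded covariate domain by boxes. -/

section Boxes

variable {d : ℕ}

/-- The index of the box of side `h` that contains `x`. -/
def boxIndex (h : ℝ) (x : Cov d) : Fin d → ℤ := fun i => ⌊x i / h⌋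

theorem measurableSet_boxIndex_eq (h : ℝ) :
    MeasurableSet {q : Cov d × Cov d | boxIndex h q.1 = boxIndex h q.2} := by
  have hm : Measurable (boxIndex h : Cov d → Fin d → ℤ) := by
    refine measurable_pi_iff.2 fun i => Int.measurable_floor.comp ?_
    fun_prop
  exact measurableSet_eq_fun (hm.comp measurable_fst) (hm.comp measurable_snd)

/-- Coordinatewise distance at most `h` gives `√d * h`; the cruder factor `d` avoids the square
root. -/
theorem dist_le_of_boxIndex_eq {h : ℝ} (hh : 0 < h) {x x' : Cov d}
    (hx : boxIndex h x = boxIndex h x') : dist x x' ≤ d * h := by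
  have hi : ∀ i, |x i - x' i| ≤ h := by
    intro i
    have h1 := Int.abs_sub_lt_one_of_floor_eq_floor (congrFun hx i)
    rw [← sub_div, abs_div, abs_of_pos hh, div_lt_one hh] at h1
    exact h1.le
  rw [EuclideanSpace.dist_eq]
  refine Real.sqrt_le_iff.2 ⟨by positivity, ?_⟩
  calc ∑ i, dist (x i) (x' i) ^ 2 ≤ ∑ _i : Fin d, h ^ 2 := by
        refine Finset.sum_le_sum fun i _ => ?_
        rw [Real.dist_eq]
        have := hi i
        gcongr
    _ = d * h ^ 2 := by simp
    _ ≤ (d * h) ^ 2 := by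
        have : (d : ℝ) ≤ (d : ℝ) ^ 2 := by
          exact_mod_cast Nat.le_self_pow two_ne_zero d
        nlinarith [sq_nonneg h]

/-- A ball of radius `R` meets at most `c / t ^ max d 2` boxes of diameter `t ≤ 2 * R`. -/
theorem exists_box_count (hd : 1 ≤ d) {R : ℝ} (hR : 0 < R) :
    ∃ c > 0, ∀ t > 0, t ≤ 2 * R → ∃ T : Finset (Fin d → ℤ),
      (∀ x : Cov d, ‖x‖ ≤ R → boxIndex (t / d) x ∈ T) ∧ (T.card : ℝ) ≤ c / t ^ (max d 2) := by
  have hd0 : (0 : ℝ) < d := by exact_mod_cast hd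
  -- Each axis carries at most `2 R d / t + 2` intervals, and `t ≤ 2 R` absorbs the 2 into `4 R /
  -- t`.
  set c₀ : ℝ := 2 * R * d + 4 * R with hc₀
  have hc₀p : 0 < c₀ := by positivity
  refine ⟨c₀ ^ d * (2 * R) ^ (max d 2 - d), by positivity, fun t ht htR => ?_⟩
  set h := t / d with hh
  have hhp : 0 < h := by positivity
  refine ⟨Fintype.piFinset fun _ => Finset.Icc ⌊-R / h⌋ ⌊R / h⌋, fun x hx => ?_, ?_⟩
  · refine Fintype.mem_piFinset.2 fun i => Finset.mem_Icc.2 ?_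
    have hxi : |x i| ≤ R := by
      have := PiLp.norm_apply_le x i
      rw [Real.norm_eq_abs] at this
      exact this.trans hx
    rw [abs_le] at hxi
    exact ⟨Int.floor_le_floor (by have := hxi.1; gcongr), Int.floor_le_floor (by have := hxi.2; gcongr)⟩
  · rw [Fintype.card_piFinset]
    simp only [Int.card_Icc, Finset.prod_const, Finset.card_univ, Fintype.card_fin]
    push_cast
    have hcard : (((⌊R / h⌋ + 1 - ⌊-R / h⌋).toNat : ℕ) : ℝ) ≤ c₀ / t := by
      have hnn : 0 ≤ ⌊R / h⌋ + 1 - ⌊-R / h⌋ := by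
        have : ⌊-R / h⌋ ≤ ⌊R / h⌋ := Int.floor_le_floor (by gcongr; linarith)
        omega
      have e : (((⌊R / h⌋ + 1 - ⌊-R / h⌋).toNat : ℕ) : ℝ) =
          ((⌊R / h⌋ + 1 - ⌊-R / h⌋ : ℤ) : ℝ) := by
        exact_mod_cast Int.toNat_of_nonneg hnn
      rw [e]
      push_cast
      have h1 := Int.floor_le (R / h)
      have h2 := Int.lt_floor_add_one (-R / h)
      have h3 : -R / h = -(R / h) := neg_div _ _
      have h4 : c₀ / t = 2 * (R / h) + 4 * R / t := by
        rw [hc₀, hh]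
        field_simp
      have h5 : 2 ≤ 4 * R / t := by
        rw [le_div_iff₀ ht]
        linarith
      linarith
    have hmax : max d 2 = d + (max d 2 - d) := by omega
    have e2 : t ^ max d 2 = t ^ d * t ^ (max d 2 - d) := by rw [← pow_add, ← hmax]
    calc (((⌊R / h⌋ + 1 - ⌊-R / h⌋).toNat : ℕ) : ℝ) ^ d ≤ (c₀ / t) ^ d := by gcongr
      _ = c₀ ^ d * t ^ (max d 2 - d) / t ^ max d 2 := by
          rw [e2, div_pow]
          field_simp
      _ ≤ _ := by gcongr

end Boxes

/-! ### Mean distance to the nearest candidate. -/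

section Discrepancy

variable {d : ℕ}

/-- A bound in mean for the distance to the nearest candidate. -/
theorem exists_discrepancy_bound (hd : 1 ≤ d) {R : ℝ} (hR : 0 < R) :
    ∃ c > 0, ∀ (P : Measure (ℝ × Cov d)) [IsProbabilityMeasure P] (𝒞 : Set ℝ)
      (_ : MeasurableSet 𝒞) (p : ℝ) (_ : 0 < p) (_ : p ≤ 1)
      (_ : ∀ h : Cov d → ENNReal, Measurable h →
        ∫⁻ w, h w.2 * 𝒞ᶜ.indicator 1 w.1 ∂P ≤ ENNReal.ofReal (1 - p) * ∫⁻ w, h w.2 ∂P)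
      (N : ℕ) (_ : ∀ᵐ u ∂Measure.pi (fun _ : Fin N => P), ∀ i, ‖(u i).2‖ ≤ R)
      (s : ℝ) (_ : 0 < s),
      ∃ F : (Fin N → ℝ × Cov d) → ENNReal, Measurable F ∧
        ∫⁻ u, F u ∂Measure.pi (fun _ : Fin N => P) ≤
          ENNReal.ofReal (s * (N + c / (s ^ (max d 2) * p))) ∧
        ∀ u, (∀ i, ‖(u i).2‖ ≤ R) → ∀ j : Fin N → Fin N,
          (∀ i, (u (j i)).1 ∈ 𝒞 ∧
            ∀ l, (u l).1 ∈ 𝒞 → dist (u (j i)).2 (u i).2 ≤ dist (u l).2 (u i).2) →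
          ENNReal.ofReal (∑ i, dist (u (j i)).2 (u i).2) ≤ F u := by
  classical
  obtain ⟨c, hc, hbox⟩ := exists_box_count hd hR
  have hd0 : (0 : ℝ) < d := by exact_mod_cast hd
  refine ⟨2 * c, by positivity, ?_⟩
  intro P _ 𝒞 h𝒞 p hp hp1 hP N hN s hs
  -- The dyadic sum below has terms `2 ^ k / (2 ^ k) ^ D`. Taking `D ≥ 2` makes it a convergent
  -- geometric series also for `d = 1`.
  set D := max d 2
  have hexK : ∃ K : ℕ, 2 * R ≤ s * 2 ^ K := by
    obtain ⟨K, hK⟩ := pow_unbounded_of_one_lt (2 * R / s) (one_lt_two)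
    exact ⟨K, by rw [div_lt_iff₀ hs] at hK; linarith⟩
  -- The least scale exceeding the diameter `2 R`: at `K` the distance bound is trivial, and every
  -- smaller scale satisfies the size restriction of the box count.
  set K := Nat.find hexK with hKdef
  have hK : 2 * R ≤ s * 2 ^ K := Nat.find_spec hexK
  have hKlt : ∀ k < K, s * 2 ^ k ≤ 2 * R := fun k hk => (not_le.1 (Nat.find_min hexK hk)).le
  have hT : ∀ k, ∃ T : Finset (Fin d → ℤ), k < K →
      (∀ x : Cov d, ‖x‖ ≤ R → boxIndex (s * 2 ^ k / d) x ∈ T) ∧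
        (T.card : ℝ) ≤ c / (s * 2 ^ k) ^ D := by
    intro k
    by_cases hk : k < K
    · obtain ⟨T, hT⟩ := hbox (s * 2 ^ k) (by positivity) (hKlt k hk)
      exact ⟨T, fun _ => hT⟩
    · exact ⟨∅, fun h => absurd h hk⟩
  choose T hT using hT
  let E : ℕ → Fin N → Set (Fin N → ℝ × Cov d) := fun k i => {u | ∀ l,
    boxIndex (s * 2 ^ k / d) (u l).2 = boxIndex (s * 2 ^ k / d) (u i).2 → (u l).1 ∉ 𝒞}
  have hEm : ∀ k i, MeasurableSet (E k i) := by
    intro k i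
    have : E k i = ⋂ l, ({u : Fin N → ℝ × Cov d | boxIndex (s * 2 ^ k / d) (u l).2 =
        boxIndex (s * 2 ^ k / d) (u i).2}ᶜ ∪ {u : Fin N → ℝ × Cov d | (u l).1 ∈ 𝒞}ᶜ) := by
      ext u
      simp [E, imp_iff_not_or]
    rw [this]
    refine MeasurableSet.iInter fun l => MeasurableSet.union (MeasurableSet.compl ?_)
      (MeasurableSet.compl ?_)
    · exact (measurableSet_boxIndex_eq _).preimage
        (by fun_prop : Measurable fun u : Fin N → ℝ × Cov d => ((u l).2, (u i).2))
    · exact h𝒞.preimage (by fun_prop : Measurable fun u : Fin N → ℝ × Cov d => (u l).1)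
  -- The majorant charges `2 ^ k` for each unit whose box at scale `k` contains no candidate. It
  -- does not involve the matching, so it is measurable whatever the choice of matches.
  let F : (Fin N → ℝ × Cov d) → ENNReal := fun u => ENNReal.ofReal s *
    (N + ∑ k ∈ Finset.range K, ENNReal.ofReal (2 ^ k) * ∑ i, (E k i).indicator 1 u)
  have hsm : ∀ k, Measurable fun u : Fin N → ℝ × Cov d =>
      ∑ i, (E k i).indicator (1 : (Fin N → ℝ × Cov d) → ENNReal) u := fun k =>
    Finset.measurable_sum _ fun i _ => measurable_one.indicator (hEm k i)
  have hsm2 : Measurable fun u : Fin N → ℝ × Cov d => ∑ k ∈ Finset.range K,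
      ENNReal.ofReal (2 ^ k) * ∑ i, (E k i).indicator (1 : (Fin N → ℝ × Cov d) → ENNReal) u :=
    Finset.measurable_sum _ fun k _ => (hsm k).const_mul _
  have hFm : Measurable F := (measurable_const.add hsm2).const_mul _
  refine ⟨F, hFm, ?_, ?_⟩
  · have hm3 : Measurable fun u : Fin N → ℝ × Cov d => (N : ENNReal) + ∑ k ∈ Finset.range K,
        ENNReal.ofReal (2 ^ k) * ∑ i, (E k i).indicator (1 : (Fin N → ℝ × Cov d) → ENNReal) u :=
      measurable_const.add hsm2
    simp only [F]
    rw [lintegral_const_mul _ hm3, lintegral_add_left measurable_const,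
      lintegral_finsetSum _ fun k _ => (hsm k).const_mul _, ENNReal.ofReal_mul hs.le,
      ENNReal.ofReal_add (by positivity) (by positivity), ENNReal.ofReal_natCast]
    have hcst : ∫⁻ _ : Fin N → ℝ × Cov d, (N : ENNReal) ∂Measure.pi (fun _ : Fin N => P) = N := by
      simp
    rw [hcst]
    gcongr
    calc ∑ k ∈ Finset.range K, ∫⁻ u, ENNReal.ofReal (2 ^ k) * ∑ i, (E k i).indicator 1 u
          ∂Measure.pi (fun _ : Fin N => P)
        ≤ ∑ k ∈ Finset.range K, ENNReal.ofReal (c / (s ^ D * p) * (1 / 2) ^ k) := by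
          refine Finset.sum_le_sum fun k hk => ?_
          have hkK := Finset.mem_range.1 hk
          rw [lintegral_const_mul _ (hsm k)]
          have h1 := lintegral_card_cell_without_candidate_le (N := N) P h𝒞 hp hp1 hP
            (boxIndex (s * 2 ^ k / d)) (measurableSet_boxIndex_eq _) (T k)
            (hN.mono fun u hu i => (hT k hkK).1 _ (hu i))
          refine (mul_le_mul_right h1 _).trans ?_
          rw [← ENNReal.ofReal_natCast, ← ENNReal.ofReal_mul (by positivity),
            ← ENNReal.ofReal_mul (by positivity)]
          refine ENNReal.ofReal_le_ofReal ?_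
          have h2 := (hT k hkK).2
          have hD : 2 ≤ D := le_max_right _ _
          have h3 : ((2 : ℝ) ^ k) ^ 2 ≤ (2 ^ k) ^ D := pow_le_pow_right₀ (one_le_pow₀ one_le_two) hD
          calc (2 : ℝ) ^ k * ((T k).card * (1 / p))
              ≤ 2 ^ k * (c / (s * 2 ^ k) ^ D * (1 / p)) := by gcongr
            _ = c / (s ^ D * p) * (2 ^ k / (2 ^ k) ^ D) := by
                rw [mul_pow]
                field_simp
            _ ≤ c / (s ^ D * p) * (2 ^ k / (2 ^ k) ^ 2) := by gcongr
            _ = c / (s ^ D * p) * (1 / 2) ^ k := by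
                rw [div_pow, one_pow, sq]
                field_simp
      _ = ENNReal.ofReal (c / (s ^ D * p) * ∑ k ∈ Finset.range K, (1 / 2) ^ k) := by
          rw [← ENNReal.ofReal_sum_of_nonneg fun k _ => by positivity, Finset.mul_sum]
      _ ≤ _ := by
          refine ENNReal.ofReal_le_ofReal ?_
          have h2 : ∑ k ∈ Finset.range K, (1 / 2 : ℝ) ^ k ≤ 2 := sum_geometric_two_le K
          calc c / (s ^ D * p) * ∑ k ∈ Finset.range K, (1 / 2 : ℝ) ^ k
              ≤ c / (s ^ D * p) * 2 := by gcongr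
            _ = 2 * c / (s ^ D * p) := by ring
  · intro u hu j hj
    let I : ℕ → Fin N → ℝ := fun k i => (E k i).indicator 1 u
    have hI0 : ∀ k i, 0 ≤ I k i := fun k i => Set.indicator_nonneg (fun _ _ => zero_le_one) u
    -- If scale `n` is the first one whose box around unit `i` contains a candidate, the match is
    -- within `s * 2 ^ n`, and `2 ^ n = 1 + ∑ k < n, 2 ^ k` is paid for by the empty smaller boxes.
    have key : ∀ i, dist (u (j i)).2 (u i).2 ≤
        s * (1 + ∑ k ∈ Finset.range K, 2 ^ k * I k i) := by
      intro i
      have geo : ∀ n, n ≤ K → (∀ k < n, u ∈ E k i) →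
          (2 : ℝ) ^ n ≤ 1 + ∑ k ∈ Finset.range K, 2 ^ k * I k i := by
        intro n hn hall
        have h1 : ∑ k ∈ Finset.range n, (2 : ℝ) ^ k * I k i ≤
            ∑ k ∈ Finset.range K, (2 : ℝ) ^ k * I k i :=
          Finset.sum_le_sum_of_subset_of_nonneg (Finset.range_mono hn)
            fun k _ _ => mul_nonneg (by positivity) (hI0 k i)
        have h2 : ∑ k ∈ Finset.range n, (2 : ℝ) ^ k * I k i = 2 ^ n - 1 := by
          rw [Finset.sum_congr rfl fun k hk => by
            rw [show I k i = 1 from Set.indicator_of_mem (hall k (Finset.mem_range.1 hk)) _,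
              mul_one]]
          rw [geom_sum_eq (by norm_num)]
          norm_num
        linarith
      by_cases hall : ∀ k < K, u ∈ E k i
      · have h1 := geo K le_rfl hall
        calc dist (u (j i)).2 (u i).2 ≤ ‖(u (j i)).2‖ + ‖(u i).2‖ := dist_le_norm_add_norm _ _
          _ ≤ 2 * R := by linarith [hu (j i), hu i]
          _ ≤ s * 2 ^ K := hK
          _ ≤ _ := by gcongr
      · push Not at hall
        have hex : ∃ k, k < K ∧ u ∉ E k i := hall
        set n := Nat.find hex with hn
        obtain ⟨hnK, hnE⟩ := Nat.find_spec hex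
        rw [← hn] at hnK hnE
        have hmin : ∀ k < n, u ∈ E k i := by
          intro k hk
          have := Nat.find_min hex hk
          by_contra hcon
          exact this ⟨hk.trans hnK, hcon⟩
        have h1 := geo n hnK.le hmin
        simp only [E, Set.mem_ofPred_eq] at hnE
        push Not at hnE
        obtain ⟨l, hl, hlC⟩ := hnE
        have h2 := dist_le_of_boxIndex_eq (by positivity) hl
        calc dist (u (j i)).2 (u i).2 ≤ dist (u l).2 (u i).2 := (hj i).2 l hlC
          _ ≤ d * (s * 2 ^ n / d) := h2
          _ = s * 2 ^ n := by field_simp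
          _ ≤ _ := by gcongr
    have hsum : ∑ i, dist (u (j i)).2 (u i).2 ≤
        s * (N + ∑ k ∈ Finset.range K, 2 ^ k * ∑ i, I k i) := by
      refine (Finset.sum_le_sum fun i _ => key i).trans (le_of_eq ?_)
      rw [← Finset.mul_sum, Finset.sum_add_distrib, Finset.sum_comm]
      simp [Finset.mul_sum]
    refine (ENNReal.ofReal_le_ofReal hsum).trans (le_of_eq ?_)
    have hIs : ∀ k, 0 ≤ ∑ i, I k i := fun k => Finset.sum_nonneg fun i _ => hI0 k i
    simp only [F]
    rw [ENNReal.ofReal_mul hs.le, ENNReal.ofReal_add (by positivity)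
      (Finset.sum_nonneg fun k _ => mul_nonneg (by positivity) (hIs k)), ENNReal.ofReal_natCast,
      ENNReal.ofReal_sum_of_nonneg fun k _ => mul_nonneg (by positivity) (hIs k)]
    congr 2
    refine Finset.sum_congr rfl fun k _ => ?_
    rw [ENNReal.ofReal_mul (by positivity), ENNReal.ofReal_sum_of_nonneg fun i _ => hI0 k i]
    congr 1
    refine Finset.sum_congr rfl fun i _ => ?_
    by_cases h : u ∈ E k i
    · simp [I, h]
    · simp [I, h]

end Discrepancy

/-! ### Paths, regression functions and their derivatives. -/

section Smooth

theorem SmoothOn.abs_sub_le {g : ℝ → ℝ} {𝒵 : Set ℝ} {C : ℝ} (h : SmoothOn g 𝒵 C) {a b : ℝ}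
    (hab : Set.Icc a b ⊆ 𝒵) {z z' : ℝ} (hz : z ∈ Set.Icc a b) (hz' : z' ∈ Set.Icc a b) :
    |g z - g z'| ≤ C * |z - z'| := by
  have := (convex_Icc a b).norm_image_sub_le_of_norm_hasDerivWithin_le
    (f := g) (f' := derivWithin g 𝒵) (C := C)
    (fun x hx => ((h.1 x (hab hx)).hasDerivWithinAt).mono hab) (fun x hx => h.2.2 x (hab hx)) hz' hz
  simpa using this

theorem SmoothOn.differentiableAt {g : ℝ → ℝ} {𝒵 : Set ℝ} {C : ℝ} (h : SmoothOn g 𝒵 C) {z : ℝ}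
    (hz : z ∈ interior 𝒵) : DifferentiableAt ℝ g z :=
  h.1.differentiableAt (mem_interior_iff_mem_nhds.1 hz)

theorem SmoothOn.abs_deriv_le {g : ℝ → ℝ} {𝒵 : Set ℝ} {C : ℝ} (h : SmoothOn g 𝒵 C) {z : ℝ}
    (hz : z ∈ interior 𝒵) : |deriv g z| ≤ C := by
  rw [← derivWithin_of_mem_nhds (mem_interior_iff_mem_nhds.1 hz)]
  exact h.2.2 z (interior_subset hz)

/-- Difference quotients along `ρ / (n + 1)` converge to the derivative. -/
theorem tendsto_quotient_deriv {g : ℝ → ℝ} {z : ℝ} (hg : DifferentiableAt ℝ g z) {ρ : ℝ}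
    (hρ : 0 < ρ) :
    Tendsto (fun n : ℕ => (ρ / (n + 1))⁻¹ * (g (z + ρ / (n + 1)) - g z)) atTop
      (𝓝 (deriv g z)) := by
  have h := (hasDerivAt_iff_tendsto_slope_zero.1 hg.hasDerivAt)
  have ht : Tendsto (fun n : ℕ => ρ / ((n : ℝ) + 1)) atTop (𝓝[≠] 0) := by
    refine tendsto_nhdsWithin_iff.2 ⟨?_, Eventually.of_forall fun n => ?_⟩
    · have := (tendsto_one_div_add_atTop_nhds_zero_nat (𝕜 := ℝ)).const_mul ρ
      simpa [div_eq_mul_inv] using this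
    · have : 0 < ρ / ((n : ℝ) + 1) := by positivity
      exact this.ne'
  exact h.comp ht

variable {d : ℕ}

/-- A Lipschitz regression function agrees on `𝒳` with one that is measurable everywhere. -/
theorem exists_measurable_extension {𝒵 : Set ℝ} {𝒳 : Set (Cov d)} {m : ℝ → Cov d → ℝ} {L : ℝ}
    (hL : ∀ z ∈ 𝒵, ∀ x ∈ 𝒳, ∀ x' ∈ 𝒳, |m z x - m z x'| ≤ L * ‖x - x'‖) :
    ∃ m' : ℝ → Cov d → ℝ, (∀ z, Measurable (m' z)) ∧ ∀ z ∈ 𝒵, ∀ x ∈ 𝒳, m' z x = m z x := by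
  have h : ∀ z, ∃ g : Cov d → ℝ, Measurable g ∧ (z ∈ 𝒵 → ∀ x ∈ 𝒳, g x = m z x) := by
    intro z
    by_cases hz : z ∈ 𝒵
    -- The set `𝒳` need not be measurable and `m z` is controlled only there. Its Lipschitz
    -- extension is continuous on the whole space, hence measurable.
    · have hlip : LipschitzOnWith L.toNNReal (m z) 𝒳 := by
        refine LipschitzOnWith.of_dist_le_mul fun x hx x' hx' => ?_
        rw [Real.dist_eq, dist_eq_norm]
        refine (hL z hz x hx x' hx').trans ?_
        gcongr
        exact Real.le_coe_toNNReal L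
      obtain ⟨g, hg, hgm⟩ := hlip.extend_real
      exact ⟨g, hg.continuous.measurable, fun _ x hx => (hgm hx).symm⟩
    · exact ⟨0, measurable_zero, fun h => absurd h hz⟩
  choose m' h1 h2 using h
  exact ⟨m', h1, fun z hz => h2 z hz⟩

variable {Ω : Type*} [MeasurableSpace Ω] {μ : Measure Ω} [IsProbabilityMeasure μ]

/-- The derivative of the regression function has a measurable version, whose mean is the
average causal derivative effect. -/
theorem exists_regression_derivative {𝒵 : Set ℝ} {𝒳 : Set (Cov d)} {Y : ℝ → Ω → ℝ}
    {X : Ω → Cov d} {m m' : ℝ → Cov d → ℝ} {C z₀ ρ : ℝ} (hz₀ : z₀ ∈ interior 𝒵) (hρ : 0 < ρ)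
    (hI : Set.Icc (z₀ - ρ) (z₀ + ρ) ⊆ 𝒵)
    (hY : ∀ z ∈ 𝒵, Measurable (Y z)) (hX : Measurable X) (hXmem : ∀ᵐ ω ∂μ, X ω ∈ 𝒳)
    (hYs : ∀ᵐ ω ∂μ, SmoothOn (fun z => Y z ω) 𝒵 C)
    (hms : ∀ x ∈ 𝒳, SmoothOn (fun z => m z x) 𝒵 C)
    (hm' : ∀ z, Measurable (m' z)) (hmm' : ∀ z ∈ 𝒵, ∀ x ∈ 𝒳, m' z x = m z x)
    (hcm : IsCondMean μ 𝒵 Y X m) (hYint : ∀ z ∈ 𝒵, Integrable (Y z) μ) :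
    ∃ D : Cov d → ℝ, Measurable D ∧ (∀ x ∈ 𝒳, D x = deriv (fun z => m z x) z₀) ∧
      ∫ ω, D (X ω) ∂μ = acde μ Y z₀ := by
  let a : ℕ → ℝ := fun n => ρ / (n + 1)
  have ha0 : ∀ n, 0 < a n := fun n => by positivity
  have haρ : ∀ n, a n ≤ ρ := fun n => div_le_self hρ.le (by linarith [n.cast_nonneg (α := ℝ)])
  have hz0I : z₀ ∈ Set.Icc (z₀ - ρ) (z₀ + ρ) := ⟨by linarith, by linarith⟩
  have hzaI : ∀ n, z₀ + a n ∈ Set.Icc (z₀ - ρ) (z₀ + ρ) := fun n =>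
    ⟨by linarith [ha0 n], by linarith [haρ n]⟩
  let q : ℕ → Cov d → ℝ := fun n x => (a n)⁻¹ * (m' (z₀ + a n) x - m' z₀ x)
  have hqm : ∀ n, Measurable (q n) := fun n => ((hm' _).sub (hm' _)).const_mul _
  have hlim : ∀ x ∈ 𝒳, Tendsto (fun n => q n x) atTop (𝓝 (deriv (fun z => m z x) z₀)) := by
    intro x hx
    have h := tendsto_quotient_deriv ((hms x hx).differentiableAt hz₀) hρ
    refine h.congr fun n => ?_
    simp only [q, hmm' _ (hI (hzaI n)) x hx, hmm' _ (hI hz0I) x hx, a]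
  have hbd : ∀ g : ℝ → ℝ, SmoothOn g 𝒵 C → ∀ n, |(a n)⁻¹ * (g (z₀ + a n) - g z₀)| ≤ C := by
    intro g hg n
    have h := hg.abs_sub_le hI (hzaI n) hz0I
    rw [add_sub_cancel_left, abs_of_pos (ha0 n)] at h
    rw [abs_mul, abs_of_pos (inv_pos.2 (ha0 n)), inv_mul_le_iff₀ (ha0 n), mul_comm]
    exact h
  -- The limsup is measurable without any convergence, and it is the derivative wherever the
  -- quotients converge, in particular on `𝒳`.
  let D : Cov d → ℝ := fun x => limsup (fun n => q n x) atTop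
  have hD : ∀ x ∈ 𝒳, D x = deriv (fun z => m z x) z₀ := fun x hx => (hlim x hx).limsup_eq
  have hDm : Measurable D := Measurable.limsup hqm
  refine ⟨D, hDm, hD, ?_⟩
  have hpt : ∀ᵐ ω ∂μ, ∀ n, q n (X ω) =
      (a n)⁻¹ * (m (z₀ + a n) (X ω) - m z₀ (X ω)) := by
    filter_upwards [hXmem] with ω hω n
    simp only [q, hmm' _ (hI (hzaI n)) _ hω, hmm' _ (hI hz0I) _ hω]
  have t1 : Tendsto (fun n => ∫ ω, q n (X ω) ∂μ) atTop (𝓝 (∫ ω, D (X ω) ∂μ)) := by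
    refine tendsto_integral_of_dominated_convergence (fun _ => C)
      (fun n => ((hqm n).comp hX).aestronglyMeasurable) (integrable_const _) (fun n => ?_) ?_
    · filter_upwards [hXmem, hpt] with ω hω h
      rw [Real.norm_eq_abs, h n]
      exact hbd (fun z => m z (X ω)) (hms _ hω) n
    · filter_upwards [hXmem] with ω hω
      rw [hD _ hω]
      exact hlim _ hω
  have t2 : Tendsto (fun n => ∫ ω, (a n)⁻¹ * (Y (z₀ + a n) ω - Y z₀ ω) ∂μ) atTop
      (𝓝 (acde μ Y z₀)) := by
    refine tendsto_integral_of_dominated_convergence (fun _ => C)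
      (fun n => (((hY _ (hI (hzaI n))).sub (hY _ (hI hz0I))).const_mul _).aestronglyMeasurable)
      (integrable_const _) (fun n => ?_) ?_
    · filter_upwards [hYs] with ω hω
      exact hbd (fun z => Y z ω) hω n
    · filter_upwards [hYs] with ω hω
      exact tendsto_quotient_deriv (hω.differentiableAt hz₀) hρ
  have hmean : ∀ z ∈ 𝒵, ∫ ω, m' z (X ω) ∂μ = ∫ ω, Y z ω ∂μ ∧
      Integrable (fun ω => m' z (X ω)) μ := by
    intro z hz
    have e : (fun ω => m' z (X ω)) =ᵐ[μ] μ[Y z | MeasurableSpace.comap X inferInstance] := by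
      filter_upwards [hcm z hz, hXmem] with ω h1 h2
      rw [← h1, hmm' z hz _ h2]
    exact ⟨(integral_congr_ae e).trans (integral_condExp hX.comap_le),
      (integrable_congr e).2 integrable_condExp⟩
  -- Both expectations are limits of the same numbers, since `m' z X` and `Y z` have equal means for
  -- every `z ∈ 𝒵`.
  refine tendsto_nhds_unique t1 (t2.congr fun n => ?_)
  obtain ⟨e1, i1⟩ := hmean _ (hI (hzaI n))
  obtain ⟨e0, i0⟩ := hmean _ (hI hz0I)
  simp only [q]
  rw [integral_const_mul, integral_const_mul, integral_sub i1 i0, e1, e0,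
    integral_sub (hYint _ (hI (hzaI n))) (hYint _ (hI hz0I))]

/-- Outside an event of small probability, the regression function is uniformly close to its
linear approximation at `z₀`. -/
theorem exists_uniform_linearization {𝒵 : Set ℝ} {𝒳 : Set (Cov d)}
    {X : Ω → Cov d} {m m' : ℝ → Cov d → ℝ} {C z₀ ρ : ℝ} (hz₀ : z₀ ∈ interior 𝒵) (hρ : 0 < ρ)
    (hI : Set.Icc (z₀ - ρ) (z₀ + ρ) ⊆ 𝒵) (hX : Measurable X) (hXmem : ∀ᵐ ω ∂μ, X ω ∈ 𝒳)
    (hms : ∀ x ∈ 𝒳, SmoothOn (fun z => m z x) 𝒵 C)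
    (hm' : ∀ z, Measurable (m' z)) (hmm' : ∀ z ∈ 𝒵, ∀ x ∈ 𝒳, m' z x = m z x)
    {D : Cov d → ℝ} (hDm : Measurable D) (hD : ∀ x ∈ 𝒳, D x = deriv (fun z => m z x) z₀)
    {δ : ℝ} (hδ : 0 < δ) {ε : ENNReal} (hε : 0 < ε) :
    ∃ θ > 0, ∃ G : Set (Cov d), MeasurableSet G ∧ μ (X ⁻¹' Gᶜ) ≤ ε ∧
      ∀ x ∈ 𝒳, x ∈ G → ∀ z, |z - z₀| < θ → |m z x - m z₀ x - D x * (z - z₀)| ≤ δ * |z - z₀| := by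
  -- Covariates whose linearization error is at most `δ` already at radius `ρ / (n + 1)`. Testing
  -- rational exposures only keeps the set measurable.
  let G : ℕ → Set (Cov d) := fun n => {x | ∀ q : ℚ, |(q : ℝ) - z₀| < ρ / (n + 1) →
    |m' q x - m' z₀ x - D x * (q - z₀)| ≤ δ * |(q : ℝ) - z₀|}
  have hGm : ∀ n, MeasurableSet (G n) := by
    intro n
    have : G n = ⋂ q : ℚ, ⋂ (_ : |(q : ℝ) - z₀| < ρ / (n + 1)),
        {x | |m' q x - m' z₀ x - D x * (q - z₀)| ≤ δ * |(q : ℝ) - z₀|} := by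
      ext x; simp [G]
    rw [this]
    refine MeasurableSet.iInter fun q => MeasurableSet.iInter fun _ => ?_
    have hme : Measurable fun x => |m' q x - m' z₀ x - D x * (q - z₀)| :=
      measurable_abs.comp (((hm' _).sub (hm' _)).sub (hDm.mul_const _))
    exact measurableSet_le hme measurable_const
  have hρn : ∀ n : ℕ, ρ / ((n : ℝ) + 1) ≤ ρ := fun n =>
    div_le_self hρ.le (by linarith [n.cast_nonneg (α := ℝ)])
  have hin : ∀ n : ℕ, ∀ z, |z - z₀| < ρ / ((n : ℝ) + 1) → z ∈ Set.Icc (z₀ - ρ) (z₀ + ρ) := by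
    intro n z hz
    have := abs_lt.1 (hz.trans_le (hρn n))
    exact ⟨by linarith [this.1], by linarith [this.2]⟩
  have hz0I : z₀ ∈ Set.Icc (z₀ - ρ) (z₀ + ρ) := ⟨by linarith, by linarith⟩
  have hanti : Antitone fun n => X ⁻¹' (G n)ᶜ := by
    intro n k hnk
    refine Set.preimage_mono (Set.compl_subset_compl.2 fun x hx q hq => hx q (hq.trans_le ?_))
    gcongr
  -- Differentiability at `z₀` puts every `x ∈ 𝒳` into some `G n`, so the decreasing complements
  -- have null intersection and eventually small probability.
  have hnull : μ (⋂ n, X ⁻¹' (G n)ᶜ) = 0 := by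
    rw [measure_eq_zero_iff_ae_notMem]
    filter_upwards [hXmem] with ω hω hmem
    have hdiff := ((hms _ hω).differentiableAt hz₀).hasDerivAt
    rw [← hD _ hω, hasDerivAt_iff_isLittleO] at hdiff
    have hev := hdiff.def hδ
    obtain ⟨θ, hθ, hball⟩ := Metric.eventually_nhds_iff.1 hev
    obtain ⟨n, hn⟩ := exists_nat_gt (ρ / θ)
    have hn' : ρ / ((n : ℝ) + 1) < θ := by
      rw [div_lt_iff₀ (by positivity)]
      rw [div_lt_iff₀ hθ] at hn
      nlinarith
    have hmemn := Set.mem_iInter.1 hmem n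
    refine hmemn fun q hq => ?_
    have h := hball (y := (q : ℝ)) (by rw [Real.dist_eq]; exact hq.trans hn')
    rw [Real.norm_eq_abs, Real.norm_eq_abs, smul_eq_mul, mul_comm ((q : ℝ) - z₀)] at h
    rwa [hmm' _ (hI (hin n _ hq)) _ hω, hmm' _ (hI hz0I) _ hω]
  have htend : Tendsto (fun n => μ (X ⁻¹' (G n)ᶜ)) atTop (𝓝 0) := by
    have := tendsto_measure_iInter_atTop (μ := μ)
      (fun n => (hX (hGm n).compl).nullMeasurableSet) hanti ⟨0, measure_ne_top _ _⟩
    rwa [hnull] at this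
  obtain ⟨n, hn⟩ := (ENNReal.tendsto_nhds_zero.1 htend ε hε).exists
  refine ⟨ρ / (n + 1), by positivity, G n, hGm n, hn, fun x hx hxG z hz => ?_⟩
  -- approximate `z` by rationals
  have hcont : ContinuousOn (fun z => m z x) 𝒵 := (hms x hx).1.continuousOn
  have hopen : {y : ℝ | |y - z₀| < ρ / (n + 1)} ∈ 𝓝 z :=
    (isOpen_lt (by fun_prop) continuous_const).mem_nhds hz
  have hcz : ContinuousAt (fun z => m z x) z := by
    refine (hcont z (hI (hin n z hz))).continuousAt ?_
    filter_upwards [hopen] with y hy using hI (hin n y hy)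
  have hcl : z ∈ closure (Set.range ((↑) : ℚ → ℝ)) := Rat.denseRange_cast z
  have hne : (𝓝[Set.range ((↑) : ℚ → ℝ)] z).NeBot := mem_closure_iff_nhdsWithin_neBot.1 hcl
  have l1 : Tendsto (fun y => |m y x - m z₀ x - D x * (y - z₀)|)
      (𝓝[Set.range ((↑) : ℚ → ℝ)] z) (𝓝 |m z x - m z₀ x - D x * (z - z₀)|) := by
    refine Tendsto.mono_left ?_ nhdsWithin_le_nhds
    exact ((hcz.tendsto.sub tendsto_const_nhds).sub
      ((continuous_id.sub continuous_const).tendsto z |>.const_mul _)).abs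
  have l2 : Tendsto (fun y => δ * |y - z₀|) (𝓝[Set.range ((↑) : ℚ → ℝ)] z) (𝓝 (δ * |z - z₀|)) :=
    Tendsto.mono_left ((by fun_prop : Continuous fun y : ℝ => δ * |y - z₀|).tendsto z)
      nhdsWithin_le_nhds
  refine le_of_tendsto_of_tendsto l1 l2 ?_
  filter_upwards [nhdsWithin_le_nhds hopen, self_mem_nhdsWithin] with y hy hyq
  obtain ⟨q, rfl⟩ := hyq
  have h := hxG q hy
  rwa [hmm' _ (hI (hin n _ hy)) _ hx, hmm' _ (hI hz0I) _ hx] at h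

end Smooth

/-- A compact interval splits into finitely many disjoint cells of length at most `τ`, each with a
representative in the interval. -/
theorem exists_interval_cells {a b τ : ℝ} (hab : a ≤ b) (hτ : 0 < τ) :
    ∃ (n : ℕ) (cell : Fin n → Set ℝ) (rep : Fin n → ℝ),
      (∀ k, MeasurableSet (cell k)) ∧ (Pairwise fun k l => Disjoint (cell k) (cell l)) ∧
      (∀ k, rep k ∈ Set.Icc a b) ∧ (∀ k, ∀ z ∈ cell k, |z - rep k| ≤ τ) ∧
      ∀ z ∈ Set.Icc a b, ∃ k, z ∈ cell k := by
  -- The extra cell holds the points at or beyond the last full multiple of `τ`. Capping the left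
  -- endpoints at `b` puts the representatives in the interval without a bound on `k`.
  refine ⟨⌊(b - a) / τ⌋₊ + 1, fun k => {z | z ∈ Set.Icc a b ∧ ⌊(z - a) / τ⌋₊ = k},
    fun k => min (a + k * τ) b, fun k => ?_, fun k l hkl => ?_, fun k => ?_, fun k z hz => ?_,
    fun z hz => ?_⟩
  · refine measurableSet_Icc.inter ?_
    have : Measurable fun z : ℝ => ⌊(z - a) / τ⌋₊ := Nat.measurable_floor.comp (by fun_prop)
    exact this (measurableSet_singleton _)
  · refine Set.disjoint_left.2 fun z hz hz' => hkl (Fin.ext ?_)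
    exact hz.2.symm.trans hz'.2
  · exact ⟨le_min (by have : (0 : ℝ) ≤ (k : ℕ) * τ := by positivity
                      linarith) hab, min_le_right _ _⟩
  · obtain ⟨⟨h1, h2⟩, h3⟩ := hz
    have hnn : 0 ≤ (z - a) / τ := div_nonneg (by linarith) hτ.le
    have h4 := Nat.floor_le hnn
    have h5 := Nat.lt_floor_add_one ((z - a) / τ)
    rw [h3] at h4 h5
    rw [le_div_iff₀ hτ] at h4
    rw [div_lt_iff₀ hτ] at h5
    show |z - min (a + k * τ) b| ≤ τ
    rw [min_eq_left (by linarith), abs_le]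
    constructor <;> linarith
  · refine ⟨⟨⌊(z - a) / τ⌋₊, ?_⟩, hz, rfl⟩
    refine Nat.lt_succ_of_le (Nat.floor_le_floor ?_)
    have := hz.2
    gcongr

/-! ### Convergence to zero in outer probability. -/

section Negligible

variable {Ω : Type*} [MeasurableSpace Ω] {μ : Measure Ω}

/-- Convergence to zero in (outer) probability of nonnegative quantities. -/
def Negligible (μ : Measure Ω) (R : ℕ → Ω → ENNReal) : Prop :=
  ∀ ε : ENNReal, 0 < ε → ε ≠ ⊤ → Tendsto (fun N => μ {ω | ε ≤ R N ω}) atTop (𝓝 0)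

/-- Markov's inequality for a measurable majorant outside a small bad event. The quantity `R` itself
need not be measurable, because the matches are not. -/
theorem Negligible.of_lintegral {R : ℕ → Ω → ENNReal} {Bad : ℕ → Set Ω}
    (hBad : Tendsto (fun N => μ (Bad N)) atTop (𝓝 0))
    (h : ∀ δ : ℝ, 0 < δ → ∀ᶠ N in atTop, ∃ F : Ω → ENNReal, AEMeasurable F μ ∧
      (∀ᵐ ω ∂μ, ω ∉ Bad N → R N ω ≤ F ω) ∧ ∫⁻ ω, F ω ∂μ ≤ ENNReal.ofReal δ) :
    Negligible μ R := by
  intro ε hε hεt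
  refine ENNReal.tendsto_nhds_zero.2 fun γ hγ => ?_
  wlog hγt : γ ≠ ⊤ generalizing γ
  · filter_upwards [this 1 one_pos ENNReal.one_ne_top] with N hN
    exact hN.trans (by rw [not_ne_iff.1 hγt]; exact le_top)
  have hδ : 0 < (ε * (γ / 2)).toReal :=
    ENNReal.toReal_pos (mul_ne_zero hε.ne' (ENNReal.half_pos hγ.ne').ne')
      (ENNReal.mul_ne_top hεt (ENNReal.div_ne_top hγt two_ne_zero))
  filter_upwards [h _ hδ, ENNReal.tendsto_nhds_zero.1 hBad (γ / 2) (ENNReal.half_pos hγ.ne')]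
    with N hN hB
  obtain ⟨F, hF, hRF, hint⟩ := hN
  rw [ENNReal.ofReal_toReal
    (ENNReal.mul_ne_top hεt (ENNReal.div_ne_top hγt two_ne_zero))] at hint
  have hM : μ {ω | ε ≤ F ω} ≤ γ / 2 := by
    have := (mul_meas_ge_le_lintegral₀ hF ε).trans hint
    rwa [ENNReal.mul_le_mul_iff_right hε.ne' hεt] at this
  calc μ {ω | ε ≤ R N ω} ≤ μ (Bad N ∪ {ω | ε ≤ F ω}) := by
        refine measure_mono_ae ?_
        filter_upwards [hRF] with ω hω
        intro hmem
        by_cases hb : ω ∈ Bad N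
        · exact Or.inl hb
        · exact Or.inr (le_trans hmem (hω hb))
    _ ≤ γ / 2 + γ / 2 := (measure_union_le _ _).trans (add_le_add hB hM)
    _ = γ := ENNReal.add_halves γ

theorem Negligible.add {R S : ℕ → Ω → ENNReal} (hR : Negligible μ R) (hS : Negligible μ S) :
    Negligible μ fun N ω => R N ω + S N ω := by
  intro ε hε hεt
  have hε2 : 0 < ε / 2 := ENNReal.half_pos hε.ne'
  have hε2t : ε / 2 ≠ ⊤ := ENNReal.div_ne_top hεt two_ne_zero
  have h := (hR _ hε2 hε2t).add (hS _ hε2 hε2t)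
  rw [add_zero] at h
  refine tendsto_of_tendsto_of_tendsto_of_le_of_le tendsto_const_nhds h (fun _ => zero_le)
    fun N => ?_
  refine (measure_mono ?_).trans (measure_union_le _ _)
  intro ω hω
  by_contra hcon
  simp only [Set.mem_union, Set.mem_ofPred_eq, not_or, not_le] at hcon hω
  have := ENNReal.add_lt_add hcon.1 hcon.2
  rw [ENNReal.add_halves] at this
  exact absurd hω (not_le.2 this)

theorem Negligible.mono {R S : ℕ → Ω → ENNReal} (hS : Negligible μ S) {Bad : ℕ → Set Ω}
    (hBad : Tendsto (fun N => μ (Bad N)) atTop (𝓝 0))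
    (h : ∀ᶠ N in atTop, ∀ᵐ ω ∂μ, ω ∉ Bad N → R N ω ≤ S N ω) : Negligible μ R := by
  intro ε hε hεt
  have h2 := hBad.add (hS ε hε hεt)
  rw [add_zero] at h2
  refine tendsto_of_tendsto_of_tendsto_of_le_of_le' tendsto_const_nhds h2
    (Eventually.of_forall fun _ => zero_le) ?_
  filter_upwards [h] with N hN
  refine le_trans (measure_mono_ae ?_) (measure_union_le (Bad N) {ω | ε ≤ S N ω})
  filter_upwards [hN] with ω hω
  intro hmem
  by_cases hb : ω ∈ Bad N
  · exact Or.inl hb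
  · exact Or.inr (le_trans hmem (hω hb))

theorem Negligible.of_sq {T : ℕ → Ω → ℝ}
    (h : Negligible μ fun N ω => ENNReal.ofReal (T N ω ^ 2)) :
    Negligible μ fun N ω => ENNReal.ofReal |T N ω| := by
  intro ε hε hεt
  refine tendsto_of_tendsto_of_tendsto_of_le_of_le tendsto_const_nhds
    (h (ε ^ 2) (by positivity) (by finiteness)) (fun _ => zero_le) fun N => measure_mono ?_
  intro ω hω
  have hω' : ε ≤ ENNReal.ofReal |T N ω| := hω
  show ε ^ 2 ≤ ENNReal.ofReal (T N ω ^ 2)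
  rw [← sq_abs, ENNReal.ofReal_pow (abs_nonneg _)]
  gcongr

theorem TendstoInMeasure.negligible {T : ℕ → Ω → ℝ} {c : ℝ}
    (h : TendstoInMeasure μ T atTop fun _ => c) :
    Negligible μ fun N ω => ENNReal.ofReal |T N ω - c| := by
  intro ε hε hεt
  have := h ε hε
  simpa [edist_dist, Real.dist_eq] using this

theorem Negligible.tendstoInMeasure {T : ℕ → Ω → ℝ}
    (h : Negligible μ fun N ω => ENNReal.ofReal |T N ω|) :
    TendstoInMeasure μ T atTop fun _ => 0 := by
  refine tendstoInMeasure_of_ne_top fun ε hε hεt => ?_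
  have := h ε hε hεt
  simpa [edist_dist, Real.dist_eq] using this

end Negligible

/-! ### The weights of the residuals in the estimator. -/

section PairWeight

variable {N d : ℕ}

/-- The total weight that the residual of unit `j`, used as a match from `𝒞`, receives in the
matching estimator when the opposite matches come from `𝒞'`. -/
def pairWeight (𝒞 𝒞' : Set ℝ) (j : Fin N) (u : Fin N → ℝ × Cov d) : ℝ :=
  (1 / (N : ℝ)) * ∑ i, ∑ k, (nearestSet 𝒞 i j).indicator 1 u * (nearestSet 𝒞' i k).indicator 1 u /
    |(u j).1 - (u k).1|

theorem measurable_pairWeight {𝒞 𝒞' : Set ℝ} (h𝒞 : MeasurableSet 𝒞) (h𝒞' : MeasurableSet 𝒞')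
    (j : Fin N) : Measurable (pairWeight (d := d) 𝒞 𝒞' j) := by
  refine Measurable.const_mul (Finset.measurable_sum _ fun i _ => Finset.measurable_sum _
    fun k _ => Measurable.div (Measurable.mul ?_ ?_) ?_) _
  · exact measurable_one.indicator (measurableSet_nearestSet h𝒞 i j)
  · exact measurable_one.indicator (measurableSet_nearestSet h𝒞' i k)
  · exact measurable_abs.comp (by fun_prop)

/-- Each unit has at most one strictly nearest opposite match, so the inner sum is at most one and
the weight reduces to a count of the units matched to `j`. -/
theorem abs_pairWeight_le {𝒞 𝒞' : Set ℝ} {s : ℝ} (hs : 0 < s)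
    (hsep : ∀ z ∈ 𝒞, ∀ z' ∈ 𝒞', s ≤ |z - z'|) (j : Fin N) (u : Fin N → ℝ × Cov d) :
    |pairWeight 𝒞 𝒞' j u| ≤ 1 / (N * s) * ∑ i, (nearestSet 𝒞 i j).indicator 1 u := by
  have hnn : ∀ (𝒟 : Set ℝ) (i k : Fin N), (0 : ℝ) ≤ (nearestSet 𝒟 i k).indicator 1 u :=
    fun 𝒟 i k => Set.indicator_nonneg (fun _ _ => zero_le_one) u
  have hterm : ∀ i k, (nearestSet 𝒞 i j).indicator 1 u * (nearestSet 𝒞' i k).indicator 1 u /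
      |(u j).1 - (u k).1| ≤ (nearestSet 𝒞 i j).indicator 1 u *
        (nearestSet 𝒞' i k).indicator 1 u * (1 / s) := by
    intro i k
    by_cases h1 : u ∈ nearestSet 𝒞 i j
    swap
    · simp [Set.indicator_of_notMem h1]
    by_cases h2 : u ∈ nearestSet 𝒞' i k
    swap
    · simp [Set.indicator_of_notMem h2]
    have := hsep _ h1.1 _ h2.1
    rw [div_eq_mul_one_div]
    have := hnn 𝒞 i j
    have := hnn 𝒞' i k
    gcongr
  rw [pairWeight, abs_of_nonneg (mul_nonneg (by positivity) (Finset.sum_nonneg fun i _ =>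
    Finset.sum_nonneg fun k _ => div_nonneg (mul_nonneg (hnn _ _ _) (hnn _ _ _)) (abs_nonneg _)))]
  calc 1 / (N : ℝ) * ∑ i, ∑ k, (nearestSet 𝒞 i j).indicator 1 u *
        (nearestSet 𝒞' i k).indicator 1 u / |(u j).1 - (u k).1|
      ≤ 1 / (N : ℝ) * ∑ i, ∑ k, (nearestSet 𝒞 i j).indicator 1 u *
        (nearestSet 𝒞' i k).indicator 1 u * (1 / s) := by
        gcongr
        exact hterm _ _
    _ = 1 / (N : ℝ) * ∑ i, (nearestSet 𝒞 i j).indicator 1 u *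
        (∑ k, (nearestSet 𝒞' i k).indicator 1 u) * (1 / s) := by
        congr 1
        refine Finset.sum_congr rfl fun i _ => ?_
        rw [Finset.mul_sum, Finset.sum_mul]
    _ ≤ 1 / (N : ℝ) * ∑ i, (nearestSet 𝒞 i j).indicator 1 u * 1 * (1 / s) := by
        gcongr with i
        · exact hnn _ _ _
        · exact sum_indicator_nearestSet_le (R := ℝ) 𝒞' i u
    _ = _ := by
        simp only [mul_one]
        rw [← Finset.sum_mul]
        field_simp

/-- Regrouping an average over matched units by the owner of the residual. The coefficients on the
left are functions of the design, as the variance bound demands. -/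
theorem sum_pairWeight_mul {𝒞 𝒞' : Set ℝ} {u : Fin N → ℝ × Cov d} {j k : Fin N → Fin N}
    (hj : ∀ i, u ∈ nearestSet 𝒞 i (j i)) (hk : ∀ i, u ∈ nearestSet 𝒞' i (k i))
    (e : Fin N → ℝ) :
    ∑ l, pairWeight 𝒞 𝒞' l u * e l =
      (1 / (N : ℝ)) * ∑ i, e (j i) / |(u (j i)).1 - (u (k i)).1| := by
  classical
  have ind : ∀ {𝒟 : Set ℝ} {f : Fin N → Fin N}, (∀ i, u ∈ nearestSet 𝒟 i (f i)) → ∀ i l,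
      (nearestSet 𝒟 i l).indicator (1 : (Fin N → ℝ × Cov d) → ℝ) u = if l = f i then 1 else 0 := by
    intro 𝒟 f hf i l
    by_cases h : l = f i
    · rw [if_pos h, h, Set.indicator_of_mem (hf i)]; rfl
    · rw [if_neg h, Set.indicator_of_notMem fun h' => h (nearestSet_unique h' (hf i))]
  simp only [pairWeight, ind hj, ind hk, Finset.sum_mul, mul_assoc, ← Finset.mul_sum]
  congr 1
  rw [Finset.sum_comm]
  refine Finset.sum_congr rfl fun i _ => ?_
  rw [Finset.sum_eq_single (j i), Finset.sum_eq_single (k i)]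
  · simp; ring
  · intro l _ hl; simp [hl]
  · simp
  · intro l _ hl; simp [hl]
  · simp

/-- Second moment of the weighted residuals in the matching estimator. -/
theorem lintegral_sq_pairWeight_le {U : Type*} [MeasurableSpace U] (Q : Measure U)
    [IsProbabilityMeasure Q] {w : U → ℝ × Cov d} (hw : Measurable w) {e : U → ℝ}
    (he : Measurable e) (he2 : MemLp e 2 Q) {V : ℝ} (hV0 : 0 ≤ V)
    (h0 : ∀ g : ℝ × Cov d → ℝ, Measurable g → (∃ B, ∀ x, |g x| ≤ B) →
      ∫ u, g (w u) * e u ∂Q = 0)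
    (hV : ∀ g : ℝ × Cov d → ENNReal, Measurable g →
      ∫⁻ u, g (w u) * ENNReal.ofReal (e u ^ 2) ∂Q ≤ ENNReal.ofReal V * ∫⁻ u, g (w u) ∂Q)
    {𝒞 𝒞' : Set ℝ} (h𝒞 : MeasurableSet 𝒞) (h𝒞' : MeasurableSet 𝒞') {s : ℝ} (hs : 0 < s)
    (hsep : ∀ z ∈ 𝒞, ∀ z' ∈ 𝒞', s ≤ |z - z'|) {p : ℝ} (hp : 0 < p) (hp1 : p ≤ 1)
    (hP : ∀ h : Cov d → ENNReal, Measurable h →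
      ∫⁻ x, h x.2 * 𝒞ᶜ.indicator 1 x.1 ∂(Q.map w) ≤
        ENNReal.ofReal (1 - p) * ∫⁻ x, h x.2 ∂(Q.map w))
    (hsph : ∀ (x : Cov d) (ρ : ℝ), ∀ᵐ v ∂(Q.map w), dist v.2 x ≠ ρ)
    {t : Finset (Cov d)} (ht : ∀ v : Cov d, v ≠ 0 → ∃ c ∈ t, v ∈ dirCone c) (hN : 0 < N) :
    ∫⁻ u, ENNReal.ofReal ((∑ j, pairWeight 𝒞 𝒞' j (w ∘ u) * e (u j)) ^ 2)
        ∂Measure.pi (fun _ : Fin N => Q) ≤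
      ENNReal.ofReal (V * (1 / (N * s ^ 2) * (1 + (1 + t.card) * (1 / p)))) := by
  have : IsProbabilityMeasure (Q.map w) := Measure.isProbabilityMeasure_map hw.aemeasurable
  have hNr : (0 : ℝ) < N := by exact_mod_cast hN
  -- A crude bound, needed only for integrability.
  have hB : ∀ (j : Fin N) (x : Fin N → ℝ × Cov d), |pairWeight 𝒞 𝒞' j x| ≤ 1 / (N * s) * N := by
    intro j x
    refine (abs_pairWeight_le hs hsep j x).trans ?_
    gcongr
    calc ∑ i, (nearestSet 𝒞 i j).indicator (1 : (Fin N → ℝ × Cov d) → ℝ) x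
        ≤ ∑ _i : Fin N, (1 : ℝ) := Finset.sum_le_sum fun i _ =>
          Set.indicator_le_self' (fun _ _ => zero_le_one) x
      _ = N := by simp
  have h1 := lintegral_sq_weighted_sum_le Q hw he he2 h0 hV
    (measurable_pairWeight (N := N) h𝒞 h𝒞') hB
  refine h1.trans ?_
  have hwu : Measurable (fun u : Fin N → U => w ∘ u) :=
    measurable_pi_iff.2 fun i => hw.comp (measurable_pi_apply i)
  have hmap : (Measure.pi (fun _ : Fin N => Q)).map (fun u => w ∘ u) =
      Measure.pi (fun _ : Fin N => Q.map w) :=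
    Measure.pi_map_pi fun _ => hw.aemeasurable
  have hm2 : Measurable fun x : Fin N → ℝ × Cov d =>
      ∑ j, ENNReal.ofReal (pairWeight 𝒞 𝒞' j x ^ 2) :=
    Finset.measurable_sum _ fun j _ =>
      ((measurable_pairWeight h𝒞 h𝒞' j).pow_const 2).ennreal_ofReal
  have e1 : ∫⁻ u, ∑ j, ENNReal.ofReal (pairWeight 𝒞 𝒞' j (w ∘ u) ^ 2)
      ∂Measure.pi (fun _ : Fin N => Q) = ∫⁻ x, ∑ j, ENNReal.ofReal (pairWeight 𝒞 𝒞' j x ^ 2)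
        ∂Measure.pi (fun _ : Fin N => Q.map w) := by
    rw [← hmap, lintegral_map hm2 hwu]
  rw [e1]
  -- The square of the number of units matched to `j` counts ordered pairs of units that share the
  -- match `j`.
  have hpt : ∀ x : Fin N → ℝ × Cov d, ∑ j, ENNReal.ofReal (pairWeight 𝒞 𝒞' j x ^ 2) ≤
      ENNReal.ofReal ((1 / (N * s)) ^ 2) * ∑ i, ∑ j, ∑ k,
        (nearestSet 𝒞 i j).indicator 1 x * (nearestSet 𝒞 k j).indicator 1 x := by
    intro x
    have hI : ∀ i j : Fin N, (nearestSet 𝒞 i j).indicator (1 : (Fin N → ℝ × Cov d) → ENNReal) x =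
        ENNReal.ofReal ((nearestSet 𝒞 i j).indicator 1 x) := by
      intro i j
      by_cases h : x ∈ nearestSet 𝒞 i j <;> simp [h]
    have hnn : ∀ i j : Fin N,
        0 ≤ (nearestSet 𝒞 i j).indicator (1 : (Fin N → ℝ × Cov d) → ℝ) x :=
      fun i j => Set.indicator_nonneg (fun _ _ => zero_le_one) x
    rw [Finset.sum_comm, Finset.mul_sum]
    refine Finset.sum_le_sum fun j _ => ?_
    have h2 : pairWeight 𝒞 𝒞' j x ^ 2 ≤
        (1 / (N * s)) ^ 2 * (∑ i, (nearestSet 𝒞 i j).indicator 1 x) ^ 2 := by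
      rw [← mul_pow, ← sq_abs]
      exact pow_le_pow_left₀ (abs_nonneg _) (abs_pairWeight_le hs hsep j x) 2
    refine (ENNReal.ofReal_le_ofReal h2).trans (le_of_eq ?_)
    rw [ENNReal.ofReal_mul (by positivity), sq (∑ i, _), ENNReal.ofReal_mul
      (Finset.sum_nonneg fun i _ => hnn i j), ENNReal.ofReal_sum_of_nonneg fun i _ => hnn i j,
      Finset.sum_mul_sum]
    simp only [hI]
  have h3 := lintegral_shared_match_le (N := N) (Q.map w) h𝒞 hp hp1 hP
    (ae_mem_noTies (Q.map w) hsph) ht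
  calc ENNReal.ofReal V * ∫⁻ x, ∑ j, ENNReal.ofReal (pairWeight 𝒞 𝒞' j x ^ 2)
        ∂Measure.pi (fun _ : Fin N => Q.map w)
      ≤ ENNReal.ofReal V * (ENNReal.ofReal ((1 / (N * s)) ^ 2) *
          (N * (1 + (1 + t.card) * ENNReal.ofReal (1 / p)))) := by
        gcongr
        refine (lintegral_mono hpt).trans ?_
        rw [lintegral_const_mul' _ _ ENNReal.ofReal_ne_top]
        gcongr
    _ = _ := by
        rw [ENNReal.ofReal_mul hV0]
        congr 1
        have e2 : (N : ENNReal) * (1 + (1 + t.card) * ENNReal.ofReal (1 / p)) =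
            ENNReal.ofReal (N * (1 + (1 + t.card) * (1 / p))) := by
          rw [ENNReal.ofReal_mul hNr.le, ENNReal.ofReal_add zero_le_one (by positivity),
            ENNReal.ofReal_mul (by positivity), ENNReal.ofReal_add zero_le_one (by positivity)]
          simp
        rw [e2, ← ENNReal.ofReal_mul (by positivity)]
        congr 1
        field_simp

end PairWeight

/-! ### Laws of the sample and of the design. -/

section Sampling

variable {Ω : Type*} [MeasurableSpace Ω] {μ : Measure Ω} {d : ℕ}

/-- The design of the first `N` units. -/
def design (N : ℕ) (Z : ℕ → Ω → ℝ) (X : ℕ → Ω → Cov d) (ω : Ω) : Fin N → ℝ × Cov d :=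
  fun l => (Z l ω, X l ω)

/-- The full data of unit `i`: potential outcomes, exposure and covariate. -/
def unitData (𝒵 : Set ℝ) (Y : ℕ → ℝ → Ω → ℝ) (Z : ℕ → Ω → ℝ) (X : ℕ → Ω → Cov d) (i : ℕ) (ω : Ω) :
    (𝒵 → ℝ) × ℝ × Cov d := ((fun z : 𝒵 => Y i z ω), Z i ω, X i ω)

variable {𝒵 : Set ℝ} {𝒳 : Set (Cov d)} {Y : ℕ → ℝ → Ω → ℝ} {Z : ℕ → Ω → ℝ} {X : ℕ → Ω → Cov d}

theorem IIDSample.measurable_unitData (h : IIDSample μ 𝒵 𝒳 Y Z X) (i : ℕ) :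
    Measurable (unitData 𝒵 Y Z X i) :=
  (measurable_pi_iff.2 fun z : 𝒵 => h.measurable_Y i z z.2).prodMk
    ((h.measurable_Z i).prodMk (h.measurable_X i))

theorem IIDSample.map_unitData [IsProbabilityMeasure μ] (h : IIDSample μ 𝒵 𝒳 Y Z X) (N : ℕ) :
    μ.map (fun ω (l : Fin N) => unitData 𝒵 Y Z X l ω) =
      Measure.pi fun _ : Fin N => μ.map (unitData 𝒵 Y Z X 0) := by
  have hi : iIndepFun (fun (l : Fin N) ω => unitData 𝒵 Y Z X l ω) μ :=
    h.indep.precomp Fin.val_injective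
  rw [(iIndepFun_iff_map_fun_eq_pi_map
    fun l : Fin N => (h.measurable_unitData l).aemeasurable).1 hi]
  congr 1
  funext l
  exact (h.identDistrib l).map_eq

theorem IIDSample.measurable_design (h : IIDSample μ 𝒵 𝒳 Y Z X) (N : ℕ) :
    Measurable (design N Z X) :=
  measurable_pi_iff.2 fun l => (h.measurable_Z l).prodMk (h.measurable_X l)

theorem IIDSample.map_design [IsProbabilityMeasure μ] (h : IIDSample μ 𝒵 𝒳 Y Z X) (N : ℕ) :
    μ.map (design N Z X) = Measure.pi fun _ : Fin N => μ.map fun ω => (Z 0 ω, X 0 ω) := by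
  have e1 : design N Z X =
      (fun u l => (u l).2) ∘ fun ω (l : Fin N) => unitData 𝒵 Y Z X l ω := rfl
  have hm := h.measurable_unitData
  have : IsProbabilityMeasure (μ.map (unitData 𝒵 Y Z X 0)) :=
    Measure.isProbabilityMeasure_map (hm 0).aemeasurable
  have hmU : Measurable fun ω (l : Fin N) => unitData 𝒵 Y Z X l ω :=
    measurable_pi_iff.2 fun l => hm l
  rw [e1, ← Measure.map_map (by fun_prop) hmU, h.map_unitData N,
    Measure.pi_map_pi fun _ => measurable_snd.aemeasurable]
  congr 1
  funext l
  rw [Measure.map_map measurable_snd (hm 0)]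
  rfl

theorem IIDSample.lintegral_covariate (h : IIDSample μ 𝒵 𝒳 Y Z X) {g : Cov d → ENNReal}
    (hg : Measurable g) (i : ℕ) : ∫⁻ ω, g (X i ω) ∂μ = ∫⁻ ω, g (X 0 ω) ∂μ := by
  have h2 : Measurable fun u : (𝒵 → ℝ) × ℝ × Cov d => g u.2.2 := by fun_prop
  have hmap : μ.map (unitData 𝒵 Y Z X i) = μ.map (unitData 𝒵 Y Z X 0) :=
    (h.identDistrib i).map_eq
  have := congrArg (fun ν => ∫⁻ u, g u.2.2 ∂ν) hmap
  rwa [lintegral_map h2 (h.measurable_unitData i), lintegral_map h2 (h.measurable_unitData 0)]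
    at this

/-- Law of large numbers for bounded functions of the covariate. -/
theorem IIDSample.tendstoInMeasure_average [IsProbabilityMeasure μ] (h : IIDSample μ 𝒵 𝒳 Y Z X)
    {D : Cov d → ℝ} (hD : Measurable D) {C : ℝ} (hC : ∀ x ∈ 𝒳, |D x| ≤ C) :
    TendstoInMeasure μ (fun (N : ℕ) ω => (1 / (N : ℝ)) * ∑ i ∈ Finset.range N, D (X i ω)) atTop
      fun _ => ∫ ω, D (X 0 ω) ∂μ := by
  have h2 : Measurable fun u : (𝒵 → ℝ) × ℝ × Cov d => D u.2.2 := by fun_prop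
  have hm : ∀ i, Measurable fun ω => D (X i ω) := fun i => hD.comp (h.measurable_X i)
  have hint : Integrable (fun ω => D (X 0 ω)) μ := by
    refine Integrable.of_bound (hm 0).aestronglyMeasurable C ?_
    filter_upwards [h.mem_covariate 0] with ω hω using hC _ hω
  have hind : Pairwise fun i j => IndepFun (fun ω => D (X i ω)) (fun ω => D (X j ω)) μ := by
    intro i j hij
    exact (h.indep.indepFun hij).comp h2 h2
  have hid : ∀ i, IdentDistrib (fun ω => D (X i ω)) (fun ω => D (X 0 ω)) μ μ := fun i =>
    (h.identDistrib i).comp h2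
  have hlaw := strong_law_ae_real (fun i ω => D (X i ω)) hint hind hid
  refine tendstoInMeasure_of_tendsto_ae (fun N => ?_) ?_
  · exact ((Finset.measurable_sum _ fun i _ => hm i).const_mul _).aestronglyMeasurable
  · filter_upwards [hlaw] with ω hω
    refine hω.congr fun N => ?_
    rw [div_eq_mul_one_div, mul_comm]

end Sampling

/-! ### Consequences of the caliper rates. -/

section Rates

variable {d : ℕ} {η : ℕ → ℝ}

theorem CaliperRate.tendsto_zero (h : CaliperRate d η) : Tendsto η atTop (𝓝 0) := by
  refine h.upper.isBigO.trans_tendsto ?_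
  have : (0 : ℝ) < 1 / ((d : ℝ) + 3) := by positivity
  exact (tendsto_rpow_neg_atTop this).comp tendsto_natCast_atTop_atTop

/-- The rate needed by the dyadic matching bound: the exponent is `d + 1` for `d ≥ 2`, while for `d
= 1` it is 3, the residual rate. -/
theorem CaliperRate.tendsto_pow_max (h : CaliperRate d η) :
    Tendsto (fun N : ℕ => (N : ℝ) * η N ^ (max d 2 + 1)) atTop atTop := by
  rcases le_total d 2 with hd | hd
  · rw [max_eq_right hd]; exact h.residual
  · rw [max_eq_left hd]; exact h.discrepancy

theorem CaliperRate.tendsto_inv_cube (h : CaliperRate d η) :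
    Tendsto (fun N : ℕ => ((N : ℝ) * η N ^ 3)⁻¹) atTop (𝓝 0) :=
  tendsto_inv_atTop_zero.comp h.residual

theorem CaliperRate.tendsto_inv_sq (h : CaliperRate d η) :
    Tendsto (fun N : ℕ => ((N : ℝ) * η N ^ 2)⁻¹) atTop (𝓝 0) := by
  have := h.tendsto_zero.mul h.tendsto_inv_cube
  rw [zero_mul] at this
  refine this.congr fun N => ?_
  have := (h.pos N).ne'
  field_simp

theorem CaliperRate.tendsto_inv (h : CaliperRate d η) :
    Tendsto (fun N : ℕ => ((N : ℝ) * η N)⁻¹) atTop (𝓝 0) := by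
  have := h.tendsto_zero.mul h.tendsto_inv_sq
  rw [zero_mul] at this
  refine this.congr fun N => ?_
  have := (h.pos N).ne'
  field_simp

end Rates

/-- `𝒞` is an exposure window that a unit hits with conditional probability at least `p`
given its covariate. -/
structure IsWindow {d : ℕ} (P : Measure (ℝ × Cov d)) (𝒞 : Set ℝ) (p : ℝ) : Prop where
  measurableSet : MeasurableSet 𝒞
  pos : 0 < p
  le_one : p ≤ 1
  miss : ∀ h : Cov d → ENNReal, Measurable h →
    ∫⁻ w, h w.2 * 𝒞ᶜ.indicator 1 w.1 ∂P ≤ ENNReal.ofReal (1 - p) * ∫⁻ w, h w.2 ∂P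

/-! ### The error terms of each window, and the secant bias. -/

section Sides

variable {Ω : Type*} [MeasurableSpace Ω] {μ : Measure Ω} [IsProbabilityMeasure μ] {d : ℕ}
  {𝒵 : Set ℝ} {𝒳 : Set (Cov d)} {Y : ℕ → ℝ → Ω → ℝ} {Z : ℕ → Ω → ℝ} {X : ℕ → Ω → Cov d}

/-- The event that no unit among the first `N` falls into the window. -/
def noCandidate (Z : ℕ → Ω → ℝ) (𝒞 : Set ℝ) (N : ℕ) : Set Ω := {ω | ∀ l < N, Z l ω ∉ 𝒞}

/-- The cell bound with a single cell: when the window is empty all `N` units lack a candidate, so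
`N` times this probability is at most `1 / p`. -/
theorem IIDSample.measure_noCandidate_le (h : IIDSample μ 𝒵 𝒳 Y Z X) {𝒞 : Set ℝ} {p : ℝ}
    (hw : IsWindow (μ.map fun ω => (Z 0 ω, X 0 ω)) 𝒞 p) {N : ℕ} (hN : 0 < N) :
    μ (noCandidate Z 𝒞 N) ≤ ENNReal.ofReal (1 / (N * p)) := by
  have : IsProbabilityMeasure (μ.map fun ω => (Z 0 ω, X 0 ω)) :=
    Measure.isProbabilityMeasure_map ((h.measurable_Z 0).prodMk (h.measurable_X 0)).aemeasurable
  have h1 := lintegral_card_cell_without_candidate_le (N := N) (μ.map fun ω => (Z 0 ω, X 0 ω))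
    hw.measurableSet hw.pos hw.le_one hw.miss (fun _ => ()) (by simp) {()}
    (Eventually.of_forall fun _ _ => by simp)
  have hset : MeasurableSet {u : Fin N → ℝ × Cov d | ∀ l, (u l).1 ∉ 𝒞} := by
    have : {u : Fin N → ℝ × Cov d | ∀ l, (u l).1 ∉ 𝒞} =
        ⋂ l, {u : Fin N → ℝ × Cov d | (u l).1 ∈ 𝒞}ᶜ := by
      ext u; simp
    rw [this]
    exact MeasurableSet.iInter fun l => (hw.measurableSet.preimage
      (by fun_prop : Measurable fun u : Fin N → ℝ × Cov d => (u l).1)).compl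
  simp only [forall_const, Finset.sum_const, Finset.card_univ, Fintype.card_fin, nsmul_eq_mul,
    Finset.card_singleton, Nat.cast_one, one_mul] at h1
  rw [lintegral_const_mul _ (measurable_one.indicator hset), lintegral_indicator_one hset,
    ← h.map_design N, Measure.map_apply (h.measurable_design N) hset] at h1
  have hpre : noCandidate Z 𝒞 N = design N Z X ⁻¹' {u | ∀ l, (u l).1 ∉ 𝒞} := by
    ext ω
    simp only [noCandidate, Set.mem_ofPred_eq, Set.mem_preimage, design]
    exact ⟨fun h l => h l l.2, fun h l hl => h ⟨l, hl⟩⟩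
  have hNr : (0 : ℝ) < N := by exact_mod_cast hN
  rw [hpre]
  have e : ENNReal.ofReal (1 / (N * p)) = (N : ENNReal)⁻¹ * ENNReal.ofReal (1 / p) := by
    rw [← ENNReal.ofReal_natCast, ← ENNReal.ofReal_inv_of_pos hNr,
      ← ENNReal.ofReal_mul (by positivity)]
    congr 1
    field_simp
  rw [e, ← ENNReal.div_eq_inv_mul, ENNReal.le_div_iff_mul_le (Or.inl (by positivity))
    (Or.inl (ENNReal.natCast_ne_top N)), mul_comm]
  exact h1

variable {η : ℕ → ℝ} {c₁ : ℝ} {𝒞 𝒞' : ℕ → Set ℝ}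

theorem IIDSample.tendsto_noCandidate (h : IIDSample μ 𝒵 𝒳 Y Z X) (hη : CaliperRate d η)
    (hwin : ∀ᶠ N in atTop, IsWindow (μ.map fun ω => (Z 0 ω, X 0 ω)) (𝒞 N) (c₁ * η N)) :
    Tendsto (fun N => μ (noCandidate Z (𝒞 N) N)) atTop (𝓝 0) := by
  have ht : Tendsto (fun N : ℕ => ENNReal.ofReal (c₁⁻¹ * ((N : ℝ) * η N)⁻¹)) atTop (𝓝 0) := by
    have := (hη.tendsto_inv.const_mul c₁⁻¹)
    rw [mul_zero] at this
    simpa using ENNReal.tendsto_ofReal this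
  refine tendsto_of_tendsto_of_tendsto_of_le_of_le' tendsto_const_nhds ht
    (Eventually.of_forall fun _ => zero_le) ?_
  filter_upwards [hwin, eventually_gt_atTop 0] with N hN hpos
  refine (h.measure_noCandidate_le hN hpos).trans (ENNReal.ofReal_le_ofReal (le_of_eq ?_))
  rw [one_div, mul_inv, mul_inv, mul_inv]
  ring

/-- The nearest-match indices, as functions on the sample, when there is a candidate. -/
theorem exists_fin_match {N : ℕ} {z : ℕ → ℝ} {x : ℕ → Cov d} {S : Set ℕ} {𝒟 : Set ℝ}
    (hS : ∀ l, l ∈ S ↔ l < N ∧ z l ∈ 𝒟) {mt : ℕ → ℕ}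
    (h : ∀ i < N, S.Nonempty → IsNearestMatch x S i (mt i)) (hne : ∃ l < N, z l ∈ 𝒟) :
    ∃ j : Fin N → Fin N, ∀ i, (j i : ℕ) = mt i ∧ z (j i) ∈ 𝒟 ∧
      ∀ l : Fin N, z l ∈ 𝒟 → dist (x (j i)) (x i) ≤ dist (x l) (x i) := by
  obtain ⟨l, hl, hl'⟩ := hne
  have hSne : S.Nonempty := ⟨l, (hS l).2 ⟨hl, hl'⟩⟩
  have hmem : ∀ i : Fin N, mt i < N ∧ z (mt i) ∈ 𝒟 := fun i => (hS _).1 (h i i.2 hSne).1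
  refine ⟨fun i => ⟨mt i, (hmem i).1⟩, fun i => ⟨rfl, (hmem i).2, fun k hk => ?_⟩⟩
  exact (h i i.2 hSne).2 k ((hS k).2 ⟨k.2, hk⟩)

/-- The average covariate distance between a unit and its match is of smaller order than the
caliper. -/
theorem IIDSample.negligible_discrepancy (h : IIDSample μ 𝒵 𝒳 Y Z X) (hd : 1 ≤ d) {R : ℝ}
    (hR : 0 < R) (hRX : ∀ x ∈ 𝒳, ‖x‖ ≤ R) (hη : CaliperRate d η) (hc₁ : 0 < c₁)
    (hwin : ∀ᶠ N in atTop, IsWindow (μ.map fun ω => (Z 0 ω, X 0 ω)) (𝒞 N) (c₁ * η N))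
    {mt : ℕ → Ω → ℕ → ℕ}
    (hmt : ∀ N ω, ω ∉ noCandidate Z (𝒞 N) N → ∃ j : Fin N → Fin N, ∀ i, (j i : ℕ) = mt N ω i ∧
      Z (j i) ω ∈ 𝒞 N ∧
        ∀ l : Fin N, Z l ω ∈ 𝒞 N → dist (X (j i) ω) (X i ω) ≤ dist (X l ω) (X i ω)) :
    Negligible μ fun N ω => ENNReal.ofReal
      (1 / (N * η N) * ∑ i ∈ Finset.range N, dist (X (mt N ω i) ω) (X i ω)) := by
  have hW0 : Measurable fun ω => (Z 0 ω, X 0 ω) := (h.measurable_Z 0).prodMk (h.measurable_X 0)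
  have : IsProbabilityMeasure (μ.map fun ω => (Z 0 ω, X 0 ω)) :=
    Measure.isProbabilityMeasure_map hW0.aemeasurable
  obtain ⟨c, hc, hbound⟩ := exists_discrepancy_bound hd hR
  refine Negligible.of_lintegral (h.tendsto_noCandidate hη hwin) fun δ hδ => ?_
  -- Obtained by inserting the smallest scale `s = δ / 2 * η N` and `p = c₁ * η N` into the distance
  -- bound and dividing by `N * η N`; the limit is `δ / 2 < δ`.
  have hlim : Tendsto (fun N : ℕ => δ / 2 * (1 + c / ((δ / 2) ^ (max d 2) * c₁) *
      ((N : ℝ) * η N ^ (max d 2 + 1))⁻¹)) atTop (𝓝 (δ / 2 * (1 + c / ((δ / 2) ^ (max d 2) * c₁) * 0))) :=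
    ((tendsto_inv_atTop_zero.comp hη.tendsto_pow_max).const_mul _ |>.const_add 1).const_mul _
  have hev := hlim.eventually_lt_const (show δ / 2 * (1 + c / ((δ / 2) ^ (max d 2) * c₁) * 0) < δ by
    rw [mul_zero, add_zero]; linarith)
  filter_upwards [hwin, eventually_gt_atTop 0, hev] with N hN hpos hlt
  have hηp := hη.pos N
  have hNr : (0 : ℝ) < N := by exact_mod_cast hpos
  have hXall : ∀ᵐ ω ∂μ, ∀ i, X i ω ∈ 𝒳 := ae_all_iff.2 h.mem_covariate
  have hnorm : ∀ᵐ u ∂Measure.pi (fun _ : Fin N => μ.map fun ω => (Z 0 ω, X 0 ω)),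
      ∀ i, ‖(u i).2‖ ≤ R := by
    have hms : MeasurableSet {u : Fin N → ℝ × Cov d | ∀ i, ‖(u i).2‖ ≤ R} := by
      have : {u : Fin N → ℝ × Cov d | ∀ i, ‖(u i).2‖ ≤ R} =
          ⋂ i, {u : Fin N → ℝ × Cov d | ‖(u i).2‖ ≤ R} := by ext u; simp
      rw [this]
      exact MeasurableSet.iInter fun i => measurableSet_le (by fun_prop) measurable_const
    rw [← h.map_design N, ae_map_iff (h.measurable_design N).aemeasurable hms]
    filter_upwards [hXall] with ω hω i using hRX _ (hω i)
  obtain ⟨F, hF, hFint, hFle⟩ := hbound (μ.map fun ω => (Z 0 ω, X 0 ω)) (𝒞 N) hN.measurableSet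
    (c₁ * η N) hN.pos hN.le_one hN.miss N hnorm (δ / 2 * η N) (by positivity)
  refine ⟨fun ω => ENNReal.ofReal (1 / (N * η N)) * F (design N Z X ω),
    ((hF.comp (h.measurable_design N)).const_mul _).aemeasurable, ?_, ?_⟩
  · filter_upwards [hXall] with ω hω hbad
    obtain ⟨j, hj⟩ := hmt N ω hbad
    rw [ENNReal.ofReal_mul (by positivity)]
    gcongr
    have h1 := hFle (design N Z X ω) (fun i => hRX _ (hω i)) j fun i => ⟨(hj i).2.1, (hj i).2.2⟩
    refine le_of_eq_of_le ?_ h1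
    rw [Finset.sum_range]
    congr 1
    refine Finset.sum_congr rfl fun i _ => ?_
    rw [← (hj i).1]
    rfl
  · have hFd : Measurable fun ω => F (design N Z X ω) := hF.comp (h.measurable_design N)
    rw [lintegral_const_mul _ hFd, ← lintegral_map hF (h.measurable_design N), h.map_design N]
    refine (mul_le_mul_right hFint _).trans ?_
    rw [← ENNReal.ofReal_mul (by positivity)]
    refine ENNReal.ofReal_le_ofReal (le_trans (le_of_eq ?_) hlt.le)
    rw [mul_pow, pow_succ]
    field_simp

/-- The weighted residuals of the matches average out. -/
theorem IIDSample.negligible_residual (h : IIDSample μ 𝒵 𝒳 Y Z X) (hη : CaliperRate d η)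
    (hc₁ : 0 < c₁)
    (hwin : ∀ᶠ N in atTop, IsWindow (μ.map fun ω => (Z 0 ω, X 0 ω)) (𝒞 N) (c₁ * η N))
    (h𝒞' : ∀ N, MeasurableSet (𝒞' N)) {κ : ℝ} (hκ : 0 < κ)
    (hsep : ∀ N, ∀ z ∈ 𝒞 N, ∀ z' ∈ 𝒞' N, 2 * κ * η N ≤ |z - z'|)
    (hsph : ∀ (x : Cov d) (ρ : ℝ), ∀ᵐ w ∂(μ.map fun ω => (Z 0 ω, X 0 ω)), dist w.2 x ≠ ρ)
    {e : ℕ → (𝒵 → ℝ) × ℝ × Cov d → ℝ} (he : ∀ N, Measurable (e N)) {V : ℝ} (hV0 : 0 ≤ V)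
    (he2 : ∀ N, MemLp (fun ω => e N (unitData 𝒵 Y Z X 0 ω)) 2 μ)
    (h0 : ∀ N, ∀ G : ℝ × Cov d → ℝ, Measurable G → (∃ B, ∀ w, |G w| ≤ B) →
      ∫ ω, G (Z 0 ω, X 0 ω) * e N (unitData 𝒵 Y Z X 0 ω) ∂μ = 0)
    (hV : ∀ N, ∀ G : ℝ × Cov d → ENNReal, Measurable G →
      ∫⁻ ω, G (Z 0 ω, X 0 ω) * ENNReal.ofReal (e N (unitData 𝒵 Y Z X 0 ω) ^ 2) ∂μ ≤
        ENNReal.ofReal V * ∫⁻ ω, G (Z 0 ω, X 0 ω) ∂μ) :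
    Negligible μ fun N ω => ENNReal.ofReal |∑ j : Fin N,
      pairWeight (𝒞 N) (𝒞' N) j (design N Z X ω) * e N (unitData 𝒵 Y Z X j ω)| := by
  refine Negligible.of_sq (Negligible.of_lintegral (Bad := fun _ => ∅) (by simp) fun δ hδ => ?_)
  obtain ⟨t, ht⟩ := exists_finset_dirCone d
  -- The second moment bound at separation `2 * κ * η N` and hitting probability `c₁ * η N`; the
  -- factor `1 / p` turns `1 / (N η ^ 2)` into `1 / (N η ^ 3)`.
  have hlim : Tendsto (fun N : ℕ => V / (4 * κ ^ 2) * (((N : ℝ) * η N ^ 2)⁻¹ +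
      (1 + t.card) / c₁ * ((N : ℝ) * η N ^ 3)⁻¹)) atTop
      (𝓝 (V / (4 * κ ^ 2) * (0 + (1 + t.card) / c₁ * 0))) :=
    (hη.tendsto_inv_sq.add (hη.tendsto_inv_cube.const_mul _)).const_mul _
  have hev := hlim.eventually_lt_const
    (show V / (4 * κ ^ 2) * (0 + (1 + t.card) / c₁ * 0) < δ by simpa using hδ)
  filter_upwards [hwin, eventually_gt_atTop 0, hev] with N hN hpos hlt
  have hηp := hη.pos N
  have hNr : (0 : ℝ) < N := by exact_mod_cast hpos
  have hU := h.measurable_unitData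
  set Q := μ.map (unitData 𝒵 Y Z X 0) with hQ
  have : IsProbabilityMeasure Q := Measure.isProbabilityMeasure_map (hU 0).aemeasurable
  have hQw : Q.map Prod.snd = μ.map fun ω => (Z 0 ω, X 0 ω) := by
    rw [hQ, Measure.map_map measurable_snd (hU 0)]
    rfl
  have hs : (0 : ℝ) < 2 * κ * η N := by positivity
  have hUN : Measurable fun ω (l : Fin N) => unitData 𝒵 Y Z X l ω :=
    measurable_pi_iff.2 fun l => hU l
  have hmeasT : Measurable fun u : Fin N → (𝒵 → ℝ) × ℝ × Cov d =>
      ENNReal.ofReal ((∑ j, pairWeight (𝒞 N) (𝒞' N) j (Prod.snd ∘ u) * e N (u j)) ^ 2) := by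
    refine ((Finset.measurable_sum _ fun j _ => Measurable.mul ?_ ?_).pow_const 2).ennreal_ofReal
    · exact (measurable_pairWeight hN.measurableSet (h𝒞' N) j).comp
        (measurable_pi_iff.2 fun i => measurable_snd.comp (measurable_pi_apply i))
    · exact (he N).comp (measurable_pi_apply j)
  refine ⟨fun ω => ENNReal.ofReal ((∑ j : Fin N,
    pairWeight (𝒞 N) (𝒞' N) j (design N Z X ω) * e N (unitData 𝒵 Y Z X j ω)) ^ 2),
    (hmeasT.comp hUN).aemeasurable, Eventually.of_forall fun _ _ => le_rfl, ?_⟩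
  have h1 := lintegral_sq_pairWeight_le (N := N) Q measurable_snd (he N)
    ((memLp_map_measure_iff (he N).aestronglyMeasurable (hU 0).aemeasurable).2 (he2 N)) hV0
    (by
      intro g hg hgb
      have m0 : Measurable fun u : (𝒵 → ℝ) × ℝ × Cov d => g u.2 * e N u :=
        (hg.comp measurable_snd).mul (he N)
      rw [hQ, integral_map (hU 0).aemeasurable m0.aestronglyMeasurable]
      exact h0 N g hg hgb)
    (by
      intro g hg
      have m1 : Measurable fun u : (𝒵 → ℝ) × ℝ × Cov d =>
          g u.2 * ENNReal.ofReal (e N u ^ 2) :=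
        (hg.comp measurable_snd).mul ((he N).pow_const 2).ennreal_ofReal
      have m2 : Measurable fun u : (𝒵 → ℝ) × ℝ × Cov d => g u.2 := hg.comp measurable_snd
      rw [hQ, lintegral_map m1 (hU 0), lintegral_map m2 (hU 0)]
      exact hV N g hg)
    hN.measurableSet (h𝒞' N) hs (hsep N) hN.pos hN.le_one (by rw [hQw]; exact hN.miss)
    (by rw [hQw]; exact hsph) ht hpos
  rw [← h.map_unitData N, lintegral_map hmeasT hUN] at h1
  refine h1.trans (ENNReal.ofReal_le_ofReal (le_trans (le_of_eq ?_) hlt.le))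
  field_simp
  ring

/-- A secant slope across `z₀` is close to the derivative at `z₀`. -/
theorem abs_secant_sub_le {g : ℝ → ℝ} {D δ z₀ z z' : ℝ} (hz : z₀ < z) (hz' : z' < z₀)
    (h : |g z - g z₀ - D * (z - z₀)| ≤ δ * |z - z₀|)
    (h' : |g z' - g z₀ - D * (z' - z₀)| ≤ δ * |z' - z₀|) :
    |(g z - g z') / (z - z') - D| ≤ δ := by
  have hpos : 0 < z - z' := by linarith
  rw [div_sub' hpos.ne', abs_div, abs_of_pos hpos, div_le_iff₀ hpos]
  rw [abs_of_pos (by linarith : 0 < z - z₀)] at h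
  rw [abs_of_neg (by linarith : z' - z₀ < 0)] at h'
  rw [abs_le] at h h' ⊢
  constructor <;> nlinarith [h.1, h.2, h'.1, h'.2]

/-- The regression secants over the matched exposures approximate the regression derivative. -/
theorem IIDSample.negligible_bias (h : IIDSample μ 𝒵 𝒳 Y Z X) (hη : CaliperRate d η)
    {m : ℝ → Cov d → ℝ} {C z₀ ρ κ : ℝ} (hz₀ : z₀ ∈ interior 𝒵) (hρ : 0 < ρ) (hκ : 0 < κ)
    (hI : Set.Icc (z₀ - ρ) (z₀ + ρ) ⊆ 𝒵)
    (hms : ∀ x ∈ 𝒳, SmoothOn (fun z => m z x) 𝒵 C) {D : Cov d → ℝ}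
    (hD : ∀ x ∈ 𝒳, D x = deriv (fun z => m z x) z₀)
    (hlin : ∀ δ : ℝ, 0 < δ → ∀ ε : ENNReal, 0 < ε →
      ∃ θ > 0, ∃ G : Set (Cov d), MeasurableSet G ∧ μ (X 0 ⁻¹' Gᶜ) ≤ ε ∧
        ∀ x ∈ 𝒳, x ∈ G → ∀ z, |z - z₀| < θ →
          |m z x - m z₀ x - D x * (z - z₀)| ≤ δ * |z - z₀|)
    {Bad : ℕ → Set Ω} (hBad : Tendsto (fun N => μ (Bad N)) atTop (𝓝 0))
    {i₁ i₂ : ℕ → Ω → ℕ → ℕ}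
    (h₁ : ∀ N ω, ω ∉ Bad N → ∀ i < N, Z (i₁ N ω i) ω ∈ Set.Icc (z₀ - η N) (z₀ - κ * η N))
    (h₂ : ∀ N ω, ω ∉ Bad N → ∀ i < N, Z (i₂ N ω i) ω ∈ Set.Icc (z₀ + κ * η N) (z₀ + η N)) :
    Negligible μ fun N ω => ENNReal.ofReal ((1 / (N : ℝ)) * ∑ i ∈ Finset.range N,
      |(m (Z (i₂ N ω i) ω) (X i ω) - m (Z (i₁ N ω i) ω) (X i ω)) /
        (Z (i₂ N ω i) ω - Z (i₁ N ω i) ω) - D (X i ω)|) := by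
  refine Negligible.of_lintegral hBad fun δ hδ => ?_
  have hC0 : 0 < 4 * |C| + 1 := by positivity
  -- Exceptional covariates cost at most `2 * |C|` each, and `2 * |C| * δ / (4 * |C| + 1) ≤ δ / 2`;
  -- the 1 keeps the denominator positive when `C = 0`.
  obtain ⟨θ, hθ, G, hG, hGμ, hGlin⟩ := hlin (δ / 2) (by positivity)
    (ENNReal.ofReal (δ / (4 * |C| + 1))) (by rw [ENNReal.ofReal_pos]; positivity)
  have hev := hη.tendsto_zero.eventually_lt_const (lt_min hθ hρ)
  filter_upwards [hev, eventually_gt_atTop 0] with N hN hpos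
  have hNr : (0 : ℝ) < N := by exact_mod_cast hpos
  have hηp := hη.pos N
  have hηθ : η N < θ := hN.trans_le (min_le_left _ _)
  have hηρ : η N < ρ := hN.trans_le (min_le_right _ _)
  have hXall : ∀ᵐ ω ∂μ, ∀ i, X i ω ∈ 𝒳 := ae_all_iff.2 h.mem_covariate
  have hind : Measurable (Gᶜ.indicator (1 : Cov d → ENNReal)) := measurable_one.indicator hG.compl
  have hind' : ∀ i, Measurable fun ω => Gᶜ.indicator (1 : Cov d → ENNReal) (X i ω) := fun i =>
    hind.comp (h.measurable_X i)
  have hsm : Measurable fun ω => ∑ i ∈ Finset.range N,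
      Gᶜ.indicator (1 : Cov d → ENNReal) (X i ω) := Finset.measurable_sum _ fun i _ => hind' i
  refine ⟨fun ω => ENNReal.ofReal (δ / 2) + ENNReal.ofReal (2 * |C| / N) *
    ∑ i ∈ Finset.range N, Gᶜ.indicator 1 (X i ω),
    (measurable_const.add (hsm.const_mul _)).aemeasurable, ?_, ?_⟩
  · filter_upwards [hXall] with ω hω hbad
    have hterm : ∀ i ∈ Finset.range N,
        |(m (Z (i₂ N ω i) ω) (X i ω) - m (Z (i₁ N ω i) ω) (X i ω)) /
          (Z (i₂ N ω i) ω - Z (i₁ N ω i) ω) - D (X i ω)| ≤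
          δ / 2 + 2 * |C| * Gᶜ.indicator 1 (X i ω) := by
      intro i hi
      have hiN := Finset.mem_range.1 hi
      obtain ⟨a1, b1⟩ := h₁ N ω hbad i hiN
      obtain ⟨a2, b2⟩ := h₂ N ω hbad i hiN
      have hκη : 0 < κ * η N := by positivity
      set z := Z (i₂ N ω i) ω
      set z' := Z (i₁ N ω i) ω
      by_cases hxG : X i ω ∈ G
      · rw [Set.indicator_of_notMem (by simpa using hxG), mul_zero, add_zero]
        refine abs_secant_sub_le (g := fun z => m z (X i ω)) (z₀ := z₀) (by linarith) (by linarith)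
          (hGlin _ (hω i) hxG z ?_) (hGlin _ (hω i) hxG z' ?_)
        · rw [abs_lt]; constructor <;> linarith
        · rw [abs_lt]; constructor <;> linarith
      -- Off the good set no linearization is available, but the secant and the derivative are each
      -- bounded by `C`.
      · rw [Set.indicator_of_mem (by simpa using hxG), Pi.one_apply, mul_one]
        have s1 := (hms _ (hω i)).abs_sub_le hI (z := z) (z' := z')
          ⟨by linarith, by linarith⟩ ⟨by linarith, by linarith⟩
        have s2 := (hms _ (hω i)).abs_deriv_le hz₀
        rw [← hD _ (hω i)] at s2
        have hzz : 0 < z - z' := by linarith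
        rw [abs_of_pos hzz] at s1
        have s3 : |(m z (X i ω) - m z' (X i ω)) / (z - z')| ≤ C := by
          rw [abs_div, abs_of_pos hzz, div_le_iff₀ hzz]
          exact s1
        have s4 := abs_sub ((m z (X i ω) - m z' (X i ω)) / (z - z')) (D (X i ω))
        have s5 := le_abs_self C
        linarith
    have hsum : (1 / (N : ℝ)) * ∑ i ∈ Finset.range N,
        |(m (Z (i₂ N ω i) ω) (X i ω) - m (Z (i₁ N ω i) ω) (X i ω)) /
          (Z (i₂ N ω i) ω - Z (i₁ N ω i) ω) - D (X i ω)| ≤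
        δ / 2 + 2 * |C| / N * ∑ i ∈ Finset.range N, Gᶜ.indicator 1 (X i ω) := by
      calc _ ≤ (1 / (N : ℝ)) * ∑ i ∈ Finset.range N,
            (δ / 2 + 2 * |C| * Gᶜ.indicator 1 (X i ω)) := by
            gcongr with i hi
            exact hterm i hi
        _ = _ := by
            rw [Finset.sum_add_distrib, ← Finset.mul_sum, Finset.sum_const, Finset.card_range,
              nsmul_eq_mul]
            field_simp
    refine (ENNReal.ofReal_le_ofReal hsum).trans (le_of_eq ?_)
    have hnn : ∀ i, (0 : ℝ) ≤ Gᶜ.indicator 1 (X i ω) := fun i =>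
      Set.indicator_nonneg (fun _ _ => zero_le_one) _
    rw [ENNReal.ofReal_add (by positivity) (mul_nonneg (by positivity)
      (Finset.sum_nonneg fun i _ => hnn i)), ENNReal.ofReal_mul (by positivity),
      ENNReal.ofReal_sum_of_nonneg fun i _ => hnn i]
    congr 2
    refine Finset.sum_congr rfl fun i _ => ?_
    by_cases hx : X i ω ∈ Gᶜ
    · rw [Set.indicator_of_mem hx, Set.indicator_of_mem hx]; simp
    · rw [Set.indicator_of_notMem hx, Set.indicator_of_notMem hx]; simp
  · rw [lintegral_add_left measurable_const, lintegral_const_mul _ hsm,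
      lintegral_finsetSum _ fun i _ => hind' i,
      Finset.sum_congr rfl fun i _ => h.lintegral_covariate hind i]
    have e1 : ∫⁻ ω, Gᶜ.indicator (1 : Cov d → ENNReal) (X 0 ω) ∂μ = μ (X 0 ⁻¹' Gᶜ) := by
      rw [← lintegral_indicator_one (h.measurable_X 0 hG.compl)]
      rfl
    rw [e1, Finset.sum_const, Finset.card_range, nsmul_eq_mul]
    calc ∫⁻ _, ENNReal.ofReal (δ / 2) ∂μ + ENNReal.ofReal (2 * |C| / N) * (N * μ (X 0 ⁻¹' Gᶜ))
        ≤ ENNReal.ofReal (δ / 2) + ENNReal.ofReal (2 * |C| / N) *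
          (N * ENNReal.ofReal (δ / (4 * |C| + 1))) := by
          gcongr
          simp
      _ = ENNReal.ofReal (δ / 2 + 2 * |C| / N * (N * (δ / (4 * |C| + 1)))) := by
          rw [ENNReal.ofReal_add (by positivity) (by positivity),
            ENNReal.ofReal_mul (by positivity), ENNReal.ofReal_mul (by positivity),
            ENNReal.ofReal_natCast]
      _ ≤ ENNReal.ofReal δ := by
          refine ENNReal.ofReal_le_ofReal ?_
          have : 2 * |C| / N * (N * (δ / (4 * |C| + 1))) ≤ δ / 2 := by
            have e2 : 2 * |C| / N * (N * (δ / (4 * |C| + 1))) = 2 * |C| * δ / (4 * |C| + 1) := by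
              field_simp
            rw [e2, div_le_div_iff₀ (by positivity) two_pos]
            nlinarith [abs_nonneg C]
          linarith

end Sides

/-! ### Combining the error terms. -/

section Combination

variable {Ω : Type*} [MeasurableSpace Ω] {μ : Measure Ω}

theorem Negligible.const_mul {R : ℕ → Ω → ENNReal} (hR : Negligible μ R) {c : ENNReal}
    (hc : c ≠ ⊤) : Negligible μ fun N ω => c * R N ω := by
  intro ε hε hεt
  rcases eq_or_ne c 0 with rfl | hc0
  · simp [hε.ne']
  refine tendsto_of_tendsto_of_tendsto_of_le_of_le tendsto_const_nhds
    (hR (ε / c) (ENNReal.div_pos hε.ne' hc) (ENNReal.div_ne_top hεt hc0)) (fun _ => zero_le)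
    fun N => measure_mono fun ω hω => ?_
  exact ENNReal.div_le_of_le_mul' hω

theorem negligible_of_tendsto {a : ℕ → ℝ} (ha : Tendsto a atTop (𝓝 0)) :
    Negligible μ fun N _ => ENNReal.ofReal (a N) := by
  intro ε hε hεt
  have h0 : Tendsto (fun N => ENNReal.ofReal (a N)) atTop (𝓝 0) := by
    simpa using ENNReal.tendsto_ofReal ha
  refine tendsto_const_nhds.congr' ?_
  filter_upwards [h0.eventually_lt_const hε] with N hN
  have : {ω : Ω | ε ≤ ENNReal.ofReal (a N)} = ∅ :=
    Set.eq_empty_iff_forall_notMem.2 fun _ h => not_le.2 hN h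
  rw [this, measure_empty]

/-- Splitting the error of an average of noisy, biased quotients into its sources. -/
theorem abs_average_sub_le {N : ℕ} (hN : 0 < N) {q E₁ E₂ b D d₁ d₂ : Fin N → ℝ} {A L s : ℝ}
    (h : ∀ i, |q i - (E₂ i - E₁ i) - b i| ≤ (2 * A + L * (d₂ i + d₁ i)) / s) (c : ℝ) :
    |(1 / (N : ℝ)) * ∑ i, q i - c| ≤ |(1 / (N : ℝ)) * ∑ i, E₂ i| + |(1 / (N : ℝ)) * ∑ i, E₁ i| +
      (1 / (N : ℝ)) * ∑ i, |b i - D i| + |(1 / (N : ℝ)) * ∑ i, D i - c| + 2 * A / s +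
      (L / s * ((1 / (N : ℝ)) * ∑ i, d₂ i) + L / s * ((1 / (N : ℝ)) * ∑ i, d₁ i)) := by
  have hNr : (0 : ℝ) < N := by exact_mod_cast hN
  have e1 : (1 / (N : ℝ)) * ∑ i, q i - c = (1 / (N : ℝ)) * ∑ i, E₂ i - (1 / (N : ℝ)) * ∑ i, E₁ i +
      (1 / (N : ℝ)) * ∑ i, (b i - D i) + ((1 / (N : ℝ)) * ∑ i, D i - c) +
      (1 / (N : ℝ)) * ∑ i, (q i - (E₂ i - E₁ i) - b i) := by
    simp only [Finset.sum_sub_distrib]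
    ring
  have h1 : |(1 / (N : ℝ)) * ∑ i, (b i - D i)| ≤ (1 / (N : ℝ)) * ∑ i, |b i - D i| := by
    rw [abs_mul, abs_of_nonneg (by positivity : (0 : ℝ) ≤ 1 / N)]
    gcongr
    exact Finset.abs_sum_le_sum_abs _ _
  have h2 : |(1 / (N : ℝ)) * ∑ i, (q i - (E₂ i - E₁ i) - b i)| ≤ 2 * A / s +
      (L / s * ((1 / (N : ℝ)) * ∑ i, d₂ i) + L / s * ((1 / (N : ℝ)) * ∑ i, d₁ i)) := by
    rw [abs_mul, abs_of_nonneg (by positivity : (0 : ℝ) ≤ 1 / N)]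
    calc _ ≤ (1 / (N : ℝ)) * ∑ i, (2 * A + L * (d₂ i + d₁ i)) / s := by
          gcongr
          exact (Finset.abs_sum_le_sum_abs _ _).trans (Finset.sum_le_sum fun i _ => h i)
      _ = _ := by
          rw [← Finset.sum_div, Finset.sum_add_distrib, Finset.sum_const, ← Finset.mul_sum,
            Finset.sum_add_distrib, Finset.card_univ, Fintype.card_fin, nsmul_eq_mul]
          field_simp
  rw [e1]
  have a1 := abs_add_le ((1 / (N : ℝ)) * ∑ i, E₂ i - (1 / (N : ℝ)) * ∑ i, E₁ i +
      (1 / (N : ℝ)) * ∑ i, (b i - D i) + ((1 / (N : ℝ)) * ∑ i, D i - c))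
      ((1 / (N : ℝ)) * ∑ i, (q i - (E₂ i - E₁ i) - b i))
  have a2 := abs_add_le ((1 / (N : ℝ)) * ∑ i, E₂ i - (1 / (N : ℝ)) * ∑ i, E₁ i +
      (1 / (N : ℝ)) * ∑ i, (b i - D i)) ((1 / (N : ℝ)) * ∑ i, D i - c)
  have a3 := abs_add_le ((1 / (N : ℝ)) * ∑ i, E₂ i - (1 / (N : ℝ)) * ∑ i, E₁ i)
      ((1 / (N : ℝ)) * ∑ i, (b i - D i))
  have a4 := abs_sub ((1 / (N : ℝ)) * ∑ i, E₂ i) ((1 / (N : ℝ)) * ∑ i, E₁ i)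
  linarith

/-- One matched quotient: noise, regression secant at the unit's own covariate, and an error. -/
theorem abs_quotient_sub_le {y₁ y₂ z₁ z₂ e₁ e₂ g₁ g₂ f₁ f₂ A B₁ B₂ s : ℝ} (hs : 0 < s)
    (hz : s ≤ z₂ - z₁) (h₁ : |y₁ - f₁ - e₁| ≤ A) (h₂ : |y₂ - f₂ - e₂| ≤ A)
    (hf₁ : |f₁ - g₁| ≤ B₁) (hf₂ : |f₂ - g₂| ≤ B₂) :
    |(y₂ - y₁) / (z₂ - z₁) - (e₂ / |z₂ - z₁| - e₁ / |z₁ - z₂|) - (g₂ - g₁) / (z₂ - z₁)| ≤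
      (2 * A + (B₂ + B₁)) / s := by
  have hpos : 0 < z₂ - z₁ := hs.trans_le hz
  rw [abs_sub_comm z₁ z₂, abs_of_pos hpos, ← sub_div, ← sub_div, ← sub_div, abs_div,
    abs_of_pos hpos]
  have hle : |y₂ - y₁ - (e₂ - e₁) - (g₂ - g₁)| ≤ 2 * A + (B₂ + B₁) := by
    rw [abs_le] at *
    constructor <;> linarith [h₁.1, h₁.2, h₂.1, h₂.2, hf₁.1, hf₁.2, hf₂.1, hf₂.2]
  exact div_le_div₀ ((abs_nonneg _).trans hle) hle hs hz

/-- Without ties, a minimiser of the covariate distance is the strictly nearest candidate. -/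
theorem mem_nearestSet_of_noTies {N d : ℕ} {A : Type*} {𝒞 : Set A} {u : Fin N → A × Cov d}
    (hu : u ∈ noTies N d A) {i j : Fin N} (hj : (u j).1 ∈ 𝒞)
    (hmin : ∀ l, (u l).1 ∈ 𝒞 → dist (u j).2 (u i).2 ≤ dist (u l).2 (u i).2) :
    u ∈ nearestSet 𝒞 i j :=
  ⟨hj, fun l hl hlc => lt_of_le_of_ne (hmin l hlc) (hu i j l hl.symm)⟩

end Combination

/-! ### Discretized residuals for the sample. -/

section Residual

variable {Ω : Type*} [MeasurableSpace Ω] {μ : Measure Ω} [IsProbabilityMeasure μ] {d : ℕ}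
  {𝒵 : Set ℝ} {𝒳 : Set (Cov d)} {Y : ℕ → ℝ → Ω → ℝ} {Z : ℕ → Ω → ℝ} {X : ℕ → Ω → Cov d}

/-- A residual that has mean zero and bounded variance given the design, and that is uniformly
close to the deviation of the observed outcome from the regression function. -/
theorem IIDSample.exists_residual (h : IIDSample μ 𝒵 𝒳 Y Z X) {r : ℝ}
    (hconf : LocalWeakConfoundedness μ 𝒵 r (Y 0) (Z 0) (X 0)) {m m' : ℝ → Cov d → ℝ}
    (hm : IsCondMean μ 𝒵 (Y 0) (X 0) m) {C a b V τ : ℝ} (hab : a ≤ b) (hI : Set.Icc a b ⊆ 𝒵)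
    (hms : ∀ x ∈ 𝒳, SmoothOn (fun z => m z x) 𝒵 C)
    (hm' : ∀ z, Measurable (m' z)) (hmm' : ∀ z ∈ 𝒵, ∀ x ∈ 𝒳, m' z x = m z x)
    (hY2 : ∀ z ∈ 𝒵, MemLp (Y 0 z) 2 μ)
    (hV : ∀ z ∈ 𝒵, ∀ᵐ ω ∂μ, Var[Y 0 z; μ | MeasurableSpace.comap (X 0) inferInstance] ω ≤ V)
    (hτ : 0 < τ) (hτr : τ ≤ r) :
    ∃ e : (𝒵 → ℝ) × ℝ × Cov d → ℝ, Measurable e ∧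
      MemLp (fun ω => e (unitData 𝒵 Y Z X 0 ω)) 2 μ ∧
      (∀ G : ℝ × Cov d → ℝ, Measurable G → (∃ B, ∀ w, |G w| ≤ B) →
        ∫ ω, G (Z 0 ω, X 0 ω) * e (unitData 𝒵 Y Z X 0 ω) ∂μ = 0) ∧
      (∀ G : ℝ × Cov d → ENNReal, Measurable G →
        ∫⁻ ω, G (Z 0 ω, X 0 ω) * ENNReal.ofReal (e (unitData 𝒵 Y Z X 0 ω) ^ 2) ∂μ ≤
          ENNReal.ofReal V * ∫⁻ ω, G (Z 0 ω, X 0 ω) ∂μ) ∧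
      ∀ i ω, X i ω ∈ 𝒳 → SmoothOn (fun z => Y i z ω) 𝒵 C → Z i ω ∈ Set.Icc a b →
        |Y i (Z i ω) ω - m (Z i ω) (X i ω) - e (unitData 𝒵 Y Z X i ω)| ≤ 2 * C * τ := by
  -- Finitely many fixed exposure levels suffice, so the null sets in unconfoundedness cause no
  -- harm. As `τ ≤ r`, each cell lies in the confoundedness window of its representative.
  obtain ⟨n, cell, rep, hcell, hdisj, hrep, hclose, hcover⟩ := exists_interval_cells hab hτ
  have hrepZ : ∀ k, rep k ∈ 𝒵 := fun k => hI (hrep k)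
  have hmom := cellResidual_moments (μ := μ) (Z := Z 0) (X := X 0) rfl rfl (h.measurable_Z 0)
    (h.measurable_X 0) (y := fun k => Y 0 (rep k)) (fun k => h.measurable_Y 0 _ (hrepZ k))
    (I := fun k => Set.Icc (rep k - r) (rep k + r)) hcell hdisj
    (fun k z hz => by
      have := abs_le.1 ((hclose k z hz).trans hτr)
      exact ⟨by linarith, by linarith⟩)
    (fun k => hconf _ (hrepZ k)) (g := fun k => m' (rep k)) (fun k => hm' _)
    (fun k => by
      refine EventuallyEq.trans ?_ (hm _ (hrepZ k))
      filter_upwards [h.mem_covariate 0] with ω hω using hmm' _ (hrepZ k) _ hω)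
    (fun k => hY2 _ (hrepZ k)) (fun k => hV _ (hrepZ k)) rfl
  refine ⟨fun u => ∑ k, (cell k).indicator 1 u.2.1 * (u.1 ⟨rep k, hrepZ k⟩ - m' (rep k) u.2.2),
    ?_, hmom.1, hmom.2.1, hmom.2.2, ?_⟩
  · refine Finset.measurable_sum _ fun k _ => Measurable.mul ?_ (Measurable.sub ?_ ?_)
    · exact (measurable_one.indicator (hcell k)).comp (measurable_fst.comp measurable_snd)
    · exact (measurable_pi_apply _).comp measurable_fst
    · exact (hm' _).comp (measurable_snd.comp measurable_snd)
  · intro i ω hx hs hz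
    obtain ⟨k, hk⟩ := hcover _ hz
    have hsum : ∑ l, (cell l).indicator 1 (Z i ω) * (Y i (rep l) ω - m' (rep l) (X i ω)) =
        Y i (rep k) ω - m (rep k) (X i ω) := by
      rw [Finset.sum_eq_single k]
      · rw [Set.indicator_of_mem hk, Pi.one_apply, one_mul, hmm' _ (hrepZ k) _ hx]
      · intro l _ hl
        rw [Set.indicator_of_notMem fun hl' => Set.disjoint_left.1 (hdisj hl) hl' hk, zero_mul]
      · simp
    have hC : 0 ≤ C := (abs_nonneg _).trans (hs.2.2 _ (hrepZ k))
    -- Passing from `Z_i` to the representative moves the path and the regression function by at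
    -- most `C * τ` each, whence `2 * C * τ`.
    have s1 := hs.abs_sub_le hI hz (hrep k)
    have s2 := (hms _ hx).abs_sub_le hI hz (hrep k)
    have s3 : C * |Z i ω - rep k| ≤ C * τ := mul_le_mul_of_nonneg_left (hclose k _ hk) hC
    show |_ - _ - ∑ l, (cell l).indicator 1 (Z i ω) * (Y i (rep l) ω - m' (rep l) (X i ω))| ≤ _
    rw [hsum]
    replace s1 := abs_le.1 (s1.trans s3)
    replace s2 := abs_le.1 (s2.trans s3)
    rw [abs_le]
    constructor <;> linarith [s1.1, s1.2, s2.1, s2.2]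

end Residual

end ACDE

end

/-! ### The consistency theorem. -/

theorem theorem4 {Ω : Type*} [MeasurableSpace Ω] (μ : Measure Ω) [IsProbabilityMeasure μ]
    (d : ℕ) (hd : 1 ≤ d)
    (𝒵 : Set ℝ) (h𝒵 : Bornology.IsBounded 𝒵) (𝒳 : Set (ACDE.Cov d))
    (Y : ℕ → ℝ → Ω → ℝ) (Yobs Z : ℕ → Ω → ℝ) (X : ℕ → Ω → ACDE.Cov d)
    (z₀ : ℝ) (hz₀ : z₀ ∈ interior 𝒵)
    (hiid : ACDE.IIDSample μ 𝒵 𝒳 Y Z X)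
    (h1 : ACDE.OutcomeConsistency 𝒵 Y Yobs Z)
    (h2 : ∃ r > 0, ∀ i, ACDE.LocalWeakConfoundedness μ 𝒵 r (Y i) (Z i) (X i))
    (h3 : ∀ i, ACDE.StrictOverlap μ 𝒵 𝒳 (Z i) (X i))
    (m : ℝ → ACDE.Cov d → ℝ) (hm : ∀ i, ACDE.IsCondMean μ 𝒵 (Y i) (X i) m)
    (h4 : ACDE.Smoothness μ 𝒵 𝒳 Y m)
    (hS : ∀ i, ACDE.Regularity μ 𝒵 𝒳 (Y i) (X i) m)
    (κ : ℝ) (hκ : κ ∈ Set.Ioo (0 : ℝ) 1)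
    (η : ℕ → ℝ) (hη : ACDE.CaliperRate d η)
    (i₁ i₂ : ℕ → Ω → ℕ → ℕ)
    (hmatch : ∀ N ω,
      ACDE.IsMatching N (fun l => Z l ω) (fun l => X l ω) z₀ κ (η N) (i₁ N ω) (i₂ N ω)) :
    TendstoInMeasure μ
      (fun N ω =>
        ACDE.matchingEstimator N (fun l => Yobs l ω) (fun l => Z l ω) (i₁ N ω) (i₂ N ω)
          - ACDE.acde μ (Y 0) z₀)
      atTop (fun _ => 0) := by

  open ACDE in
  obtain ⟨hκ0, hκ1⟩ := hκ
  obtain ⟨r, hr, hconf⟩ := h2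
  obtain ⟨C, hYs, hms⟩ := h4
  obtain ⟨V, hV⟩ := (hS 0).condVar_bounded
  obtain ⟨L, hL⟩ := (hS 0).lipschitz
  obtain ⟨fX, -, -, hfX⟩ := (hS 0).density
  obtain ⟨R, hR, hRX⟩ := (hS 0).bounded_covariate.exists_pos_norm_le
  obtain ⟨ρ, hρ, hI⟩ : ∃ ρ > 0, Set.Icc (z₀ - ρ) (z₀ + ρ) ⊆ 𝒵 := by
    obtain ⟨ε, hε, hb⟩ := Metric.nhds_basis_closedBall.mem_iff.1 (mem_interior_iff_mem_nhds.1 hz₀)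
    exact ⟨ε, hε, by rwa [← Real.closedBall_eq_Icc]⟩
  obtain ⟨m', hm'm, hmm'⟩ := exists_measurable_extension hL
  have hY2 := (hS 0).memLp
  obtain ⟨D, hDm, hD, hDint⟩ := exists_regression_derivative hz₀ hρ hI (hiid.measurable_Y 0)
    (hiid.measurable_X 0) (hiid.mem_covariate 0) (hYs 0) hms hm'm hmm' (hm 0)
    fun z hz => (hY2 z hz).integrable one_le_two
  obtain ⟨ζ, hζ, hmiss⟩ := (h3 0).exists_miss_bound (hiid.measurable_Z 0) (hiid.measurable_X 0)
    (hiid.mem_covariate 0)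
  have hηp := hη.pos
  have hκη : ∀ N, 0 < κ * η N := fun N => mul_pos hκ0 (hηp N)
  have hκη1 : ∀ N, κ * η N < η N := fun N => by nlinarith [hηp N]
  -- Each window has length `(1 - κ) * η N`, so overlap gives it conditional probability at least `ζ
  -- * (1 - κ) * η N`.
  have hc₁ : 0 < ζ * (1 - κ) := mul_pos hζ (by linarith)
  set 𝒞₁ : ℕ → Set ℝ := fun N => Set.Icc (z₀ - η N) (z₀ - κ * η N)
  set 𝒞₂ : ℕ → Set ℝ := fun N => Set.Icc (z₀ + κ * η N) (z₀ + η N)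
  have hηρ : ∀ᶠ N in atTop, η N < ρ := hη.tendsto_zero.eventually_lt_const hρ
  have hwin₁ : ∀ᶠ N in atTop,
      IsWindow (μ.map fun ω => (Z 0 ω, X 0 ω)) (𝒞₁ N) (ζ * (1 - κ) * η N) := by
    filter_upwards [hηρ] with N hN
    obtain ⟨b1, b2⟩ := hmiss (z₀ - η N) (z₀ - κ * η N) (by linarith [hκη1 N])
      ((Set.Icc_subset_Icc (by linarith) (by linarith [hκη N])).trans hI)
    have e : ζ * (z₀ - κ * η N - (z₀ - η N)) = ζ * (1 - κ) * η N := by ring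
    rw [e] at b1 b2
    exact ⟨measurableSet_Icc, mul_pos hc₁ (hηp N), b1, b2⟩
  have hwin₂ : ∀ᶠ N in atTop,
      IsWindow (μ.map fun ω => (Z 0 ω, X 0 ω)) (𝒞₂ N) (ζ * (1 - κ) * η N) := by
    filter_upwards [hηρ] with N hN
    obtain ⟨b1, b2⟩ := hmiss (z₀ + κ * η N) (z₀ + η N) (by linarith [hκη1 N])
      ((Set.Icc_subset_Icc (by linarith [hκη N]) (by linarith)).trans hI)
    have e : ζ * (z₀ + η N - (z₀ + κ * η N)) = ζ * (1 - κ) * η N := by ring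
    rw [e] at b1 b2
    exact ⟨measurableSet_Icc, mul_pos hc₁ (hηp N), b1, b2⟩
  have hsph : ∀ (x : Cov d) (ρ : ℝ), ∀ᵐ w ∂(μ.map fun ω => (Z 0 ω, X 0 ω)), dist w.2 x ≠ ρ :=
    ae_dist_ne_of_density hd (hiid.measurable_Z 0) (hiid.measurable_X 0) hfX
  -- Residuals on a mesh that is fine compared with the caliper.
  have hτ : ∀ N, 0 < min (η N ^ 2) r := fun N => lt_min (pow_pos (hηp N) 2) hr
  choose e he_meas he2 he0 heV he_close using fun N =>
    hiid.exists_residual (hconf 0) (hm 0) (a := z₀ - ρ) (b := z₀ + ρ) (V := max V 0)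
      (by linarith) hI hms hm'm hmm' hY2
      (fun z hz => (hV z hz).mono fun ω hω => hω.trans (le_max_left V 0)) (hτ N) (min_le_right _ _)
  have hsep₂ : ∀ N, ∀ z ∈ 𝒞₂ N, ∀ z' ∈ 𝒞₁ N, 2 * κ * η N ≤ z - z' := fun N z hz z' hz' => by
    linarith [hz.1, hz'.2]
  have hT₂ := hiid.negligible_residual hη hc₁ hwin₂ (fun N => measurableSet_Icc) hκ0
    (fun N z hz z' hz' => (hsep₂ N z hz z' hz').trans (le_abs_self _))
    hsph he_meas (le_max_right V 0) he2 he0 heV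
  have hT₁ := hiid.negligible_residual hη hc₁ hwin₁ (fun N => measurableSet_Icc) hκ0
    (fun N z hz z' hz' => by
      rw [abs_sub_comm]
      exact (hsep₂ N z' hz' z hz).trans (le_abs_self _))
    hsph he_meas (le_max_right V 0) he2 he0 heV
  have hmt₁ : ∀ N ω, ω ∉ noCandidate Z (𝒞₁ N) N → ∃ j : Fin N → Fin N, ∀ i,
      (j i : ℕ) = i₁ N ω i ∧ Z (j i) ω ∈ 𝒞₁ N ∧
        ∀ l : Fin N, Z l ω ∈ 𝒞₁ N → dist (X (j i) ω) (X i ω) ≤ dist (X l ω) (X i ω) := by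
    intro N ω hω
    refine exists_fin_match (z := fun l => Z l ω) (x := fun l => X l ω)
      (S := leftCandidates N (fun l => Z l ω) z₀ κ (η N)) (fun l => Iff.rfl)
      (fun i hi => (hmatch N ω i hi).1) ?_
    by_contra hcon
    push Not at hcon
    exact hω hcon
  have hmt₂ : ∀ N ω, ω ∉ noCandidate Z (𝒞₂ N) N → ∃ j : Fin N → Fin N, ∀ i,
      (j i : ℕ) = i₂ N ω i ∧ Z (j i) ω ∈ 𝒞₂ N ∧
        ∀ l : Fin N, Z l ω ∈ 𝒞₂ N → dist (X (j i) ω) (X i ω) ≤ dist (X l ω) (X i ω) := by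
    intro N ω hω
    refine exists_fin_match (z := fun l => Z l ω) (x := fun l => X l ω)
      (S := rightCandidates N (fun l => Z l ω) z₀ κ (η N)) (fun l => Iff.rfl)
      (fun i hi => (hmatch N ω i hi).2) ?_
    by_contra hcon
    push Not at hcon
    exact hω hcon
  have hdisc₁ := hiid.negligible_discrepancy hd hR hRX hη hc₁ hwin₁ hmt₁
  have hdisc₂ := hiid.negligible_discrepancy hd hR hRX hη hc₁ hwin₂ hmt₂
  set Bad : ℕ → Set Ω := fun N => noCandidate Z (𝒞₁ N) N ∪ noCandidate Z (𝒞₂ N) N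
  have hBad : Tendsto (fun N => μ (Bad N)) atTop (𝓝 0) := by
    have := (hiid.tendsto_noCandidate hη hwin₁).add (hiid.tendsto_noCandidate hη hwin₂)
    rw [add_zero] at this
    exact tendsto_of_tendsto_of_tendsto_of_le_of_le tendsto_const_nhds this (fun _ => zero_le)
      fun N => measure_union_le _ _
  have hbias := hiid.negligible_bias hη hz₀ hρ hκ0 hI hms hD
    (fun δ hδ ε hε => exists_uniform_linearization hz₀ hρ hI (hiid.measurable_X 0)
      (hiid.mem_covariate 0) hms hm'm hmm' hDm hD hδ hε) hBad (i₁ := i₁) (i₂ := i₂)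
    (fun N ω hω i hi => by
      obtain ⟨j, hj⟩ := hmt₁ N ω fun h => hω (Or.inl h)
      have := (hj ⟨i, hi⟩).2.1
      rwa [(hj ⟨i, hi⟩).1] at this)
    (fun N ω hω i hi => by
      obtain ⟨j, hj⟩ := hmt₂ N ω fun h => hω (Or.inr h)
      have := (hj ⟨i, hi⟩).2.1
      rwa [(hj ⟨i, hi⟩).1] at this)
  have hlln := TendstoInMeasure.negligible (hiid.tendstoInMeasure_average hDm (C := C)
    fun x hx => by rw [hD x hx]; exact (hms x hx).abs_deriv_le hz₀)
  rw [hDint] at hlln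
  -- The mesh error is divided by the exposure gap, at least `2 * κ * η N`. A mesh of order `η ^ 2`
  -- leaves `O(η)`.
  have hmesh : Tendsto (fun N => 2 * (2 * C * min (η N ^ 2) r) / (2 * κ * η N)) atTop (𝓝 0) := by
    have h0 : Tendsto (fun N => 2 * |C| / κ * η N) atTop (𝓝 0) := by
      simpa using hη.tendsto_zero.const_mul (2 * |C| / κ)
    refine squeeze_zero_norm (fun N => ?_) h0
    have hη1 := hηp N
    rw [Real.norm_eq_abs, abs_div, abs_of_pos (by positivity : 0 < 2 * κ * η N),
      div_le_iff₀ (by positivity), abs_mul, abs_mul, abs_mul, abs_of_pos (hτ N)]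
    have e1 : 2 * |C| / κ * η N * (2 * κ * η N) = 4 * |C| * η N ^ 2 := by
      field_simp
      ring
    rw [e1]
    have := mul_le_mul_of_nonneg_left (min_le_left (η N ^ 2) r) (abs_nonneg C)
    norm_num
    linarith
  have hLκ : (0 : ℝ) ≤ |L| / (2 * κ) := by positivity
  -- Noise from both sides, secant bias, law of large numbers, mesh, and covariate mismatch from
  -- both sides, in the order of `abs_average_sub_le`.
  refine Negligible.tendstoInMeasure (Negligible.mono (((((hT₂.add hT₁).add hbias).add hlln).add
    (negligible_of_tendsto hmesh)).add ((hdisc₂.const_mul (c := ENNReal.ofReal (|L| / (2 * κ)))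
      ENNReal.ofReal_ne_top).add (hdisc₁.const_mul (c := ENNReal.ofReal (|L| / (2 * κ)))
      ENNReal.ofReal_ne_top))) hBad ?_)
  filter_upwards [hηρ, eventually_gt_atTop 0] with N hN hNpos
  -- Almost surely there are no ties, so the prescribed matches coincide with the strictly nearest
  -- candidates in terms of which the weights are defined.
  have hties : ∀ᵐ ω ∂μ, design N Z X ω ∈ noTies N d ℝ := by
    have : IsProbabilityMeasure (μ.map fun ω => (Z 0 ω, X 0 ω)) := Measure.isProbabilityMeasure_map
      ((hiid.measurable_Z 0).prodMk (hiid.measurable_X 0)).aemeasurable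
    refine ae_of_ae_map (hiid.measurable_design N).aemeasurable ?_
    rw [hiid.map_design N]
    exact ae_mem_noTies _ hsph
  filter_upwards [hties, ae_all_iff.2 hiid.mem_covariate, ae_all_iff.2 hYs] with ω hω hX hY hgood
  obtain ⟨j, hj⟩ := hmt₁ N ω fun h => hgood (Or.inl h)
  obtain ⟨k, hk⟩ := hmt₂ N ω fun h => hgood (Or.inr h)
  have hjn : ∀ i, design N Z X ω ∈ nearestSet (𝒞₁ N) i (j i) := fun i =>
    mem_nearestSet_of_noTies hω (hj i).2.1 (hj i).2.2
  have hkn : ∀ i, design N Z X ω ∈ nearestSet (𝒞₂ N) i (k i) := fun i =>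
    mem_nearestSet_of_noTies hω (hk i).2.1 (hk i).2.2
  rw [sum_pairWeight_mul hkn hjn (fun l => e N (unitData 𝒵 Y Z X l ω)),
    sum_pairWeight_mul hjn hkn (fun l => e N (unitData 𝒵 Y Z X l ω))]
  have hs : 0 < 2 * κ * η N := by have := hηp N; positivity
  have hI₁ : ∀ z ∈ 𝒞₁ N, z ∈ Set.Icc (z₀ - ρ) (z₀ + ρ) := fun z hz =>
    ⟨by linarith [hz.1], by linarith [hz.2, hκη N]⟩
  have hI₂ : ∀ z ∈ 𝒞₂ N, z ∈ Set.Icc (z₀ - ρ) (z₀ + ρ) := fun z hz =>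
    ⟨by linarith [hz.1, hκη N], by linarith [hz.2]⟩
  have hfit : ∀ l : ℕ, Z l ω ∈ Set.Icc (z₀ - ρ) (z₀ + ρ) →
      |Yobs l ω - m (Z l ω) (X l ω) - e N (unitData 𝒵 Y Z X l ω)| ≤
        2 * C * min (η N ^ 2) r := fun l hl => by
    rw [h1 l _ (hI hl) ω rfl]
    exact he_close N l ω (hX l) (hY l) hl
  have hlip : ∀ l i : ℕ, Z l ω ∈ Set.Icc (z₀ - ρ) (z₀ + ρ) →
      |m (Z l ω) (X l ω) - m (Z l ω) (X i ω)| ≤ |L| * dist (X l ω) (X i ω) := fun l i hl => by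
    refine (hL _ (hI hl) _ (hX l) _ (hX i)).trans ?_
    rw [dist_eq_norm]
    exact mul_le_mul_of_nonneg_right (le_abs_self L) (norm_nonneg _)
  have hmain := abs_average_sub_le hNpos
    (q := fun i => (Yobs (k i) ω - Yobs (j i) ω) / (Z (k i) ω - Z (j i) ω))
    (E₂ := fun i => e N (unitData 𝒵 Y Z X (k i) ω) / |Z (k i) ω - Z (j i) ω|)
    (E₁ := fun i => e N (unitData 𝒵 Y Z X (j i) ω) / |Z (j i) ω - Z (k i) ω|)
    (b := fun i => (m (Z (k i) ω) (X i ω) - m (Z (j i) ω) (X i ω)) / (Z (k i) ω - Z (j i) ω))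
    (D := fun i => D (X i ω)) (d₂ := fun i => dist (X (k i) ω) (X i ω))
    (d₁ := fun i => dist (X (j i) ω) (X i ω)) (A := 2 * C * min (η N ^ 2) r) (L := |L|)
    (s := 2 * κ * η N)
    (fun i => by
      have hzj := hI₁ _ (hj i).2.1
      have hzk := hI₂ _ (hk i).2.1
      rw [mul_add]
      exact abs_quotient_sub_le hs (hsep₂ N _ (hk i).2.1 _ (hj i).2.1) (hfit _ hzj) (hfit _ hzk)
        (hlip _ i hzj) (hlip _ i hzk))
    (acde μ (Y 0) z₀)
  simp only [matchingEstimator, Finset.sum_range, ← (hj _).1, ← (hk _).1]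
  have e₂ : |L| / (2 * κ * η N) * (1 / (N : ℝ) * ∑ i : Fin N, dist (X (k i) ω) (X i ω)) =
      |L| / (2 * κ) * (1 / (N * η N) * ∑ i : Fin N, dist (X (k i) ω) (X i ω)) := by
    field_simp
  have e₁ : |L| / (2 * κ * η N) * (1 / (N : ℝ) * ∑ i : Fin N, dist (X (j i) ω) (X i ω)) =
      |L| / (2 * κ) * (1 / (N * η N) * ∑ i : Fin N, dist (X (j i) ω) (X i ω)) := by
    field_simp
  rw [e₁, e₂] at hmain
  rw [← ENNReal.ofReal_mul hLκ, ← ENNReal.ofReal_mul hLκ]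
  refine (ENNReal.ofReal_le_ofReal hmain).trans (ENNReal.ofReal_add_le.trans
    (add_le_add ?_ ENNReal.ofReal_add_le))
  refine ENNReal.ofReal_add_le.trans (add_le_add_left (ENNReal.ofReal_add_le.trans
    (add_le_add_left (ENNReal.ofReal_add_le.trans (add_le_add_left ENNReal.ofReal_add_le _)) _)) _)
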